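/- **Model.** There are $n$ balls and $n$ bins with globally unique addresses $1,\dots,n$ that are known to all balls. Computation proceeds in synchronous rounds; in each round balls send messages to arbitrary bins, then bins receive them and send messages to balls that contacted them in this or an earlier round, then balls receive these messages and may commit to a bin. Balls use independent unbiased randomness. All logarithms are to base $2$; $\log^{(r)}$ is the $r$ times iterated logarithm and $\log^* x$ is the least $k\ge 0$ with $\log^{(k)}x\le 1$. An event holds w.h.p. if it fails with probability at most $1/n^c$, where $c>0$ is an arbitrary constant (a parameter of the algorithm, on which the constants hidden in $\mathcal O(\cdot)$ may depend). The algorithm must place every ball into a bin. **Algorithm $\mathcal A(l)$**, for an integer $l\ge 1$ with $l^2\le n$. If $l^2$ does not divide $n$, the last $n-l^2\lfloor n/l^2\rfloor$ bins are ignored; let $m=l^2\lfloor n/l^2\rfloor$ be the number of bins in use (so $m=n$ if $l^2\mid n$), and let $I_j=\{(j-1)l+1,\dots,jl\}$ for $1\le j\le m/l$, with indices modulo $m/l$. 1. (Round 1) With probability $1/l$, a ball picks a uniformly random interval $I_j$ and sends $\lceil (c+2)\log n\rceil$ random bits to all bins of $I_j$. Each bin that received messages acknowledges the ball with the smallest string;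 if two or more of the received strings are identical, it does not respond. 2. (Round 2) Each ball acknowledged by $I_j$ queries one uniformly random bin in each of $I_{j+1},\dots,I_{j+l-1}$ whether it acknowledged another ball; the bins reply. The ball becomes the coordinator of $I_j,I_{j+1},\dots,I_{j+k}$ for the maximal $k<l$ such that none of $I_{j+1},\dots,I_{j+k}$ acknowledged another ball. 3. (Round 3) Each ball contacts one uniformly random bin in use. 4. (Round 4) Each coordinator contacts its bins, which reply with the number of balls that contacted them in Round 3. 5. (Round 5) Each coordinator assigns up to three of these balls to each of its bins (a ball is left over only if all its bins got three balls), and tells its bins where their balls are to be redirected. 6. (Round 6) Each ball contacts the same bin as in Round 3; if the ball has been assigned to a bin, it is told so. 7. (Round 7) Each assigned ball informs the bin it has been assigned to that it is placed into it, and terminates. 8. (Rounds $8,9,\dots$, one phase $i=1,2,\dots$ per round) Each remaining ball sends requests to $\lfloor k(i)\rfloor$ independent uniformly random bins in use. Bins already containing at least two balls refuse all requests; every other bin receiving requests admits one arbitrary requesting ball; all requests are answered. A ball admitted by at least one bin commits to an arbitrary one of these bins, informs it in the next round, and terminates. Here $k(1)=\min\{2^{\alpha l},\log n\}$ and $k(i+1)=\min\{k(i)e^{\lfloor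 k(i)\rfloor/10},\log n\}$. **Theorem.** There is a constant $\alpha>0$ such that, however the arbitrary choices in Steps 5 and 8 are made (by rules, depending on the information that these steps refer to, that are fixed before the random choices): * For all $n$, $l$, $c$ as above, no bin ever contains more than three balls, and with probability one the algorithm terminates with all balls placed. * For all constants $c>0$ and $C>0$, all sufficiently large $n$, and all $l\le C\sqrt{\log n}$: $\mathcal A(l)$ terminates within $\log^* n-\log^* l+\mathcal O(1)$ rounds w.h.p.; each ball and each bin sends and receives $\mathcal O(1)$ messages in expectation; w.h.p. all balls send and receive $\mathcal O(\log n)$ messages; w.h.p. all bins send and receive $\mathcal O(\log n/\log\log n)$ messages; and the total number of messages is $\mathcal O(n)$ w.h.p. The hidden constants depend only on $c$ and $C$. * In particular, for every constant $c>0$, all sufficiently large $n$ and all $1\le r<\log^* n$, the choice $l=\lfloor\min\{\log^{(r)}n,\sqrt{\log n}\}\rfloor$ (which is $\lfloor\log^{(r)}n\rfloor$ if $r\ge2$) is admissible and $\mathcal A(l)$ terminates within $r+\mathcal O(1)$ rounds w.h.p., with a hidden constant depending only on $c$. -/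

import Mathlib

open MeasureTheory ProbabilityTheory
open scoped Classical ENNReal

namespace BallsIntoBins

/-! ## Iterated logarithms (all logarithms have base two) -/

/-- The `r` times iterated logarithm `log^(r) x`. -/
noncomputable def iterLog (r : ℕ) (x : ℝ) : ℝ := (Real.logb 2)^[r] x

/-- `log* x`: how often the logarithm has to be applied to `x` until the result is at most one. -/
noncomputable def logStar (x : ℝ) : ℕ := sInf {k : ℕ | iterLog k x ≤ 1}

/-! ## Parameters -/

/-- `n` balls and `n` bins, the interval length `l`, the constant `c` that controls the length of
the random strings, and the constant `α` that controls the initial number of requests.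
The bins beyond the largest multiple of `l ^ 2` that is at most `n` are ignored. -/
structure Params where
  n : ℕ
  l : ℕ
  c : ℝ
  α : ℝ
  one_le_l : 1 ≤ l
  sq_le_n : l ^ 2 ≤ n

namespace Params

variable (p : Params)

/-- The balls. -/
abbrev Ball : Type := Fin p.n

/-- The bins, given by their globally unique addresses. -/
abbrev Bin : Type := Fin p.n

/-- The number of intervals of `l` consecutive bins; it is a multiple of `l`, and equal to `n / l`
if `l ^ 2` divides `n`. -/
def numIntervals : ℕ := p.n / p.l ^ 2 * p.l

/-- The number of bins in use; it equals `n` if `l ^ 2` divides `n`. -/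
def numUsed : ℕ := p.numIntervals * p.l

lemma numIntervals_pos : 0 < p.numIntervals :=
  Nat.mul_pos (Nat.div_pos p.sq_le_n (pow_pos p.one_le_l 2)) p.one_le_l

lemma numUsed_pos : 0 < p.numUsed := Nat.mul_pos p.numIntervals_pos p.one_le_l

lemma numUsed_le : p.numUsed ≤ p.n := by
  have h : p.numUsed = p.n / p.l ^ 2 * p.l ^ 2 := by
    unfold numUsed numIntervals; ring
  rw [h]
  exact Nat.div_mul_le_self _ _

/-- The `s`-th bin of the interval `j`. -/
def binAt (j : Fin p.numIntervals) (s : Fin p.l) : p.Bin :=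
  ⟨j * p.l + s, by
    have h1 : (j : ℕ) * p.l + s < (j + 1) * p.l := by
      have := s.isLt
      nlinarith
    have h2 : ((j : ℕ) + 1) * p.l ≤ p.numIntervals * p.l := Nat.mul_le_mul_right _ j.isLt
    exact lt_of_lt_of_le (lt_of_lt_of_le h1 h2) p.numUsed_le⟩

/-- The interval that comes `s` places after interval `j`, indices taken cyclically. -/
def shift (j : Fin p.numIntervals) (s : ℕ) : Fin p.numIntervals :=
  ⟨(j + s) % p.numIntervals, Nat.mod_lt _ p.numIntervals_pos⟩

/-- The number of random bits attached to the messages of the first step. -/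
noncomputable def numBits : ℕ := ⌈(p.c + 2) * Real.logb 2 p.n⌉₊

end Params

/-! ## Random choices -/

/-- The random choices made by `n` balls. -/
inductive Coin (n : ℕ) : Type
  /-- whether ball `b` participates in the search for coordinators -/
  | participate (b : Fin n)
  /-- the interval ball `b` contacts if it participates -/
  | interval (b : Fin n)
  /-- the random string of ball `b` -/
  | bits (b : Fin n)
  /-- the position of the bin queried by ball `b` in the `s`-th interval after its own -/
  | query (b : Fin n) (s : ℕ)
  /-- the uniform bin contacted by ball `b` -/
  | target (b : Fin n)
  /-- the `s`-th bin ball `b` requests in phase `i` of the final part -/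
  | request (b : Fin n) (i s : ℕ)

namespace Params

variable (p : Params)

/-- The number of (equally likely) values of a random choice. A ball participates if the
corresponding choice among `l` values is `0`, so with probability `1 / l`. -/
noncomputable def size : Coin p.n → ℕ
  | .participate _ => p.l
  | .interval _ => p.numIntervals
  | .bits _ => 2 ^ p.numBits
  | .query _ _ => p.l
  | .target _ => p.numUsed
  | .request _ _ _ => p.numUsed

lemma size_pos (x : Coin p.n) : 0 < p.size x := by
  cases x
  · exact p.one_le_l
  · exact p.numIntervals_pos
  · exact pow_pos two_pos _
  · exact p.one_le_l
  · exact p.numUsed_pos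
  · exact p.numUsed_pos

/-- The outcomes of all random choices. -/
abbrev Outcome : Type := (x : Coin p.n) → Fin (p.size x)

/-- The uniform distribution of a single random choice. -/
noncomputable def coinLaw (x : Coin p.n) : Measure (Fin (p.size x)) := uniformOn Set.univ

instance coinLaw_isProbabilityMeasure (x : Coin p.n) : IsProbabilityMeasure (p.coinLaw x) := by
  have : Nonempty (Fin (p.size x)) := ⟨⟨0, p.size_pos x⟩⟩
  exact isProbabilityMeasure_uniformOn Set.finite_univ Set.univ_nonempty

/-- All random choices are independent and uniform. -/
noncomputable def prob : Measure p.Outcome := Measure.infinitePi p.coinLaw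

end Params

/-! ## Choices that the algorithm leaves open -/

/-- A rule for every choice that the algorithm leaves open.

* `assign B A` is the decision of a coordinator of the bins `B`, if `A v` is the set of balls that
  contacted bin `v`: every bin of `B` gets up to three of the balls that contacted a bin of `B`,
  and a ball is left over only if all bins of `B` got three balls.
* `grant i v R` is the ball that bin `v` admits in phase `i` if `R` are the requesting balls.
* `choose i b V` is the bin that ball `b` chooses in phase `i` if the bins `V` gave permission. -/
structure Rules (n : ℕ) where
  assign : Finset (Fin n) → (Fin n → Finset (Fin n)) → Fin n → Option (Fin n)
  assign_mem : ∀ B A b w, assign B A b = some w → b ∈ B.biUnion A ∧ w ∈ B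
  assign_le_three : ∀ B A w, (Finset.univ.filter fun b => assign B A b = some w).card ≤ 3
  assign_maximal : ∀ B A, (Finset.univ.filter fun b => (assign B A b).isSome).card =
    min (B.biUnion A).card (3 * B.card)
  grant : ℕ → Fin n → Finset (Fin n) → Fin n
  grant_mem : ∀ i v R, R.Nonempty → grant i v R ∈ R
  choose : ℕ → Fin n → Finset (Fin n) → Fin n
  choose_mem : ∀ i b V, V.Nonempty → choose i b V ∈ V

/-- Such rules exist: number the balls and the bins, and fill the bins one after another. -/
theorem Rules.nonempty (n : ℕ) : Nonempty (Rules n) := by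
  have key : ∀ S B : Finset (Fin n), ∃ f : Fin n → Option (Fin n),
      (∀ b w, f b = some w → b ∈ S ∧ w ∈ B) ∧
      (∀ w, (Finset.univ.filter fun b => f b = some w).card ≤ 3) ∧
      (Finset.univ.filter fun b => (f b).isSome).card = min S.card (3 * B.card) := by
    intro S B
    let g : Fin n → Option (Fin n) := fun b =>
      if h : ∃ hb : b ∈ S, (S.equivFin ⟨b, hb⟩ : ℕ) / 3 < B.card then
        some (B.equivFin.symm ⟨_, h.choose_spec⟩ : B) else none
    have hg : ∀ b w, g b = some w → ∃ hb : b ∈ S, ∃ hw : w ∈ B,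
        (S.equivFin ⟨b, hb⟩ : ℕ) / 3 = B.equivFin ⟨w, hw⟩ := by
      intro b w h
      simp only [g] at h
      split_ifs at h with h1
      have h2 := Option.some.inj h
      subst h2
      exact ⟨h1.choose, Subtype.coe_prop _, by simp⟩
    refine ⟨g, fun b w h => ?_, fun w => ?_, ?_⟩
    · obtain ⟨hb, hw, -⟩ := hg b w h
      exact ⟨hb, hw⟩
    · by_cases hw : w ∈ B
      · have : (Finset.univ.filter fun b => g b = some w).card ≤
            (Finset.Ico (3 * (B.equivFin ⟨w, hw⟩ : ℕ)) (3 * (B.equivFin ⟨w, hw⟩ : ℕ) + 3)).card := by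
          refine Finset.card_le_card_of_injOn
            (fun b => if hb : b ∈ S then (S.equivFin ⟨b, hb⟩ : ℕ) else 0) ?_ ?_
          · intro b hb
            obtain ⟨h1, h2, h3⟩ := hg b w (by simpa using hb)
            simp only [h1, dif_pos, Finset.coe_Ico, Set.mem_Ico]
            omega
          · intro b hb b' hb' h
            obtain ⟨h1, -⟩ := hg b w (by simpa using hb)
            obtain ⟨h1', -⟩ := hg b' w (by simpa using hb')
            simp only [h1, h1', dif_pos] at h
            have := S.equivFin.injective (Fin.ext h)
            simpa using this
        simpa using this
      · have : (Finset.univ.filter fun b => g b = some w) = ∅ := by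
          ext b
          simp only [Finset.mem_filter, Finset.mem_univ, true_and, Finset.notMem_empty, iff_false]
          intro h
          exact hw (hg b w h).2.1
        simp [this]
    · have h1 : (Finset.univ.filter fun b => (g b).isSome).card =
          (Finset.range (min S.card (3 * B.card))).card := by
        refine Finset.card_bij
          (fun b _ => if hb : b ∈ S then (S.equivFin ⟨b, hb⟩ : ℕ) else 0) ?_ ?_ ?_
        · intro b hb
          obtain ⟨w, hw⟩ := Option.isSome_iff_exists.1 (Finset.mem_filter.1 hb).2
          obtain ⟨h1, h2, h3⟩ := hg b w hw
          have h4 := (S.equivFin ⟨b, h1⟩).isLt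
          have h5 := (B.equivFin ⟨w, h2⟩).isLt
          simp only [h1, dif_pos, Finset.mem_range]
          omega
        · intro b hb b' hb' h
          obtain ⟨w, hw⟩ := Option.isSome_iff_exists.1 (Finset.mem_filter.1 hb).2
          obtain ⟨w', hw'⟩ := Option.isSome_iff_exists.1 (Finset.mem_filter.1 hb').2
          obtain ⟨h1, -⟩ := hg b w hw
          obtain ⟨h1', -⟩ := hg b' w' hw'
          simp only [h1, h1', dif_pos] at h
          have := S.equivFin.injective (Fin.ext h)
          simpa using this
        · intro t ht
          rw [Finset.mem_range, lt_min_iff] at ht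
          have hm : ((S.equivFin.symm ⟨t, ht.1⟩ : S) : Fin n) ∈ S := Subtype.coe_prop _
          have hc : ∃ hb : ((S.equivFin.symm ⟨t, ht.1⟩ : S) : Fin n) ∈ S,
              (S.equivFin ⟨_, hb⟩ : ℕ) / 3 < B.card := ⟨hm, by simp; omega⟩
          refine ⟨(S.equivFin.symm ⟨t, ht.1⟩ : S), ?_, ?_⟩
          · simp only [g, Finset.mem_filter, Finset.mem_univ, true_and, dif_pos hc, Option.isSome_some]
          · simp
      simpa using h1
  choose f hf1 hf2 hf3 using key
  exact ⟨{
    assign := fun B A => f (B.biUnion A) B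
    assign_mem := fun B A => hf1 _ _
    assign_le_three := fun B A => hf2 _ _
    assign_maximal := fun B A => hf3 _ _
    grant := fun _ v R => if h : R.Nonempty then h.choose else v
    grant_mem := fun i v R h => by simp only [dif_pos h]; exact h.choose_spec
    choose := fun _ b V => if h : V.Nonempty then h.choose else b
    choose_mem := fun i b V h => by simp only [dif_pos h]; exact h.choose_spec }⟩

/-! ## The execution

Throughout, `ω` is the outcome of the random choices and `ρ` settles the choices left open. -/

namespace Params

variable (p : Params) (ρ : Rules p.n) (ω : p.Outcome)

/-! ### Finding coordinators -/

/-- Ball `b` contacts the bins of interval `j` (all of them). -/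
def Contacts (b : p.Ball) (j : Fin p.numIntervals) : Prop :=
  (ω (.participate b)).val = 0 ∧ ω (.interval b) = j

/-- The bins of interval `j` acknowledge ball `b`: among the strings they received, no two are
identical, and the one of `b` represents the smallest number. (All bins of an interval receive the
same messages in this step.) -/
def Acknowledged (b : p.Ball) (j : Fin p.numIntervals) : Prop :=
  p.Contacts ω b j ∧
  (∀ b₁ b₂, p.Contacts ω b₁ j → p.Contacts ω b₂ j →
    (ω (.bits b₁)).val = (ω (.bits b₂)).val → b₁ = b₂) ∧
  ∀ b', p.Contacts ω b' j → (ω (.bits b)).val ≤ (ω (.bits b')).val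

/-- Ball `b` queries bin `v`: it was acknowledged by some interval `j`, and `v` is the random bin
it chose from one of the `l - 1` intervals that follow. -/
def Queries (b : p.Ball) (v : p.Bin) : Prop :=
  ∃ j s, p.Acknowledged ω b j ∧ 1 ≤ s ∧ s < p.l ∧ v = p.binAt (p.shift j s) (ω (.query b s))

/-- Ball `b` becomes the coordinator of interval `i`: for some interval `j` that acknowledged `b`,
`i` is `j` or one of the `l - 1` intervals following it, and none of the intervals after `j` up to
and including `i` has acknowledged another ball. -/
def Coordinates (b : p.Ball) (i : Fin p.numIntervals) : Prop :=
  ∃ j s, p.Acknowledged ω b j ∧ s < p.l ∧ i = p.shift j s ∧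
    ∀ s', 1 ≤ s' → s' ≤ s → ∀ b', b' ≠ b → ¬ p.Acknowledged ω b' (p.shift j s')

/-- The bins coordinated by ball `b`. -/
noncomputable def block (b : p.Ball) : Finset p.Bin :=
  Finset.univ.filter fun v => ∃ i s, v = p.binAt i s ∧ p.Coordinates ω b i

/-! ### Placing balls by coordinators -/

/-- The bin ball `b` contacts, chosen uniformly from the bins in use. -/
noncomputable def target (b : p.Ball) : p.Bin := Fin.castLE p.numUsed_le (ω (.target b))

/-- The balls that contacted bin `v`. -/
noncomputable def arrivals (v : p.Bin) : Finset p.Ball :=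
  Finset.univ.filter fun b => p.target ω b = v

/-- The bin ball `b` is assigned to by the coordinator of the bin it contacted, if there is a
coordinator and it assigned the ball to a bin. -/
noncomputable def assigned (b : p.Ball) : Option p.Bin :=
  if h : ∃ a, p.target ω b ∈ p.block ω a then
    ρ.assign (p.block ω h.choose) (p.arrivals ω) b
  else none

/-! ### The final part: phases `i = 0, 1, 2, …`, one per round -/

/-- The (real-valued) number of requests per remaining ball in phase `i`. As in all phases, it is
capped at `log n` in the initial phase. -/
noncomputable def k : ℕ → ℝ
  | 0 => min ((2 : ℝ) ^ (p.α * p.l)) (Real.logb 2 p.n)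
  | i + 1 => min (k i * Real.exp (⌊k i⌋₊ / 10)) (Real.logb 2 p.n)

/-- The bin that receives the `s`-th request of ball `b` in phase `i`. -/
noncomputable def requestBin (b : p.Ball) (i s : ℕ) : p.Bin :=
  Fin.castLE p.numUsed_le (ω (.request b i s))

/-- The number of balls in bin `v`, if `pl` is the current placement. -/
noncomputable def load (pl : p.Ball → Option p.Bin) (v : p.Bin) : ℕ :=
  (Finset.univ.filter fun b => pl b = some v).card

/-- The number of requests ball `b` sends to bin `v` in phase `i`: remaining balls contact
`⌊k i⌋` independent uniform bins. -/
noncomputable def requests (pl : p.Ball → Option p.Bin) (i : ℕ) (b : p.Ball) (v : p.Bin) : ℕ :=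
  if pl b = none then ((Finset.range ⌊p.k i⌋₊).filter fun s => p.requestBin ω b i s = v).card
  else 0

/-- The balls requesting permission from bin `v` in phase `i`. -/
noncomputable def requesters (pl : p.Ball → Option p.Bin) (i : ℕ) (v : p.Bin) : Finset p.Ball :=
  Finset.univ.filter fun b => 0 < p.requests ω pl i b v

/-- The bins that give permission to ball `b` in phase `i`: bins that already contain two or more
balls refuse all requests, any other bin admits one of the requesting balls. -/
noncomputable def permissions (pl : p.Ball → Option p.Bin) (i : ℕ) (b : p.Ball) : Finset p.Bin :=
  Finset.univ.filter fun v => p.load pl v < 2 ∧ (p.requesters ω pl i v).Nonempty ∧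
    ρ.grant i v (p.requesters ω pl i v) = b

/-- The placement before phase `i`. -/
noncomputable def placement : ℕ → p.Ball → Option p.Bin
  | 0 => p.assigned ρ ω
  | i + 1 => fun b =>
    if placement i b = none ∧ (p.permissions ρ ω (placement i) i b).Nonempty then
      some (ρ.choose i b (p.permissions ρ ω (placement i) i b))
    else placement i b

/-! ### Rounds and messages

In a round the balls send messages to bins, and then the bins send messages to balls. Rounds
`1` and `2` find the coordinators, rounds `3` to `7` place balls by coordinators, and phase `i` of
the final part is round `8 + i`. -/

/-- The bin into which ball `b` has been placed by the end of round `t`, if any. -/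
noncomputable def position (t : ℕ) (b : p.Ball) : Option p.Bin :=
  if t < 7 then none else p.placement ρ ω (t - 7) b

/-- The number of messages ball `b` sends to bin `v` in round `t`.
Round 1: participating balls contact an interval. Round 2: acknowledged balls query the following
intervals. Round 3: balls contact a uniform bin. Round 4: coordinators contact their bins.
Round 5: coordinators tell their bins where balls are redirected to. Round 6: balls contact the
bin of round 3 again. Round 7: assigned balls inform the bin they are placed into. Round `8 + i`:
remaining balls send their requests of phase `i`, and balls that chose a bin at the end of the
preceding phase inform that bin. -/
noncomputable def ballMsg : ℕ → p.Ball → p.Bin → ℕ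
  | 0, _, _ => 0
  | 1, b, v => if ∃ j s, v = p.binAt j s ∧ p.Contacts ω b j then 1 else 0
  | 2, b, v => if p.Queries ω b v then 1 else 0
  | 3, b, v => if p.target ω b = v then 1 else 0
  | 4, b, v => if v ∈ p.block ω b then 1 else 0
  | 5, b, v => if v ∈ p.block ω b then 1 else 0
  | 6, b, v => if p.target ω b = v then 1 else 0
  | 7, b, v => if p.assigned ρ ω b = some v then 1 else 0
  | i + 8, b, v => p.requests ω (p.placement ρ ω i) i b v +
      if 1 ≤ i ∧ p.placement ρ ω (i - 1) b = none ∧ p.placement ρ ω i b = some v then 1 else 0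

/-- The number of messages bin `v` sends to ball `b` in round `t`.
Round 1: acknowledgements. Round 2: replies to all queries. Round 4: the number of balls received
in round 3, sent to the coordinator. Round 6: the assigned bin, sent to the balls that have been
assigned. Round `8 + i`: every request of phase `i` is granted or declined. -/
noncomputable def binMsg : ℕ → p.Bin → p.Ball → ℕ
  | 1, v, b => if ∃ j s, v = p.binAt j s ∧ p.Acknowledged ω b j then 1 else 0
  | 2, v, b => if p.Queries ω b v then 1 else 0
  | 4, v, b => if v ∈ p.block ω b then 1 else 0
  | 6, v, b => if p.target ω b = v ∧ (p.assigned ρ ω b).isSome then 1 else 0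
  | i + 8, v, b => p.requests ω (p.placement ρ ω i) i b v
  | _, _, _ => 0

/-- By the end of round `t`, all balls are placed and the communication has ended. -/
def TerminatedBy (t : ℕ) : Prop :=
  (∀ b, (p.position ρ ω t b).isSome) ∧
  ∀ t', t < t' → ∀ b v, p.ballMsg ρ ω t' b v = 0 ∧ p.binMsg ρ ω t' v b = 0

/-- The number of rounds until termination (`⊤` if the algorithm does not terminate). -/
noncomputable def rounds : ℕ∞ := ⨅ (t : ℕ) (_ : p.TerminatedBy ρ ω t), (t : ℕ∞)

/-- The number of messages sent by ball `b`. -/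
noncomputable def sentByBall (b : p.Ball) : ℝ≥0∞ :=
  ∑' t : ℕ, ((∑ v, p.ballMsg ρ ω t b v : ℕ) : ℝ≥0∞)

/-- The number of messages received by ball `b`. -/
noncomputable def receivedByBall (b : p.Ball) : ℝ≥0∞ :=
  ∑' t : ℕ, ((∑ v, p.binMsg ρ ω t v b : ℕ) : ℝ≥0∞)

/-- The number of messages sent by bin `v`. -/
noncomputable def sentByBin (v : p.Bin) : ℝ≥0∞ :=
  ∑' t : ℕ, ((∑ b, p.binMsg ρ ω t v b : ℕ) : ℝ≥0∞)

/-- The number of messages received by bin `v`. -/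
noncomputable def receivedByBin (v : p.Bin) : ℝ≥0∞ :=
  ∑' t : ℕ, ((∑ b, p.ballMsg ρ ω t b v : ℕ) : ℝ≥0∞)

/-- The total number of messages. -/
noncomputable def totalMessages : ℝ≥0∞ :=
  ∑ b, p.sentByBall ρ ω b + ∑ v, p.sentByBin ρ ω v

/-- With high probability: the event `E` fails with probability at most `1 / n ^ c`. -/
def WHP (E : p.Outcome → Prop) : Prop :=
  p.prob {ω | ¬ E ω} ≤ ENNReal.ofReal (1 / (p.n : ℝ) ^ p.c)

end Params

end BallsIntoBins

namespace BallsIntoBins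

/-! ## Products of probability measures -/

section Product

variable {ι : Type*} {X : ι → Type*} {β : Type*}

/-- The family that agrees with `y` on `S` and with `x` elsewhere. -/
noncomputable def splice (S : Set ι) (x y : ∀ i, X i) : ∀ i, X i := fun i => if i ∈ S then y i else x i

lemma splice_of_mem {S : Set ι} {i : ι} (h : i ∈ S) (x y : ∀ i, X i) : splice S x y i = y i :=
  if_pos h

lemma splice_of_notMem {S : Set ι} {i : ι} (h : i ∉ S) (x y : ∀ i, X i) : splice S x y i = x i :=
  if_neg h

lemma DependsOn.splice_eq {f : (∀ i, X i) → β} {T S : Set ι} (hf : DependsOn f T) (h : T ⊆ S)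
    (x y : ∀ i, X i) : f (splice S x y) = f y :=
  hf fun _ hi => splice_of_mem (h hi) x y

lemma DependsOn.splice_eq_left {f : (∀ i, X i) → β} {T S : Set ι} (hf : DependsOn f T)
    (h : Disjoint T S) (x y : ∀ i, X i) : f (splice S x y) = f x :=
  hf fun _ hi => splice_of_notMem (Set.disjoint_left.1 h hi) x y

variable [∀ i, MeasurableSpace (X i)]

lemma measurable_splice (S : Set ι) :
    Measurable fun z : (∀ i, X i) × (∀ i, X i) => splice S z.1 z.2 := by
  refine measurable_pi_lambda _ fun i => ?_
  by_cases h : i ∈ S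
  · simp only [splice, h, if_true]; fun_prop
  · simp only [splice, h, if_false]; fun_prop

/-- The function factors through a finite discrete product. Measurability is not automatic here: the
number of phases is unbounded, so there are infinitely many coins. -/
lemma DependsOn.measurable [∀ i, Finite (X i)] [∀ i, DiscreteMeasurableSpace (X i)]
    [∀ i, Nonempty (X i)]
    [MeasurableSpace β] {f : (∀ i, X i) → β} {S : Set ι} (hf : DependsOn f S) (hS : S.Finite) :
    Measurable f := by
  have : Finite S := hS
  have := Fintype.ofFinite S
  let x₀ : ∀ i, X i := fun i => Classical.arbitrary _
  have h : f = (fun y : ∀ i : S, X i => f fun i => if h : i ∈ S then y ⟨i, h⟩ else x₀ i) ∘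
      fun x (i : S) => x i := by
    funext x
    refine hf fun i hi => ?_
    simp [hi]
  rw [h]
  exact (Measurable.of_discrete).comp (measurable_pi_lambda _ fun i => measurable_pi_apply _)

variable (μ : ∀ i, Measure (X i)) [∀ i, IsProbabilityMeasure (μ i)]

/-- Resampling a part of the coordinates does not change the distribution. -/
theorem measurePreserving_splice (S : Set ι) :
    MeasurePreserving (fun z : (∀ i, X i) × (∀ i, X i) => splice S z.1 z.2)
      ((Measure.infinitePi μ).prod (Measure.infinitePi μ)) (Measure.infinitePi μ) := by
  refine ⟨measurable_splice S, Measure.eq_infinitePi μ fun s t ht => ?_⟩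
  rw [Measure.map_apply (measurable_splice S) (MeasurableSet.pi s.countable_toSet fun i _ => ht i)]
  have : (fun z : (∀ i, X i) × (∀ i, X i) => splice S z.1 z.2) ⁻¹' (Set.pi s t) =
      (Set.pi (s.filter (· ∉ S) : Finset ι) t) ×ˢ (Set.pi (s.filter (· ∈ S) : Finset ι) t) := by
    ext z
    simp only [Set.mem_preimage, Set.mem_pi, Finset.mem_coe, Set.mem_prod, Finset.mem_filter, splice]
    constructor
    · intro h
      exact ⟨fun i hi => by simpa [hi.2] using h i hi.1, fun i hi => by simpa [hi.2] using h i hi.1⟩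
    · rintro ⟨h1, h2⟩ i hi
      split_ifs with h
      exacts [h2 i ⟨hi, h⟩, h1 i ⟨hi, h⟩]
  rw [this, Measure.prod_prod, Measure.infinitePi_pi _ fun i _ => ht i,
    Measure.infinitePi_pi _ fun i _ => ht i, mul_comm, Finset.prod_filter_mul_prod_filter_not]

/-- The inner integral is the conditional expectation given the coordinates outside `S`. This takes
the place of conditional probabilities throughout. -/
lemma lintegral_splice (S : Set ι) {f : (∀ i, X i) → ℝ≥0∞} (hf : Measurable f) :
    ∫⁻ x, f x ∂Measure.infinitePi μ =
      ∫⁻ x, ∫⁻ y, f (splice S x y) ∂Measure.infinitePi μ ∂Measure.infinitePi μ := by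
  rw [← (measurePreserving_splice μ S).lintegral_comp hf, lintegral_prod]
  exact (hf.comp (measurable_splice S)).aemeasurable

lemma integral_splice (S : Set ι) {f : (∀ i, X i) → ℝ} (hf : Measurable f) {B : ℝ}
    (hB : ∀ x, |f x| ≤ B) :
    ∫ x, f x ∂Measure.infinitePi μ =
      ∫ x, ∫ y, f (splice S x y) ∂Measure.infinitePi μ ∂Measure.infinitePi μ := by
  have h := (measurePreserving_splice μ S)
  rw [← h.map_eq, integral_map h.measurable.aemeasurable hf.aestronglyMeasurable, h.map_eq]
  refine integral_prod _ (Integrable.of_bound (C := B) ?_ ?_)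
  · exact (hf.comp (measurable_splice S)).aestronglyMeasurable
  · exact Filter.Eventually.of_forall fun z => hB _

/-- If `f` and `g` depend on disjoint sets of coordinates, then they are independent. -/
lemma lintegral_mul_of_dependsOn {S T : Set ι} (hST : Disjoint S T) {f g : (∀ i, X i) → ℝ≥0∞}
    (hf : DependsOn f S) (hg : DependsOn g T) (mf : Measurable f) (mg : Measurable g) :
    ∫⁻ x, f x * g x ∂Measure.infinitePi μ =
      (∫⁻ x, f x ∂Measure.infinitePi μ) * ∫⁻ x, g x ∂Measure.infinitePi μ := by
  rw [lintegral_splice μ S (f := fun x => f x * g x) (mf.mul mg)]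
  simp only [DependsOn.splice_eq hf subset_rfl, DependsOn.splice_eq_left hg hST.symm]
  simp only [lintegral_mul_const _ mf, lintegral_const_mul _ mg]

lemma lintegral_prod_of_dependsOn {κ : Type*} (s : Finset κ) (S : κ → Set ι)
    (hS : Pairwise fun a b => Disjoint (S a) (S b)) (f : κ → (∀ i, X i) → ℝ≥0∞)
    (hf : ∀ a, DependsOn (f a) (S a)) (mf : ∀ a, Measurable (f a)) :
    ∫⁻ x, ∏ a ∈ s, f a x ∂Measure.infinitePi μ =
      ∏ a ∈ s, ∫⁻ x, f a x ∂Measure.infinitePi μ := by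
  induction s using Finset.induction_on with
  | empty => simp
  | insert a s ha ih =>
    simp only [Finset.prod_insert ha]
    rw [lintegral_mul_of_dependsOn μ (S := S a) (T := ⋃ b ∈ s, S b) _ (hf a) _ (mf a), ih]
    · exact Finset.measurable_fun_prod _ fun b _ => mf b
    · simp only [Set.disjoint_iUnion_right]
      intro b hb
      exact hS (by rintro rfl; exact ha hb)
    · intro x y h
      refine Finset.prod_congr rfl fun b hb => hf b fun i hi => h i ?_
      exact Set.mem_biUnion hb hi

lemma measure_inter_of_dependsOn {S T : Set ι} (hST : Disjoint S T) {E E' : Set (∀ i, X i)}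
    (hE : DependsOn (fun x => x ∈ E) S) (hE' : DependsOn (fun x => x ∈ E') T)
    (mE : MeasurableSet E) (mE' : MeasurableSet E') :
    Measure.infinitePi μ (E ∩ E') = Measure.infinitePi μ E * Measure.infinitePi μ E' := by
  have h := lintegral_mul_of_dependsOn μ hST (f := E.indicator 1) (g := E'.indicator 1)
    (fun x y h => by have := hE h; simp only [eq_iff_iff] at this; simp [Set.indicator, this])
    (fun x y h => by have := hE' h; simp only [eq_iff_iff] at this; simp [Set.indicator, this])
    (measurable_one.indicator mE) (measurable_one.indicator mE')
  rw [lintegral_indicator_one mE, lintegral_indicator_one mE'] at h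
  rw [← h, ← lintegral_indicator_one (mE.inter mE')]
  congr 1
  funext x
  simp only [Set.indicator, Set.mem_inter_iff, Pi.one_apply]
  split_ifs <;> simp_all

/-- The exponential moments of the number of those of the independent events `E a` that occur, if
each of them has probability at most `q`. -/
lemma lintegral_pow_card_le {κ : Type*} (s : Finset κ) (S : κ → Set ι)
    (hS : Pairwise fun a b => Disjoint (S a) (S b)) (E : κ → Set (∀ i, X i))
    (hE : ∀ a, DependsOn (fun x => x ∈ E a) (S a)) (mE : ∀ a, MeasurableSet (E a)) {q y : ℝ}
    (hq : 0 ≤ q) (hy : 0 ≤ y)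
    (hEq : ∀ a ∈ s, Measure.infinitePi μ (E a) ≤ ENNReal.ofReal q) :
    ∫⁻ x, ENNReal.ofReal (1 + y) ^ (s.filter fun a => x ∈ E a).card ∂Measure.infinitePi μ ≤
      ENNReal.ofReal (Real.exp (y * (q * s.card))) := by
  -- Each event contributes the factor `1 + y` or `1`. The factors are independent, and each has
  -- mean at most `1 + y * q ≤ exp (y * q)`.
  have h1 : ∀ x, ENNReal.ofReal (1 + y) ^ (s.filter fun a => x ∈ E a).card =
      ∏ a ∈ s, (1 + ENNReal.ofReal y * (E a).indicator 1 x) := by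
    intro x
    rw [← Finset.prod_const, Finset.prod_filter]
    refine Finset.prod_congr rfl fun a _ => ?_
    split_ifs with h
    · simp [h, ENNReal.ofReal_add zero_le_one hy]
    · simp [h]
  have mI : ∀ a, Measurable ((E a).indicator (1 : (∀ i, X i) → ℝ≥0∞)) :=
    fun a => measurable_one.indicator (mE a)
  simp only [h1]
  rw [lintegral_prod_of_dependsOn μ s S hS]
  · calc _ ≤ ∏ a ∈ s, ENNReal.ofReal (Real.exp (y * q)) := by
          refine Finset.prod_le_prod' fun a ha => ?_
          rw [lintegral_add_left measurable_const, lintegral_const_mul _ (mI a),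
            lintegral_indicator_one (mE a)]
          simp only [lintegral_const, measure_univ, mul_one]
          calc _ ≤ 1 + ENNReal.ofReal y * ENNReal.ofReal q := by gcongr; exact hEq a ha
            _ = ENNReal.ofReal (y * q + 1) := by
              rw [← ENNReal.ofReal_mul hy, add_comm, ENNReal.ofReal_add (by positivity) zero_le_one,
                ENNReal.ofReal_one]
            _ ≤ _ := ENNReal.ofReal_le_ofReal (Real.add_one_le_exp _)
      _ = _ := by
        rw [Finset.prod_const, ← ENNReal.ofReal_pow (Real.exp_nonneg _), ← Real.exp_nat_mul]
        congr 2; ring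
  · intro a x x' h
    have := hE a h
    simp only [eq_iff_iff] at this
    simp [Set.indicator, this]
  · exact fun a => ((mI a).const_mul _).const_add _

/-- Markov's inequality for exponential moments. -/
lemma measure_card_ge_le_of_lintegral_pow {Ω : Type*} [MeasurableSpace Ω] (P : Measure Ω)
    (N : Ω → ℕ) (mN : Measurable N) {z B t : ℝ} (hz : 1 ≤ z)
    (h : ∫⁻ x, ENNReal.ofReal z ^ N x ∂P ≤ ENNReal.ofReal B) :
    P {x | t ≤ N x} ≤ ENNReal.ofReal (z ^ (-t) * B) := by
  have hz0 : 0 < z := by linarith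
  have h1 := mul_meas_ge_le_lintegral (μ := P) (f := fun x => ENNReal.ofReal z ^ N x)
    ((measurable_of_countable fun k : ℕ => ENNReal.ofReal z ^ k).comp mN) (ENNReal.ofReal (z ^ t))
  have h2 : {x | t ≤ N x} ⊆ {x | ENNReal.ofReal (z ^ t) ≤ ENNReal.ofReal z ^ N x} := by
    intro x hx
    simp only [Set.mem_ofPred_eq] at hx ⊢
    rw [← ENNReal.ofReal_pow hz0.le, ← Real.rpow_natCast]
    exact ENNReal.ofReal_le_ofReal (Real.rpow_le_rpow_of_exponent_le hz hx)
  have h3 : 0 < z ^ t := Real.rpow_pos_of_pos hz0 _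
  rw [Real.rpow_neg hz0.le, ENNReal.ofReal_mul (by positivity), ENNReal.ofReal_inv_of_pos h3]
  calc P {x | t ≤ N x} ≤ P _ := measure_mono h2
    _ ≤ (ENNReal.ofReal (z ^ t))⁻¹ * (∫⁻ x, ENNReal.ofReal z ^ N x ∂P) := by
      rw [mul_comm, ← div_eq_mul_inv, ENNReal.le_div_iff_mul_le (by simp [h3]) (by simp), mul_comm]
      exact h1
    _ ≤ _ := by gcongr

end Product

end BallsIntoBins

namespace BallsIntoBins

/-! ## Bounded differences -/

section BoundedDifferences

/-- A function of finitely many finite coordinates is bounded. -/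
lemma exists_bound_of_dependsOn {ι : Type*} {X : ι → Type*} [∀ i, Finite (X i)]
    [∀ i, Nonempty (X i)] {f : (∀ i, X i) → ℝ} {F : Finset ι}
    (hf : DependsOn f F) : ∃ B, ∀ x, |f x| ≤ B := by
  let x₀ : ∀ i, X i := fun i => Classical.arbitrary _
  have hfin : (Set.range fun y : ∀ i : F, X i =>
      |f fun i => if h : i ∈ F then y ⟨i, h⟩ else x₀ i|).Finite := Set.finite_range _
  obtain ⟨B, hB⟩ := hfin.bddAbove
  refine ⟨B, fun x => hB ⟨fun i => x i, ?_⟩⟩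
  refine congrArg abs (hf fun i hi => ?_)
  simp only [Finset.mem_coe] at hi
  simp [hi]

variable {ι : Type*} {X : ι → Type*} [∀ i, MeasurableSpace (X i)] [∀ i, Finite (X i)]
  [∀ i, DiscreteMeasurableSpace (X i)] (μ : ∀ i, Measure (X i)) [∀ i, IsProbabilityMeasure (μ i)]

/-- Exponential moments of functions with bounded differences. -/
theorem integral_exp_sub_le [∀ i, Nonempty (X i)] {c : ℝ} (t : ℝ) (F : Finset ι) :
    ∀ f : (∀ i, X i) → ℝ, DependsOn f F →
    (∀ i ∈ F, ∀ x y, |f (splice {i} x y) - f x| ≤ c) →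
    ∫ x, Real.exp (t * (f x - ∫ y, f y ∂Measure.infinitePi μ)) ∂Measure.infinitePi μ ≤
      Real.exp (F.card * (c ^ 2 * t ^ 2 / 2)) := by
  induction F using Finset.induction_on with
  | empty =>
    intro f hf _
    let x₀ : ∀ i, X i := fun i => Classical.arbitrary _
    have h : ∀ x, f x = f x₀ := fun x => hf (by simp)
    simp [h]
  | insert i F hi ih =>
    intro f hf hc
    set P := Measure.infinitePi μ
    obtain ⟨B, hB⟩ := exists_bound_of_dependsOn hf
    have mf : Measurable f := DependsOn.measurable hf (Finset.finite_toSet _)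
    -- average over coordinate `i`
    set g : (∀ i, X i) → ℝ := fun x => ∫ y, f (splice {i} x y) ∂P with hg
    have ms : ∀ x, Measurable fun y => f (splice {i} x y) := fun x =>
      mf.comp ((measurable_splice {i}).comp measurable_prodMk_left)
    have is : ∀ x, Integrable (fun y => f (splice {i} x y)) P := fun x =>
      Integrable.of_bound (C := B) (ms x).aestronglyMeasurable
        (Filter.Eventually.of_forall fun y => hB _)
    have dg : DependsOn g F := by
      intro x x' h
      simp only [hg]
      congr 1
      funext y
      refine hf fun j hj => ?_
      by_cases hji : j = i
      · simp [splice, hji]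
      · have hjF : j ∈ F := by simpa [hji] using hj
        simp [splice, hji, h j hjF]
    have mg : Measurable g := DependsOn.measurable dg (Finset.finite_toSet _)
    have hgB : ∀ x, |g x| ≤ B := fun x => by
      have := norm_integral_le_of_norm_le_const (μ := P) (f := fun y => f (splice {i} x y))
        (C := B) (Filter.Eventually.of_forall fun y => hB _)
      simpa using this
    have hgf : ∫ x, g x ∂P = ∫ x, f x ∂P := (integral_splice μ {i} mf hB).symm
    -- Resamplings at different coordinates commute, so averaging over `i` keeps the differences in
    -- the other coordinates bounded by `c`.
    have hcg : ∀ j ∈ F, ∀ x y, |g (splice {j} x y) - g x| ≤ c := by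
      intro j hj x y
      have hne : j ≠ i := by rintro rfl; exact hi hj
      have h1 : ∀ z, splice {i} (splice {j} x y) z = splice {j} (splice {i} x z) y := by
        intro z
        funext k
        by_cases hki : k = i
        · subst hki
          simp [splice, hne.symm]
        · by_cases hkj : k = j
          · simp [splice, hkj, hne]
          · simp [splice, hki, hkj]
      simp only [hg]
      rw [← integral_sub (is _) (is _)]
      have := norm_integral_le_of_norm_le_const (μ := P)
        (f := fun z => f (splice {i} (splice {j} x y) z) - f (splice {i} x z))
        (C := c) (Filter.Eventually.of_forall fun z => by
          rw [h1]; exact hc j (Finset.mem_insert_of_mem hj) _ _)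
      simpa using this
    -- Hoeffding's lemma for the single coordinate `i`: the values lie within `c` of `f x`, and `g
    -- x` is their mean. Together with the induction hypothesis for `g` this is the usual martingale
    -- argument.
    have key : ∀ x, ∫ y, Real.exp (t * (f (splice {i} x y) - g x)) ∂P ≤
        Real.exp (c ^ 2 * t ^ 2 / 2) := by
      intro x
      have hb : ∀ᵐ y ∂P, f (splice {i} x y) ∈ Set.Icc (f x - c) (f x + c) :=
        Filter.Eventually.of_forall fun y => by
          have := abs_le.1 (hc i (Finset.mem_insert_self _ _) x y)
          constructor <;> linarith [this.1, this.2]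
      have h := (hasSubgaussianMGF_of_mem_Icc (ms x).aemeasurable hb).mgf_le t
      simp only [mgf] at h
      refine h.trans (Real.exp_le_exp.2 (le_of_eq ?_))
      have : f x + c - (f x - c) = 2 * c := by ring
      rw [this]
      simp [mul_div_assoc]
    have hbd : ∀ x, |t * (f x - ∫ y, f y ∂P)| ≤ |t| * (B + B) := by
      intro x
      rw [abs_mul]
      gcongr
      have h1 := abs_sub (f x) (∫ y, f y ∂P)
      have h2 : |∫ y, f y ∂P| ≤ B := by
        have := norm_integral_le_of_norm_le_const (μ := P) (f := f)
          (C := B) (Filter.Eventually.of_forall fun y => hB _)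
        simpa using this
      linarith [hB x]
    rw [integral_splice μ {i} (B := Real.exp (|t| * (B + B))) (by fun_prop)
      (fun x => by
        rw [abs_of_nonneg (Real.exp_nonneg _)]
        exact Real.exp_le_exp.2 ((le_abs_self _).trans (hbd x)))]
    have h2 : ∀ x, ∫ y, Real.exp (t * (f (splice {i} x y) - ∫ y, f y ∂P)) ∂P ≤
        Real.exp (c ^ 2 * t ^ 2 / 2) * Real.exp (t * (g x - ∫ y, g y ∂P)) := by
      intro x
      have : ∀ y, Real.exp (t * (f (splice {i} x y) - ∫ y, f y ∂P)) =
          Real.exp (t * (f (splice {i} x y) - g x)) * Real.exp (t * (g x - ∫ y, g y ∂P)) := by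
        intro y
        rw [← Real.exp_add, hgf]; ring_nf
      simp only [this]
      rw [integral_mul_const]
      exact mul_le_mul_of_nonneg_right (key x) (Real.exp_nonneg _)
    have hgi : Integrable (fun x => Real.exp (t * (g x - ∫ y, g y ∂P))) P := by
      refine Integrable.of_bound (C := Real.exp (|t| * (B + |∫ y, g y ∂P|)))
        (Measurable.aestronglyMeasurable (by fun_prop)) (Filter.Eventually.of_forall fun x => ?_)
      rw [Real.norm_of_nonneg (Real.exp_nonneg _)]
      refine Real.exp_le_exp.2 ((le_abs_self _).trans ?_)
      rw [abs_mul]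
      gcongr
      exact (abs_sub _ _).trans (by linarith [hgB x])
    calc _ ≤ ∫ x, Real.exp (c ^ 2 * t ^ 2 / 2) * Real.exp (t * (g x - ∫ y, g y ∂P)) ∂P :=
          integral_mono_of_nonneg
            (Filter.Eventually.of_forall fun x => integral_nonneg fun y => Real.exp_nonneg _)
            (hgi.const_mul _) (Filter.Eventually.of_forall h2)
      _ = Real.exp (c ^ 2 * t ^ 2 / 2) * ∫ x, Real.exp (t * (g x - ∫ y, g y ∂P)) ∂P :=
          integral_const_mul _ _
      _ ≤ Real.exp (c ^ 2 * t ^ 2 / 2) * Real.exp (F.card * (c ^ 2 * t ^ 2 / 2)) := by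
          gcongr
          exact ih g dg hcg
      _ = _ := by
          rw [← Real.exp_add, Finset.card_insert_of_notMem hi]
          push_cast; ring_nf

/-- The bounded differences inequality (with a constant that is not optimal). -/
theorem measure_ge_le_of_bounded_differences [∀ i, Nonempty (X i)] {c t : ℝ} (ht : 0 ≤ t)
    (hc0 : 0 < c) {F : Finset ι} {N : ℝ} (hN : 0 < N) (hFN : F.card ≤ N)
    {f : (∀ i, X i) → ℝ} (hf : DependsOn f F)
    (hc : ∀ i ∈ F, ∀ x y, |f (splice {i} x y) - f x| ≤ c) :
    Measure.infinitePi μ {x | (∫ y, f y ∂Measure.infinitePi μ) + t ≤ f x} ≤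
      ENNReal.ofReal (Real.exp (-(t ^ 2 / (2 * N * c ^ 2)))) := by
  set P := Measure.infinitePi μ
  set e := ∫ y, f y ∂P
  -- This value minimises the exponent `-s * t + N * c ^ 2 * s ^ 2 / 2`.
  set s := t / (N * c ^ 2)
  have hs : 0 ≤ s := by positivity
  have mf : Measurable f := DependsOn.measurable hf (Finset.finite_toSet _)
  obtain ⟨B, hB⟩ := exists_bound_of_dependsOn hf
  have hint : Integrable (fun x => Real.exp (s * (f x - e))) P := by
    refine Integrable.of_bound (C := Real.exp (|s| * (B + |e|)))
      (Measurable.aestronglyMeasurable (by fun_prop)) (Filter.Eventually.of_forall fun x => ?_)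
    rw [Real.norm_of_nonneg (Real.exp_nonneg _)]
    refine Real.exp_le_exp.2 ((le_abs_self _).trans ?_)
    rw [abs_mul]
    gcongr
    exact (abs_sub _ _).trans (by linarith [hB x])
  have h1 := measure_ge_le_exp_mul_mgf (μ := P) (X := fun x => f x - e) t hs hint
  have h2 := integral_exp_sub_le μ (c := c) s F f hf hc
  have h3 : P.real {x | e + t ≤ f x} ≤ Real.exp (-(t ^ 2 / (2 * N * c ^ 2))) := by
    have : {x | e + t ≤ f x} = {x | t ≤ f x - e} := by
      ext x; constructor <;> intro h <;> simp only [Set.mem_ofPred_eq] at h ⊢ <;> linarith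
    rw [this]
    refine h1.trans ?_
    simp only [mgf]
    calc _ ≤ Real.exp (-s * t) * Real.exp (F.card * (c ^ 2 * s ^ 2 / 2)) := by gcongr
      _ ≤ Real.exp (-s * t) * Real.exp (N * (c ^ 2 * s ^ 2 / 2)) := by gcongr
      _ = _ := by
        rw [← Real.exp_add]
        congr 1
        simp only [s]
        field_simp
        ring
  rw [← ENNReal.ofReal_toReal (measure_ne_top P _)]
  exact ENNReal.ofReal_le_ofReal h3

end BoundedDifferences

end BallsIntoBins

namespace BallsIntoBins

namespace Params

/-! ## Intervals, coordinators and blocks -/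

section Blocks

variable (p : Params)

/-- Consequently `l` consecutive intervals never wrap around onto themselves. Truncating to a
multiple of `l ^ 2`, together with `l ^ 2 ≤ n`, guarantees this. -/
lemma l_le_numIntervals : p.l ≤ p.numIntervals :=
  Nat.le_mul_of_pos_left _ (Nat.div_pos p.sq_le_n (pow_pos p.one_le_l 2))

lemma n_lt_numUsed_add : p.n < p.numUsed + p.l ^ 2 := by
  have h : p.numUsed = p.l ^ 2 * (p.n / p.l ^ 2) := by unfold numUsed numIntervals; ring
  rw [h]
  have := Nat.div_add_mod p.n (p.l ^ 2)
  have := Nat.mod_lt p.n (pow_pos p.one_le_l 2)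
  omega

lemma sq_le_numUsed : p.l ^ 2 ≤ p.numUsed := by
  have h : p.numUsed = p.l ^ 2 * (p.n / p.l ^ 2) := by unfold numUsed numIntervals; ring
  rw [h]
  exact Nat.le_mul_of_pos_right _ (Nat.div_pos p.sq_le_n (pow_pos p.one_le_l 2))

variable {p}

lemma shift_zero (j : Fin p.numIntervals) : p.shift j 0 = j := by
  ext; simp [shift, Nat.mod_eq_of_lt j.isLt]

lemma shift_shift (j : Fin p.numIntervals) (s t : ℕ) :
    p.shift (p.shift j s) t = p.shift j (s + t) := by
  ext; simp [shift, add_assoc]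

lemma shift_left_injective (s : ℕ) : Function.Injective fun j : Fin p.numIntervals => p.shift j s := by
  intro j j' h
  have h1 : (j + s : ℕ) ≡ j' + s [MOD p.numIntervals] := congrArg Fin.val h
  have h2 := Nat.ModEq.add_right_cancel' s h1
  exact Fin.ext (by simpa [Nat.ModEq, Nat.mod_eq_of_lt j.isLt, Nat.mod_eq_of_lt j'.isLt] using h2)

lemma shift_left_surjective (s : ℕ) : Function.Surjective fun j : Fin p.numIntervals => p.shift j s :=
  Finite.surjective_of_injective (shift_left_injective s)

lemma shift_right_injOn (j : Fin p.numIntervals) {s t : ℕ} (hs : s < p.l) (ht : t < p.l)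
    (h : p.shift j s = p.shift j t) : s = t := by
  have h1 : (j + s : ℕ) ≡ j + t [MOD p.numIntervals] := congrArg Fin.val h
  have h2 := Nat.ModEq.add_left_cancel' _ h1
  exact Nat.ModEq.eq_of_lt_of_lt h2 (hs.trans_le p.l_le_numIntervals) (ht.trans_le p.l_le_numIntervals)

lemma binAt_inj {j j' : Fin p.numIntervals} {s s' : Fin p.l} :
    p.binAt j s = p.binAt j' s' ↔ j = j' ∧ s = s' := by
  constructor
  · intro h
    have h1 : (j : ℕ) * p.l + s = j' * p.l + s' := by simpa [binAt] using h
    have hl : 0 < p.l := p.one_le_l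
    have h2 : (j : ℕ) = j' := by
      have h3 := congrArg (· / p.l) h1
      simpa [Nat.add_comm, Nat.add_mul_div_right _ _ hl, Nat.div_eq_of_lt s.isLt,
        Nat.div_eq_of_lt s'.isLt] using h3
    rw [h2] at h1
    exact ⟨Fin.ext h2, Fin.ext (by omega)⟩
  · rintro ⟨rfl, rfl⟩; rfl

lemma exists_binAt {v : p.Bin} (hv : (v : ℕ) < p.numUsed) : ∃ j s, v = p.binAt j s := by
  have hl : 0 < p.l := p.one_le_l
  refine ⟨⟨v / p.l, ?_⟩, ⟨v % p.l, Nat.mod_lt _ hl⟩, ?_⟩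
  · exact Nat.div_lt_of_lt_mul (by rw [mul_comm]; exact hv)
  · ext; simp [binAt, Nat.div_add_mod']

lemma binAt_lt (j : Fin p.numIntervals) (s : Fin p.l) : (p.binAt j s : ℕ) < p.numUsed := by
  have h1 : (j : ℕ) * p.l + s < (j + 1) * p.l := by
    have := s.isLt
    nlinarith
  exact h1.trans_le (Nat.mul_le_mul_right _ j.isLt)

variable {ω : p.Outcome}

lemma target_lt (b : p.Ball) : (p.target ω b : ℕ) < p.numUsed := (ω (.target b)).isLt

/-- Both strings are minimal, hence equal, and equal strings of different balls would suppress the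
acknowledgement. -/
lemma Acknowledged.eq_ball {b b' : p.Ball} {j} (h : p.Acknowledged ω b j)
    (h' : p.Acknowledged ω b' j) : b = b' :=
  h.2.1 _ _ h.1 h'.1 (le_antisymm (h.2.2 _ h'.1) (h'.2.2 _ h.1))

lemma Contacts.eq_interval {b : p.Ball} {j j'} (h : p.Contacts ω b j) (h' : p.Contacts ω b j') :
    j = j' := h.2.symm.trans h'.2

/-- Of the two acknowledging intervals, the one nearer to `i` lies among those that the ball of the
farther one must find without foreign acknowledgements. If they are equally near, they coincide. -/
lemma Coordinates.eq_ball {b b' : p.Ball} {i} (h : p.Coordinates ω b i)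
    (h' : p.Coordinates ω b' i) : b = b' := by
  have key : ∀ {b b' : p.Ball} {j j' s s'}, p.Acknowledged ω b j → p.Acknowledged ω b' j' →
      p.shift j s = p.shift j' s' → s' ≤ s →
      (∀ t, 1 ≤ t → t ≤ s → ∀ a, a ≠ b → ¬ p.Acknowledged ω a (p.shift j t)) → b = b' := by
    intro b b' j j' s s' hb hb' he hs hn
    by_contra hne
    have h1 : p.shift j (s - s') = j' := by
      apply shift_left_injective s'
      simp only [shift_shift]
      rw [Nat.sub_add_cancel hs, he]
    rcases Nat.eq_zero_or_pos (s - s') with h0 | h0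
    · rw [h0, shift_zero] at h1
      subst h1
      exact hne (hb.eq_ball hb')
    · exact hn _ h0 (Nat.sub_le _ _) b' (Ne.symm hne) (h1 ▸ hb')
  obtain ⟨j, s, hb, hs, he, hn⟩ := h
  obtain ⟨j', s', hb', hs', he', hn'⟩ := h'
  rcases le_total s' s with hle | hle
  · exact key hb hb' (he.symm.trans he') hle hn
  · exact (key hb' hb (he'.symm.trans he) hle hn').symm

lemma mem_block {b : p.Ball} {v : p.Bin} :
    v ∈ p.block ω b ↔ ∃ i s, v = p.binAt i s ∧ p.Coordinates ω b i := by
  simp [block]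

lemma eq_of_mem_block {b b' : p.Ball} {v : p.Bin} (h : v ∈ p.block ω b) (h' : v ∈ p.block ω b') :
    b = b' := by
  obtain ⟨i, s, hv, hc⟩ := mem_block.1 h
  obtain ⟨i', s', hv', hc'⟩ := mem_block.1 h'
  obtain ⟨rfl, rfl⟩ := binAt_inj.1 (hv.symm.trans hv')
  exact hc.eq_ball hc'

lemma card_filter_mem_block_le_one (v : p.Bin) :
    (Finset.univ.filter fun b => v ∈ p.block ω b).card ≤ 1 := by
  rw [Finset.card_le_one]
  intro a ha b hb
  exact eq_of_mem_block (by simpa using ha) (by simpa using hb)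

lemma sum_card_block_le : ∑ b, (p.block ω b).card ≤ p.numUsed := by
  have h1 : ∑ b, (p.block ω b).card = (Finset.univ.biUnion (p.block ω)).card := by
    rw [Finset.card_biUnion]
    intro a _ b _ hab
    refine Finset.disjoint_left.2 ?_
    intro v hv hv'
    exact hab (eq_of_mem_block hv hv')
  rw [h1]
  calc _ ≤ (Finset.univ.filter fun v : p.Bin => (v : ℕ) < p.numUsed).card := by
        refine Finset.card_le_card fun v hv => ?_
        obtain ⟨b, -, hb⟩ := Finset.mem_biUnion.1 hv
        obtain ⟨i, s, rfl, -⟩ := mem_block.1 hb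
        simpa using binAt_lt i s
    _ ≤ _ := by
        rw [Fin.card_filter_val_lt]
        exact min_le_right _ _

lemma card_interval (j : Fin p.numIntervals) :
    (Finset.univ.filter fun v : p.Bin => ∃ s, v = p.binAt j s).card = p.l := by
  have : (Finset.univ.filter fun v : p.Bin => ∃ s, v = p.binAt j s) =
      Finset.univ.image (p.binAt j) := by
    ext v; simp [eq_comm]
  rw [this, Finset.card_image_of_injective _ fun s s' h => (binAt_inj.1 h).2]
  simp

/-- A coordinator always coordinates the interval that acknowledged it, which is the case of
distance zero. The bound makes the probability that a block overflows exponentially small in `l`. -/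
lemma l_le_card_block {b : p.Ball} (h : (p.block ω b).Nonempty) : p.l ≤ (p.block ω b).card := by
  obtain ⟨v, hv⟩ := h
  obtain ⟨i, s, -, j, t, hj, -⟩ := mem_block.1 hv
  rw [← card_interval j]
  refine Finset.card_le_card fun w hw => ?_
  obtain ⟨s', hs'⟩ := (Finset.mem_filter.1 hw).2
  refine mem_block.2 ⟨j, s', hs', j, 0, hj, p.one_le_l, (shift_zero j).symm, ?_⟩
  intro s' h1 h2
  omega

/-- Interval `i` has a coordinator: one of the `l` intervals up to `i` acknowledged a ball. -/
def Covered (ω : p.Outcome) (i : Fin p.numIntervals) : Prop :=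
  ∃ j s, s < p.l ∧ i = p.shift j s ∧ ∃ b, p.Acknowledged ω b j

/-- The nearest acknowledging interval up to `i` supplies the coordinator: by minimality of the
distance, nothing after it up to `i` acknowledged anyone. -/
lemma Covered.exists_coordinates {i} (h : Covered ω i) : ∃ b, p.Coordinates ω b i := by
  have h' : ∃ s, s < p.l ∧ ∃ j, i = p.shift j s ∧ ∃ b, p.Acknowledged ω b j := by
    obtain ⟨j, s, h1, h2, h3⟩ := h
    exact ⟨s, h1, j, h2, h3⟩
  obtain ⟨h1, j, h2, b, h3⟩ := Nat.find_spec h'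
  refine ⟨b, j, Nat.find h', h3, h1, h2, fun s' hs1 hs2 b' hb' ha => ?_⟩
  refine Nat.find_min h' (m := Nat.find h' - s') (by omega)
    ⟨by omega, p.shift j s', ?_, b', ha⟩
  rw [shift_shift, Nat.add_sub_cancel' hs2]
  exact h2

lemma exists_mem_block_of_covered {i} (h : Covered ω i) (s : Fin p.l) :
    ∃ b, p.binAt i s ∈ p.block ω b := by
  obtain ⟨b, hb⟩ := h.exists_coordinates
  exact ⟨b, mem_block.2 ⟨i, s, rfl, hb⟩⟩

end Blocks

/-! ## Loads -/

section Loads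

variable {p : Params} {ρ : Rules p.n} {ω : p.Outcome}

lemma assigned_of_mem_block {a b : p.Ball} (h : p.target ω b ∈ p.block ω a) :
    p.assigned ρ ω b = ρ.assign (p.block ω a) (p.arrivals ω) b := by
  have h' : ∃ a, p.target ω b ∈ p.block ω a := ⟨a, h⟩
  rw [assigned, dif_pos h', eq_of_mem_block h'.choose_spec h]

lemma assigned_eq_some {b : p.Ball} {w : p.Bin} (h : p.assigned ρ ω b = some w) :
    ∃ a, p.target ω b ∈ p.block ω a ∧ w ∈ p.block ω a ∧
      ρ.assign (p.block ω a) (p.arrivals ω) b = some w := by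
  by_cases h' : ∃ a, p.target ω b ∈ p.block ω a
  · obtain ⟨a, ha⟩ := h'
    rw [assigned_of_mem_block ha] at h
    exact ⟨a, ha, (ρ.assign_mem _ _ _ _ h).2, h⟩
  · rw [assigned, dif_neg h'] at h
    exact absurd h (by simp)

lemma load_assigned_le (w : p.Bin) : p.load (p.assigned ρ ω) w ≤ 3 := by
  by_cases h : ∃ a, w ∈ p.block ω a
  · obtain ⟨a, ha⟩ := h
    refine le_trans (Finset.card_le_card fun b hb => ?_)
      (ρ.assign_le_three (p.block ω a) (p.arrivals ω) w)
    obtain ⟨a', -, h2, h3⟩ := assigned_eq_some (Finset.mem_filter.1 hb).2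
    obtain rfl := eq_of_mem_block ha h2
    simpa using h3
  · rw [load, Finset.card_eq_zero.2]
    · simp
    · ext b
      simp only [Finset.mem_filter, Finset.mem_univ, true_and, Finset.notMem_empty, iff_false]
      intro hb
      obtain ⟨a, -, h2, -⟩ := assigned_eq_some hb
      exact h ⟨a, h2⟩

lemma placement_succ_eq_some {i : ℕ} {b : p.Ball} {w : p.Bin}
    (h : p.placement ρ ω (i + 1) b = some w) :
    p.placement ρ ω i b = some w ∨ p.placement ρ ω i b = none ∧
      w ∈ p.permissions ρ ω (p.placement ρ ω i) i b := by
  rw [placement] at h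
  dsimp only at h
  split_ifs at h with h1
  · right
    refine ⟨h1.1, ?_⟩
    rw [← Option.some.inj h]
    exact ρ.choose_mem _ _ _ h1.2
  · exact Or.inl h

lemma placement_succ_of_some {i : ℕ} {b : p.Ball} {w : p.Bin}
    (h : p.placement ρ ω i b = some w) : p.placement ρ ω (i + 1) b = some w := by
  rw [placement]
  dsimp only
  rw [if_neg (by simp [h]), h]

lemma placement_mono {i j : ℕ} (hij : i ≤ j) {b : p.Ball} {w : p.Bin}
    (h : p.placement ρ ω i b = some w) : p.placement ρ ω j b = some w := by
  induction j, hij using Nat.le_induction with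
  | base => exact h
  | succ j _ ih => exact placement_succ_of_some ih

lemma placement_eq_none_of_le {i j : ℕ} (hij : i ≤ j) {b : p.Ball}
    (h : p.placement ρ ω j b = none) : p.placement ρ ω i b = none := by
  by_contra h'
  obtain ⟨w, hw⟩ := Option.ne_none_iff_exists'.1 h'
  rw [placement_mono hij hw] at h
  exact absurd h (by simp)

lemma placement_succ_eq_none {i : ℕ} {b : p.Ball} :
    p.placement ρ ω (i + 1) b = none ↔ p.placement ρ ω i b = none ∧
      p.permissions ρ ω (p.placement ρ ω i) i b = ∅ := by
  rw [placement]
  dsimp only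
  split_ifs with h
  · simp [h.2.ne_empty]
  · rw [not_and, Finset.not_nonempty_iff_eq_empty] at h
    exact ⟨fun h' => ⟨h', h h'⟩, fun h' => h'.1⟩

/-- In a phase a bin gains at most the one ball chosen by `grant`, and only if it held at most one
ball. So only coordinators can produce a load of three. -/
lemma load_placement_le (i : ℕ) (w : p.Bin) : p.load (p.placement ρ ω i) w ≤ 3 := by
  induction i with
  | zero => exact load_assigned_le w
  | succ i ih =>
    by_cases h : p.load (p.placement ρ ω i) w < 2
    · calc p.load (p.placement ρ ω (i + 1)) w ≤ (insert (ρ.grant i w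
            (p.requesters ω (p.placement ρ ω i) i w))
            (Finset.univ.filter fun b => p.placement ρ ω i b = some w)).card := by
            refine Finset.card_le_card fun b hb => ?_
            rcases placement_succ_eq_some (Finset.mem_filter.1 hb).2 with h1 | ⟨-, h1⟩
            · simp [h1]
            · simp only [permissions, Finset.mem_filter] at h1
              simp [h1.2.2.2]
        _ ≤ p.load (p.placement ρ ω i) w + 1 := Finset.card_insert_le _ _
        _ ≤ 3 := by omega
    · refine le_trans (Finset.card_le_card fun b hb => ?_) ih
      rcases placement_succ_eq_some (Finset.mem_filter.1 hb).2 with h1 | ⟨-, h1⟩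
      · simpa using h1
      · simp only [permissions, Finset.mem_filter] at h1
        exact absurd h1.2.1 h

lemma load_position_le (t : ℕ) (w : p.Bin) : p.load (p.position ρ ω t) w ≤ 3 := by
  by_cases h : t < 7
  · simp [load, position, h]
  · simpa [load, position, h] using load_placement_le (ρ := ρ) (ω := ω) (t - 7) w

end Loads

end Params

end BallsIntoBins

namespace BallsIntoBins

/-! ## Messages -/

/-- Here `A` accounts for the first seven rounds and the empty round `0`, and `g i` for the requests
of phase `i`. Round `i + 8` also carries the notifications after phase `i - 1`; charging them to the
requests of that phase causes the factor two. -/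
lemma tsum_le_of_shift {f g : ℕ → ℕ} {A : ℕ} (hA : ∑ t ∈ Finset.range 8, f t ≤ A)
    (h : ∀ i, f (i + 8) ≤ g i + if i = 0 then 0 else g (i - 1)) :
    ∑' t, (f t : ℝ≥0∞) ≤ A + 2 * ∑' i, (g i : ℝ≥0∞) := by
  rw [← ENNReal.summable.sum_add_tsum_nat_add' (f := fun t => (f t : ℝ≥0∞)) (k := 8)]
  refine add_le_add ?_ ?_
  · rw [← Nat.cast_sum]
    exact_mod_cast hA
  · calc ∑' i, (f (i + 8) : ℝ≥0∞)
        ≤ ∑' i, ((g i : ℝ≥0∞) + ((if i = 0 then 0 else g (i - 1) : ℕ) : ℝ≥0∞)) := by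
          refine ENNReal.tsum_le_tsum fun i => ?_
          exact_mod_cast h i
      _ = ∑' i, (g i : ℝ≥0∞) + ∑' i, ((if i = 0 then 0 else g (i - 1) : ℕ) : ℝ≥0∞) :=
          ENNReal.tsum_add
      _ = _ := by
          rw [two_mul]
          congr 1
          rw [tsum_eq_zero_add' ENNReal.summable]
          simp

namespace Params

section Messages

variable {p : Params} {ρ : Rules p.n} {ω : p.Outcome}

/-- One if ball `b` participates in the search for coordinators, and zero otherwise. -/
noncomputable def part (ω : p.Outcome) (b : p.Ball) : ℕ :=
  if (ω (.participate b)).val = 0 then 1 else 0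

/-- The number of requests that ball `b` sends in phase `i`. -/
noncomputable def numRequests (ρ : Rules p.n) (ω : p.Outcome) (i : ℕ) (b : p.Ball) : ℕ :=
  if p.placement ρ ω i b = none then ⌊p.k i⌋₊ else 0

/-- The number of requests that bin `v` receives in phase `i`. -/
noncomputable def requestsAt (ρ : Rules p.n) (ω : p.Outcome) (i : ℕ) (v : p.Bin) : ℕ :=
  ∑ b, p.requests ω (p.placement ρ ω i) i b v

/-- The balls that contact the interval of bin `v`. -/
noncomputable def contactsAt (ω : p.Outcome) (v : p.Bin) : Finset p.Ball :=
  Finset.univ.filter fun b => ∃ j s, v = p.binAt j s ∧ p.Contacts ω b j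

/-- The balls that query bin `v`. -/
noncomputable def queriesAt (ω : p.Outcome) (v : p.Bin) : Finset p.Ball :=
  Finset.univ.filter fun b => p.Queries ω b v

lemma sum_requests (pl : p.Ball → Option p.Bin) (i : ℕ) (b : p.Ball) :
    ∑ v, p.requests ω pl i b v = if pl b = none then ⌊p.k i⌋₊ else 0 := by
  unfold requests
  split_ifs with h
  · rw [← Finset.card_eq_sum_card_fiberwise (fun _ _ => Finset.mem_coe.2 (Finset.mem_univ _))]
    simp
  · simp

lemma inform_le (i : ℕ) (b : p.Ball) (v : p.Bin) :
    (if 1 ≤ i ∧ p.placement ρ ω (i - 1) b = none ∧ p.placement ρ ω i b = some v then 1 else 0) ≤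
      if i = 0 then 0 else p.requests ω (p.placement ρ ω (i - 1)) (i - 1) b v := by
  rcases i with _ | i
  · simp
  · simp only [Nat.add_sub_cancel, Nat.succ_ne_zero, if_false]
    split_ifs with h
    · rcases placement_succ_eq_some h.2.2 with h1 | ⟨-, h1⟩
      · rw [h.2.1] at h1
        exact absurd h1 (by simp)
      · simp only [permissions, Finset.mem_filter] at h1
        have h2 := ρ.grant_mem i v _ h1.2.2.1
        rw [h1.2.2.2] at h2
        exact (Finset.mem_filter.1 h2).2
    · exact Nat.zero_le _

lemma ballMsg_phase_le (i : ℕ) (b : p.Ball) (v : p.Bin) :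
    p.ballMsg ρ ω (i + 8) b v ≤ p.requests ω (p.placement ρ ω i) i b v +
      if i = 0 then 0 else p.requests ω (p.placement ρ ω (i - 1)) (i - 1) b v :=
  Nat.add_le_add_left (inform_le i b v) _

lemma card_contacted_le (b : p.Ball) :
    (Finset.univ.filter fun v => ∃ j s, v = p.binAt j s ∧ p.Contacts ω b j).card ≤
      p.l * part ω b := by
  unfold part
  split_ifs with h
  · rw [mul_one]
    refine le_trans (Finset.card_le_card fun v hv => ?_) (card_interval (ω (.interval b))).le
    obtain ⟨j, s, h1, -, h2⟩ := (Finset.mem_filter.1 hv).2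
    subst h2
    simpa using ⟨s, h1⟩
  · rw [mul_zero, Nat.le_zero, Finset.card_eq_zero]
    ext v
    simp only [Finset.mem_filter, Finset.mem_univ, true_and, Finset.notMem_empty, iff_false]
    rintro ⟨j, s, -, h1, -⟩
    exact h h1

lemma card_queried_le (b : p.Ball) :
    (Finset.univ.filter fun v => p.Queries ω b v).card ≤ p.l * part ω b := by
  unfold part
  split_ifs with h
  · rw [mul_one]
    calc _ ≤ ((Finset.range p.l).image fun s =>
          p.binAt (p.shift (ω (.interval b)) s) (ω (.query b s))).card := by
          refine Finset.card_le_card fun v hv => ?_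
          obtain ⟨j, s, h1, -, h2, h3⟩ := (Finset.mem_filter.1 hv).2
          obtain rfl := h1.1.2
          exact Finset.mem_image.2 ⟨s, Finset.mem_range.2 h2, h3.symm⟩
      _ ≤ _ := Finset.card_image_le.trans (by simp)
  · rw [mul_zero, Nat.le_zero, Finset.card_eq_zero]
    ext v
    simp only [Finset.mem_filter, Finset.mem_univ, true_and, Finset.notMem_empty, iff_false]
    rintro ⟨j, s, h1, -⟩
    exact h h1.1.1

/-- For each distance `s`, only the interval `s` places before that of `v` matters, and it
acknowledges at most one ball. -/
lemma card_queriesAt_le (v : p.Bin) : (queriesAt ω v).card ≤ p.l := by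
  calc _ ≤ ((Finset.range p.l).biUnion fun s => Finset.univ.filter fun b =>
        ∃ j x, p.Acknowledged ω b j ∧ v = p.binAt (p.shift j s) x).card := by
        refine Finset.card_le_card fun b hb => ?_
        obtain ⟨j, s, h1, -, h2, h3⟩ := (Finset.mem_filter.1 hb).2
        simp only [Finset.mem_biUnion, Finset.mem_range, Finset.mem_filter, Finset.mem_univ, true_and]
        exact ⟨s, h2, j, _, h1, h3⟩
    _ ≤ ∑ s ∈ Finset.range p.l, 1 := by
        refine Finset.card_biUnion_le.trans (Finset.sum_le_sum fun s _ => ?_)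
        rw [Finset.card_le_one]
        intro a ha b hb
        obtain ⟨j, x, h1, h2⟩ := (Finset.mem_filter.1 ha).2
        obtain ⟨j', x', h1', h2'⟩ := (Finset.mem_filter.1 hb).2
        have := (binAt_inj.1 (h2.symm.trans h2')).1
        obtain rfl := shift_left_injective s this
        exact h1.eq_ball h1'
    _ = p.l := by simp

theorem sentByBall_le (b : p.Ball) :
    p.sentByBall ρ ω b ≤ ((2 * p.l * part ω b + 2 * (p.block ω b).card + 5 : ℕ) : ℝ≥0∞) +
      2 * ∑' i, (numRequests ρ ω i b : ℝ≥0∞) := by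
  refine tsum_le_of_shift ?_ fun i => ?_
  · have h1 := card_contacted_le (ω := ω) b
    have h2 := card_queried_le (ω := ω) b
    have h3 : (Finset.univ.filter fun v => p.assigned ρ ω b = some v).card ≤ 1 := by
      rw [Finset.card_le_one]
      intro v hv w hw
      simp only [Finset.mem_filter, Finset.mem_univ, true_and] at hv hw
      exact Option.some.inj (hv.symm.trans hw)
    simp only [Finset.sum_range_succ, Finset.sum_range_zero, ballMsg, Finset.sum_boole,
      Finset.sum_const_zero, Nat.cast_id, Finset.filter_eq, Finset.mem_univ, if_true,
      Finset.card_singleton, Finset.filter_univ_mem]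
    rw [mul_assoc]
    omega
  · calc _ ≤ ∑ v, (p.requests ω (p.placement ρ ω i) i b v +
          if i = 0 then 0 else p.requests ω (p.placement ρ ω (i - 1)) (i - 1) b v) :=
          Finset.sum_le_sum fun v _ => ballMsg_phase_le i b v
      _ ≤ _ := by
          rw [Finset.sum_add_distrib, sum_requests]
          refine Nat.add_le_add_left ?_ _
          split_ifs with h
          · simp
          · rw [sum_requests]; rfl

theorem receivedByBall_le (b : p.Ball) :
    p.receivedByBall ρ ω b ≤ ((2 * p.l * part ω b + 2 * (p.block ω b).card + 5 : ℕ) : ℝ≥0∞) +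
      2 * ∑' i, (numRequests ρ ω i b : ℝ≥0∞) := by
  refine tsum_le_of_shift ?_ fun i => ?_
  · have h1 : (Finset.univ.filter fun v => ∃ j s, v = p.binAt j s ∧ p.Acknowledged ω b j).card ≤
        p.l * part ω b := by
      refine le_trans (Finset.card_le_card fun v hv => ?_) (card_contacted_le (ω := ω) b)
      obtain ⟨j, s, h1, h2⟩ := (Finset.mem_filter.1 hv).2
      simpa using ⟨j, ⟨s, h1⟩, h2.1⟩
    have h2 := card_queried_le (ω := ω) b
    have h3 : (Finset.univ.filter fun v => p.target ω b = v ∧ (p.assigned ρ ω b).isSome).card ≤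
        1 := by
      rw [Finset.card_le_one]
      intro v hv w hw
      exact (Finset.mem_filter.1 hv).2.1.symm.trans (Finset.mem_filter.1 hw).2.1
    simp only [Finset.sum_range_succ, Finset.sum_range_zero, binMsg, Finset.sum_boole,
      Finset.sum_const_zero, Nat.cast_id, Finset.filter_univ_mem]
    rw [mul_assoc]
    omega
  · show ∑ v, p.requests ω (p.placement ρ ω i) i b v ≤ _
    rw [sum_requests]
    exact Nat.le_add_right _ _

theorem sentByBin_le (v : p.Bin) :
    p.sentByBin ρ ω v ≤ (((contactsAt ω v).card + (queriesAt ω v).card +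
      2 * (p.arrivals ω v).card + 5 : ℕ) : ℝ≥0∞) + 2 * ∑' i, (requestsAt ρ ω i v : ℝ≥0∞) := by
  refine tsum_le_of_shift ?_ fun i => ?_
  · have h1 : (Finset.univ.filter fun b => ∃ j s, v = p.binAt j s ∧ p.Acknowledged ω b j).card ≤
        (contactsAt ω v).card := by
      refine Finset.card_le_card fun b hb => ?_
      obtain ⟨j, s, h1, h2⟩ := (Finset.mem_filter.1 hb).2
      simpa [contactsAt] using ⟨j, ⟨s, h1⟩, h2.1⟩
    have h2 := card_filter_mem_block_le_one (ω := ω) v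
    have h3 : (Finset.univ.filter fun b => p.target ω b = v ∧ (p.assigned ρ ω b).isSome).card ≤
        (p.arrivals ω v).card := by
      refine Finset.card_le_card fun b hb => ?_
      simpa [arrivals] using (Finset.mem_filter.1 hb).2.1
    simp only [Finset.sum_range_succ, Finset.sum_range_zero, binMsg, Finset.sum_boole,
      Finset.sum_const_zero, Nat.cast_id]
    rw [← queriesAt]
    omega
  · exact Nat.le_add_right _ _

theorem receivedByBin_le (v : p.Bin) :
    p.receivedByBin ρ ω v ≤ (((contactsAt ω v).card + (queriesAt ω v).card +
      2 * (p.arrivals ω v).card + 5 : ℕ) : ℝ≥0∞) + 2 * ∑' i, (requestsAt ρ ω i v : ℝ≥0∞) := by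
  refine tsum_le_of_shift ?_ fun i => ?_
  · have h2 := card_filter_mem_block_le_one (ω := ω) v
    have h3 : (Finset.univ.filter fun b => p.assigned ρ ω b = some v).card ≤ 3 :=
      load_assigned_le v
    simp only [Finset.sum_range_succ, Finset.sum_range_zero, ballMsg, Finset.sum_boole,
      Finset.sum_const_zero, Nat.cast_id]
    rw [← queriesAt, ← contactsAt, ← arrivals]
    omega
  · calc _ ≤ ∑ b, (p.requests ω (p.placement ρ ω i) i b v +
          if i = 0 then 0 else p.requests ω (p.placement ρ ω (i - 1)) (i - 1) b v) :=
          Finset.sum_le_sum fun b _ => ballMsg_phase_le i b v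
      _ ≤ _ := by
          rw [Finset.sum_add_distrib]
          refine Nat.add_le_add_left ?_ _
          split_ifs with h
          · simp
          · exact le_rfl

/-- What bins send is what balls receive, and both counts for a ball obey the same bound. -/
theorem totalMessages_le :
    p.totalMessages ρ ω ≤ 2 * ∑ b, (((2 * p.l * part ω b + 2 * (p.block ω b).card + 5 : ℕ) : ℝ≥0∞) +
      2 * ∑' i, (numRequests ρ ω i b : ℝ≥0∞)) := by
  have h : ∑ v, p.sentByBin ρ ω v = ∑ b, p.receivedByBall ρ ω b := by
    unfold sentByBin receivedByBall
    rw [← Summable.tsum_finsetSum fun _ _ => ENNReal.summable,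
      ← Summable.tsum_finsetSum fun _ _ => ENNReal.summable]
    congr 1
    funext t
    push_cast
    exact Finset.sum_comm
  rw [totalMessages, h, two_mul]
  exact add_le_add (Finset.sum_le_sum fun b _ => sentByBall_le b)
    (Finset.sum_le_sum fun b _ => receivedByBall_le b)

/-! ## Termination -/

/-- Round `j + 8` has no requests any more, but it may still carry the notifications sent by balls
that were placed in phase `j - 1`. -/
lemma terminatedBy_of_placement {j : ℕ} (h : ∀ b, p.placement ρ ω j b ≠ none) :
    p.TerminatedBy ρ ω (j + 8) := by
  have h' : ∀ i, j ≤ i → ∀ b, p.placement ρ ω i b ≠ none := fun i hi b hb =>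
    h b (placement_eq_none_of_le hi hb)
  refine ⟨fun b => ?_, fun t ht b v => ?_⟩
  · have : ¬ j + 8 < 7 := by omega
    rw [position, if_neg this, Option.isSome_iff_ne_none]
    exact h' _ (by omega) b
  · obtain ⟨i, rfl⟩ : ∃ i, t = i + 8 := ⟨t - 8, by omega⟩
    have h1 : p.requests ω (p.placement ρ ω i) i b v = 0 := if_neg (h' i (by omega) b)
    refine ⟨?_, h1⟩
    rw [ballMsg, h1, if_neg]
    rintro ⟨-, h2, -⟩
    exact h' (i - 1) (by omega) b h2

lemma rounds_le_of_placement {j : ℕ} (h : ∀ b, p.placement ρ ω j b ≠ none) :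
    p.rounds ρ ω ≤ (j + 8 : ℕ) :=
  iInf₂_le (j + 8) (terminatedBy_of_placement h)

end Messages

end Params

end BallsIntoBins

namespace BallsIntoBins

/-- The law of total probability: `g x` bounds the conditional probability of `E`, given the
coordinates of `x` outside `S`. -/
lemma measure_le_of_splice {ι : Type*} {X : ι → Type*} [∀ i, MeasurableSpace (X i)]
    (μ : ∀ i, Measure (X i)) [∀ i, IsProbabilityMeasure (μ i)] (S : Set ι) {E : Set (∀ i, X i)}
    (mE : MeasurableSet E) {g : (∀ i, X i) → ℝ≥0∞}
    (h : ∀ x, Measure.infinitePi μ {y | splice S x y ∈ E} ≤ g x) :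
    Measure.infinitePi μ E ≤ ∫⁻ x, g x ∂Measure.infinitePi μ := by
  rw [← lintegral_indicator_one mE,
    lintegral_splice μ S (f := E.indicator 1) (measurable_one.indicator mE)]
  refine lintegral_mono fun x => le_trans (le_of_eq ?_) (h x)
  have : MeasurableSet {y | splice S x y ∈ E} :=
    (measurable_splice S).comp measurable_prodMk_left mE
  rw [← lintegral_indicator_one this]
  rfl

namespace Params

/-! ## The probability space -/

section Prob

variable (p : Params)

instance (x : Coin p.n) : Nonempty (Fin (p.size x)) := ⟨⟨0, p.size_pos x⟩⟩

instance : IsProbabilityMeasure p.prob := by unfold prob; infer_instance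

lemma prob_coin (x : Coin p.n) (A : Finset (Fin (p.size x))) :
    p.prob {ω | ω x ∈ A} = ENNReal.ofReal (A.card / p.size x) := by
  have h := (measurePreserving_eval_infinitePi p.coinLaw x).measure_preimage
    (s := (A : Set (Fin (p.size x)))) (MeasurableSet.of_discrete).nullMeasurableSet
  have h1 : p.prob {ω | ω x ∈ A} = p.coinLaw x A := h
  rw [h1, coinLaw, uniformOn_univ, Measure.count_apply_finset, Fintype.card_fin,
    ENNReal.ofReal_div_of_pos (by exact_mod_cast p.size_pos x)]
  simp

lemma prob_coin_eq (x : Coin p.n) (y : Fin (p.size x)) :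
    p.prob {ω | ω x = y} = ENNReal.ofReal (1 / p.size x) := by
  simpa using p.prob_coin x {y}

lemma measurableSet_of_dependsOn {E : Set p.Outcome} {S : Set (Coin p.n)} (hS : S.Finite)
    (hE : DependsOn (fun ω => ω ∈ E) S) : MeasurableSet E :=
  measurableSet_setOfPred.2 (DependsOn.measurable hE hS)

variable {p}

/-- The coins for the requests of the balls `B` in phase `i`. -/
noncomputable def requestCoins (B : Finset p.Ball) (i : ℕ) : Finset (Coin p.n) :=
  (B ×ˢ Finset.range ⌊p.k i⌋₊).image fun z => .request z.1 i z.2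

lemma mem_requestCoins {B : Finset p.Ball} {i : ℕ} {x : Coin p.n} :
    x ∈ requestCoins B i ↔ ∃ b ∈ B, ∃ s < ⌊p.k i⌋₊, x = .request b i s := by
  simp only [requestCoins, Finset.mem_image, Finset.mem_product, Finset.mem_range, Prod.exists]
  constructor
  · rintro ⟨b, s, ⟨h1, h2⟩, h3⟩; exact ⟨b, h1, s, h2, h3.symm⟩
  · rintro ⟨b, h1, s, h2, h3⟩; exact ⟨b, s, ⟨h1, h2⟩, h3.symm⟩

lemma card_requestCoins (B : Finset p.Ball) (i : ℕ) :
    (requestCoins B i).card = B.card * ⌊p.k i⌋₊ := by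
  rw [requestCoins, Finset.card_image_of_injective, Finset.card_product, Finset.card_range]
  rintro ⟨b, s⟩ ⟨b', s'⟩ h
  simpa using h

/-! ## A single phase -/

/-- The balls that remain to be placed. -/
noncomputable def remaining (pl : p.Ball → Option p.Bin) : Finset p.Ball :=
  Finset.univ.filter fun b => pl b = none

lemma mem_remaining {pl : p.Ball → Option p.Bin} {b : p.Ball} :
    b ∈ remaining pl ↔ pl b = none := by simp [remaining]

lemma card_remaining_le (pl : p.Ball → Option p.Bin) : (remaining pl).card ≤ p.n :=
  (Finset.card_le_univ _).trans (by simp)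

/-- The bins in use that contain at most one ball. -/
noncomputable def nonfull (pl : p.Ball → Option p.Bin) : Finset (Fin p.numUsed) :=
  Finset.univ.filter fun u => p.load pl (Fin.castLE p.numUsed_le u) < 2

/-- Every bin in use outside `nonfull` holds at least two of the `n` balls. -/
lemma two_mul_numUsed_le (pl : p.Ball → Option p.Bin) :
    2 * p.numUsed ≤ 2 * (nonfull pl).card + p.n := by
  have h1 : ∑ v, p.load pl v ≤ p.n := by
    unfold load
    rw [← Finset.card_biUnion]
    · exact (Finset.card_le_univ _).trans (by simp)
    · intro v _ w _ hvw
      refine Finset.disjoint_left.2 fun b hb hb' => hvw ?_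
      simp only [Finset.mem_filter, Finset.mem_univ, true_and] at hb hb'
      exact Option.some.inj (hb.symm.trans hb')
  have h2 : ∑ u : Fin p.numUsed, p.load pl (Fin.castLE p.numUsed_le u) ≤ ∑ v, p.load pl v := by
    rw [← Finset.sum_image (f := p.load pl) (g := Fin.castLE p.numUsed_le)
      (fun _ _ _ _ h => Fin.castLE_injective _ h)]
    exact Finset.sum_le_sum_of_subset (Finset.subset_univ _)
  have h3 : ∑ u : Fin p.numUsed, 2 ≤ ∑ u : Fin p.numUsed,
      (p.load pl (Fin.castLE p.numUsed_le u) + if u ∈ nonfull pl then 2 else 0) := by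
    refine Finset.sum_le_sum fun u _ => ?_
    split_ifs with h
    · omega
    · simp only [nonfull, Finset.mem_filter, Finset.mem_univ, true_and] at h
      omega
  rw [Finset.sum_add_distrib, ← Finset.sum_filter] at h3
  simp at h3
  omega

/-- No ball but `b` requests bin `u`. -/
def Lone (pl : p.Ball → Option p.Bin) (i : ℕ) (ω : p.Outcome) (b : p.Ball) (u : Fin p.numUsed) :
    Prop :=
  ∀ b', b' ≠ b → pl b' = none → ∀ s < ⌊p.k i⌋₊, ω (.request b' i s) ≠ u

/-- None of the requests of `b` goes to a bin with at most one ball and no other request. -/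
def Fails (pl : p.Ball → Option p.Bin) (i : ℕ) (ω : p.Outcome) (b : p.Ball) : Prop :=
  pl b = none ∧ ∀ s < ⌊p.k i⌋₊, ¬ (ω (.request b i s) ∈ nonfull pl ∧
    Lone pl i ω b (ω (.request b i s)))

lemma requests_pos {pl : p.Ball → Option p.Bin} {i : ℕ} {ω : p.Outcome} {b : p.Ball} {v : p.Bin} :
    0 < p.requests ω pl i b v ↔ pl b = none ∧ ∃ s < ⌊p.k i⌋₊, p.requestBin ω b i s = v := by
  unfold requests
  split_ifs with h
  · simp [h, Finset.card_pos, Finset.Nonempty]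
  · simp [h]

lemma mem_requesters {pl : p.Ball → Option p.Bin} {i : ℕ} {ω : p.Outcome} {b : p.Ball} {v : p.Bin} :
    b ∈ p.requesters ω pl i v ↔ pl b = none ∧ ∃ s < ⌊p.k i⌋₊, p.requestBin ω b i s = v := by
  simp [requesters, requests_pos]

/-- A sole requester of a bin with room is admitted whatever `grant` does. `Fails` refers to no
rule, so bounding its probability for every fixed placement serves all rules at once. -/
lemma fails_of_placement_succ {ρ : Rules p.n} {ω : p.Outcome} {i : ℕ} {b : p.Ball}
    (h : p.placement ρ ω (i + 1) b = none) : Fails (p.placement ρ ω i) i ω b := by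
  obtain ⟨h1, h2⟩ := placement_succ_eq_none.1 h
  refine ⟨h1, fun s hs hh => ?_⟩
  obtain ⟨h3, h4⟩ := hh
  refine Finset.notMem_empty (p.requestBin ω b i s) (h2 ▸ ?_)
  have h5 : p.requesters ω (p.placement ρ ω i) i (p.requestBin ω b i s) = {b} := by
    ext b'
    rw [mem_requesters, Finset.mem_singleton]
    constructor
    · rintro ⟨h6, s', hs', h7⟩
      by_contra hne
      exact h4 b' hne h6 s' hs' (Fin.castLE_injective _ h7)
    · rintro rfl
      exact ⟨h1, s, hs, rfl⟩
  simp only [permissions, Finset.mem_filter, Finset.mem_univ, true_and, h5]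
  refine ⟨(Finset.mem_filter.1 h3).2, Finset.singleton_nonempty _, ?_⟩
  exact Finset.mem_singleton.1 (ρ.grant_mem i _ _ (Finset.singleton_nonempty b))

/-- Even if the bin admits another ball than `b`, the admitted ball becomes placed. This weaker form
of progress is what almost sure termination uses. -/
lemma card_remaining_succ_lt {ρ : Rules p.n} {ω : p.Outcome} {i s : ℕ} {b : p.Ball}
    (hb : p.placement ρ ω i b = none) (hs : s < ⌊p.k i⌋₊)
    (h : ω (.request b i s) ∈ nonfull (p.placement ρ ω i)) :
    (remaining (p.placement ρ ω (i + 1))).card < (remaining (p.placement ρ ω i)).card := by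
  set v := p.requestBin ω b i s
  have h1 : (p.requesters ω (p.placement ρ ω i) i v).Nonempty :=
    ⟨b, mem_requesters.2 ⟨hb, s, hs, rfl⟩⟩
  have h2 := ρ.grant_mem i v _ h1
  set a := ρ.grant i v (p.requesters ω (p.placement ρ ω i) i v)
  refine Finset.card_lt_card (Finset.ssubset_iff_subset_ne.2 ⟨fun b' hb' => ?_, fun he => ?_⟩)
  · exact mem_remaining.2 (placement_eq_none_of_le (Nat.le_succ i) (mem_remaining.1 hb'))
  · have h3 := mem_remaining.1 (he ▸ mem_remaining.2 (mem_requesters.1 h2).1)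
    refine Finset.notMem_empty v ((placement_succ_eq_none.1 h3).2 ▸ ?_)
    simp only [permissions, Finset.mem_filter, Finset.mem_univ, true_and]
    exact ⟨(Finset.mem_filter.1 h).2, h1, rfl⟩

/-- The bins with at most one ball and without requests of other balls than `b`. -/
noncomputable def freeFor (pl : p.Ball → Option p.Bin) (i : ℕ) (ω : p.Outcome) (b : p.Ball) :
    Finset (Fin p.numUsed) :=
  (nonfull pl).filter fun u => Lone pl i ω b u

lemma mem_freeFor {pl : p.Ball → Option p.Bin} {i : ℕ} {ω : p.Outcome} {b : p.Ball}
    {u : Fin p.numUsed} : u ∈ freeFor pl i ω b ↔ u ∈ nonfull pl ∧ Lone pl i ω b u :=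
  Finset.mem_filter

lemma dependsOn_lone (pl : p.Ball → Option p.Bin) (i : ℕ) (b : p.Ball) (u : Fin p.numUsed) :
    DependsOn (fun ω => Lone pl i ω b u) (requestCoins ((remaining pl).erase b) i) := by
  intro ω ω' h
  simp only [Lone, eq_iff_iff]
  refine forall_congr' fun b' => forall_congr' fun h1 => forall_congr' fun h2 =>
    forall_congr' fun s => forall_congr' fun h3 => ?_
  rw [h _ (mem_requestCoins.2 ⟨b', by simp [h1, mem_remaining, h2], s, h3, rfl⟩)]

/-- The coins of `b` itself are absent. Given the set of free bins, the requests of `b` are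
therefore still uniform and independent. -/
lemma dependsOn_freeFor (pl : p.Ball → Option p.Bin) (i : ℕ) (b : p.Ball) :
    DependsOn (fun ω => freeFor pl i ω b) (requestCoins ((remaining pl).erase b) i) := by
  intro ω ω' h
  ext u
  have := dependsOn_lone pl i b u h
  simp only [eq_iff_iff] at this
  simp [freeFor, this]

lemma dependsOn_fails (pl : p.Ball → Option p.Bin) (i : ℕ) (b : p.Ball) :
    DependsOn (fun ω => Fails pl i ω b) (requestCoins (remaining pl) i) := by
  intro ω ω' h
  by_cases hb : pl b = none
  · simp only [Fails, hb, true_and, eq_iff_iff]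
    refine forall_congr' fun s => forall_congr' fun hs => ?_
    rw [h _ (mem_requestCoins.2 ⟨b, mem_remaining.2 hb, s, hs, rfl⟩)]
    have := dependsOn_lone pl i b (ω' (.request b i s)) (x := ω) (y := ω') (fun x hx => h x ?_)
    · simp only [eq_iff_iff] at this
      rw [this]
    · obtain ⟨b', h1, s', h2⟩ := mem_requestCoins.1 hx
      exact mem_requestCoins.2 ⟨b', Finset.mem_of_mem_erase h1, s', h2⟩
  · simp [Fails, hb]

lemma coinLaw_request_notMem (b : p.Ball) (i s : ℕ) (A : Finset (Fin p.numUsed)) :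
    p.coinLaw (.request b i s) {y | ∀ u ∈ A, y.val ≠ u.val} =
      ENNReal.ofReal (1 - A.card / p.numUsed) := by
  have h := (measurePreserving_eval_infinitePi p.coinLaw (.request b i s)).measure_preimage
    (s := {y | ∀ u ∈ A, y.val ≠ u.val}) (MeasurableSet.of_discrete).nullMeasurableSet
  rw [← h]
  have h2 : Function.eval (Coin.request b i s) ⁻¹' {y : Fin (p.size (.request b i s)) |
      ∀ u ∈ A, y.val ≠ u.val} = {ω : p.Outcome | ω (.request b i s) ∈ A}ᶜ := by
    ext ω
    constructor
    · exact fun h h' => h _ h' rfl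
    · intro h u hu h'
      refine h ?_
      have h3 : ω (.request b i s) = u := Fin.ext h'
      rw [Set.mem_ofPred_eq, h3]
      exact hu
  have hm : MeasurableSet {ω : p.Outcome | ω (.request b i s) ∈ A} :=
    measurable_pi_apply (X := fun x : Coin p.n => Fin (p.size x)) (Coin.request b i s)
      (MeasurableSet.of_discrete (s := (A : Set (Fin p.numUsed))))
  rw [h2]
  change p.prob _ = _
  have h3 : p.prob {ω | ω (.request b i s) ∈ A} = ENNReal.ofReal (A.card / p.numUsed) :=
    p.prob_coin (.request b i s) A
  rw [prob_compl_eq_one_sub hm, h3, ENNReal.ofReal_sub _ (by positivity), ENNReal.ofReal_one]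

lemma prob_lone (pl : p.Ball → Option p.Bin) (i : ℕ) (b : p.Ball) (u : Fin p.numUsed) :
    p.prob {ω | Lone pl i ω b u} =
      ENNReal.ofReal ((1 - 1 / p.numUsed) ^ (requestCoins ((remaining pl).erase b) i).card) := by
  have h : {ω : p.Outcome | Lone pl i ω b u} =
      Set.pi (requestCoins ((remaining pl).erase b) i) fun x => {y | y.val ≠ u.val} := by
    ext ω
    simp only [Lone, Set.mem_ofPred_eq, Set.mem_pi, Finset.mem_coe, mem_requestCoins]
    constructor
    · rintro h x ⟨b', h1, s, h2, rfl⟩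
      rw [Finset.mem_erase, mem_remaining] at h1
      exact fun h3 => h b' h1.1 h1.2 s h2 (Fin.ext h3)
    · intro h b' h1 h2 s h3 h4
      refine h (.request b' i s) ⟨b', ?_, s, h3, rfl⟩ (congrArg Fin.val h4)
      rw [Finset.mem_erase, mem_remaining]
      exact ⟨h1, h2⟩
  have hm : (1 : ℝ) / p.numUsed ≤ 1 := by
    rw [div_le_one (by exact_mod_cast p.numUsed_pos)]
    exact_mod_cast p.numUsed_pos
  rw [h, prob, Measure.infinitePi_pi _ fun x _ => MeasurableSet.of_discrete,
    ENNReal.ofReal_pow (by linarith), ← Finset.prod_const]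
  refine Finset.prod_congr rfl fun x hx => ?_
  obtain ⟨b', -, s, -, rfl⟩ := mem_requestCoins.1 hx
  simpa using coinLaw_request_notMem b' i s {u}

lemma measurableSet_lone (pl : p.Ball → Option p.Bin) (i : ℕ) (b : p.Ball) (u : Fin p.numUsed) :
    MeasurableSet {ω | Lone pl i ω b u} :=
  measurableSet_of_dependsOn p (Finset.finite_toSet _) (dependsOn_lone pl i b u)

lemma integral_card_freeFor (pl : p.Ball → Option p.Bin) (i : ℕ) (b : p.Ball) :
    ∫ ω, ((freeFor pl i ω b).card : ℝ) ∂p.prob = (nonfull pl).card *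
      (1 - 1 / p.numUsed : ℝ) ^ (requestCoins ((remaining pl).erase b) i).card := by
  have hm : (1 : ℝ) / p.numUsed ≤ 1 := by
    rw [div_le_one (by exact_mod_cast p.numUsed_pos)]
    exact_mod_cast p.numUsed_pos
  have h : ∀ ω, ((freeFor pl i ω b).card : ℝ) =
      ∑ u ∈ nonfull pl, {ω | Lone pl i ω b u}.indicator (1 : p.Outcome → ℝ) ω := by
    intro ω
    rw [freeFor, Finset.card_filter]
    push_cast
    rfl
  simp only [h]
  rw [integral_finsetSum]
  · simp only [integral_indicator_one (measurableSet_lone pl i b _), Measure.real, prob_lone]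
    rw [ENNReal.toReal_ofReal (pow_nonneg (by linarith) _)]
    simp
  · intro u _
    exact (integrable_const 1).indicator (measurableSet_lone pl i b u)

lemma card_filter_le_add {κ : Type*} (s : Finset κ) {P Q : κ → Prop} [DecidablePred P]
    [DecidablePred Q] (T : Finset κ)
    (h : ∀ a ∈ s, P a → ¬ Q a → a ∈ T) : (s.filter P).card ≤ (s.filter Q).card + T.card := by
  refine le_trans (Finset.card_le_card fun a ha => ?_) (Finset.card_union_le _ _)
  rw [Finset.mem_filter] at ha
  by_cases hQ : Q a
  · exact Finset.mem_union_left _ (Finset.mem_filter.2 ⟨ha.1, hQ⟩)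
  · exact Finset.mem_union_right _ (h a ha.1 ha.2 hQ)

/-- Moving one request can spoil only the bin it moves to and free only the bin it leaves. -/
lemma abs_card_freeFor_sub_le (pl : p.Ball → Option p.Bin) (i : ℕ) (b : p.Ball)
    {x : Coin p.n} (hx : x ∈ requestCoins ((remaining pl).erase b) i) (ω ω' : p.Outcome) :
    |((freeFor pl i (splice {x} ω ω') b).card : ℝ) - (freeFor pl i ω b).card| ≤ 1 := by
  obtain ⟨b₀, -, s₀, -, rfl⟩ := mem_requestCoins.1 hx
  have key : ∀ ω ω' : p.Outcome, (∀ y, y ≠ Coin.request b₀ i s₀ → ω y = ω' y) →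
      (freeFor pl i ω b).card ≤ (freeFor pl i ω' b).card + 1 := by
    intro ω ω' h
    refine card_filter_le_add (nonfull pl) (P := fun u => Lone pl i ω b u)
      (Q := fun u => Lone pl i ω' b u) {ω' (.request b₀ i s₀)} fun u _ h1 h2 => ?_
    refine Finset.mem_singleton.2 ?_
    by_contra h3
    refine h2 fun b' hb' hb'' s hs => ?_
    by_cases h4 : Coin.request b' i s = Coin.request b₀ i s₀
    · obtain ⟨rfl, rfl⟩ : b' = b₀ ∧ s = s₀ := by simpa using h4
      exact Ne.symm h3
    · rw [← h _ h4]; exact h1 b' hb' hb'' s hs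
  have h1 := key (splice {.request b₀ i s₀} ω ω') ω fun y hy => splice_of_notMem (by simpa) _ _
  have h2 := key ω (splice {.request b₀ i s₀} ω ω')
    fun y hy => (splice_of_notMem (by simpa) _ _).symm
  have h1' : ((freeFor pl i (splice {.request b₀ i s₀} ω ω') b).card : ℝ) ≤
      (freeFor pl i ω b).card + 1 := by exact_mod_cast h1
  have h2' : ((freeFor pl i ω b).card : ℝ) ≤
      (freeFor pl i (splice {.request b₀ i s₀} ω ω') b).card + 1 := by exact_mod_cast h2
  rw [abs_le]
  constructor <;> linarith

/-- A ball that fails under `ω` but not under `ω'` is either `b₀` or has lost a bin to the moved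
request. In the second case it was the only requester, under `ω'`, of the bin that this request hits
under `ω`, and there is at most one such ball. -/
lemma card_fails_le (pl : p.Ball → Option p.Bin) (i : ℕ) (b₀ : p.Ball) (s₀ : ℕ) (ω ω' : p.Outcome)
    (h : ∀ y, y ≠ Coin.request b₀ i s₀ → ω y = ω' y) :
    (Finset.univ.filter fun b => Fails pl i ω b).card ≤
      (Finset.univ.filter fun b => Fails pl i ω' b).card + 2 := by
  have hsole : (Finset.univ.filter fun b : p.Ball => Lone pl i ω' b (ω (.request b₀ i s₀)) ∧
      pl b = none ∧ ∃ s < ⌊p.k i⌋₊, ω' (.request b i s) = ω (.request b₀ i s₀)).card ≤ 1 := by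
    rw [Finset.card_le_one]
    intro a ha b hb
    obtain ⟨-, ha, -⟩ := Finset.mem_filter.1 ha
    obtain ⟨-, -, h1, s, hs, h2⟩ := Finset.mem_filter.1 hb
    by_contra hne
    exact ha b (Ne.symm hne) h1 s hs h2
  refine (card_filter_le_add _ (insert b₀ _) ?_).trans
    (Nat.add_le_add_left ((Finset.card_insert_le _ _).trans (Nat.add_le_add_right hsole 1)) _)
  intro b _ h1 h2
  rw [Finset.mem_insert]
  by_cases hb : b = b₀
  · exact Or.inl hb
  right
  have hc : ∀ s, ω (.request b i s) = ω' (.request b i s) := fun s => h _ (by simp [hb])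
  rw [Finset.mem_filter]
  refine ⟨Finset.mem_univ _, ?_⟩
  simp only [Fails, h1.1, true_and, not_forall, not_not] at h2
  obtain ⟨s, hs, h3, h4⟩ := h2
  have h5 := h1.2 s hs
  rw [hc s] at h5
  have h6 : ¬ Lone pl i ω b (ω' (.request b i s)) := fun h6 => h5 ⟨h3, h6⟩
  simp only [Lone, not_forall, not_not] at h6
  obtain ⟨b', hb', hb'', s', hs', h7⟩ := h6
  have h8 : Coin.request b' i s' = Coin.request b₀ i s₀ := by
    by_contra h8
    rw [h _ h8] at h7
    exact h4 b' hb' hb'' s' hs' h7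
  have h9 : ω (.request b₀ i s₀) = ω' (.request b i s) := by
    have h10 := h7
    obtain ⟨rfl, rfl⟩ : b' = b₀ ∧ s' = s₀ := by simpa using h8
    exact h10
  rw [h9]
  exact ⟨h4, h1.1, s, hs, rfl⟩

lemma abs_card_fails_sub_le (pl : p.Ball → Option p.Bin) (i : ℕ)
    {x : Coin p.n} (hx : x ∈ requestCoins (remaining pl) i) (ω ω' : p.Outcome) :
    |((Finset.univ.filter fun b => Fails pl i (splice {x} ω ω') b).card : ℝ) -
      (Finset.univ.filter fun b => Fails pl i ω b).card| ≤ 2 := by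
  obtain ⟨b₀, -, s₀, -, rfl⟩ := mem_requestCoins.1 hx
  have h1 := card_fails_le pl i b₀ s₀ (splice {.request b₀ i s₀} ω ω') ω
    fun y hy => splice_of_notMem (by simpa) _ _
  have h2 := card_fails_le pl i b₀ s₀ ω (splice {.request b₀ i s₀} ω ω')
    fun y hy => (splice_of_notMem (by simpa) _ _).symm
  have h1' := (Nat.cast_le (α := ℝ)).2 h1
  have h2' := (Nat.cast_le (α := ℝ)).2 h2
  push_cast at h1' h2'
  rw [abs_le]
  constructor <;> linarith

end Prob

end Params

end BallsIntoBins

namespace BallsIntoBins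

namespace Params

/-! ## Estimates for a single phase -/

/-- The number `1.012` bounds `n / (m - 1)`, hence also `n / m`, when `n ≤ 1.01 * m` and `m ≥ 990`.
-/
lemma exp_le_2_77 : Real.exp 1.012 ≤ 2.77 := by
  have h4 : Real.exp 0.012 ≤ 1.0122 := by
    have := Real.add_one_le_exp (-0.012)
    rw [Real.exp_neg] at this
    have h5 := Real.exp_pos 0.012
    have h6 : Real.exp 0.012 * (Real.exp 0.012)⁻¹ = 1 := by field_simp
    nlinarith
  have h5 : Real.exp 1.012 = Real.exp 1 * Real.exp 0.012 := by
    rw [← Real.exp_add]; norm_num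
  have := Real.exp_one_lt_d9
  have := Real.exp_pos 0.012
  rw [h5]
  nlinarith

/-- The number of bins is large, and few bins are ignored. -/
structure Large (p : Params) : Prop where
  thousand_le : 1000 ≤ (p.n : ℝ)
  n_le : (p.n : ℝ) ≤ 1.01 * p.numUsed
  exp_le : Real.exp (-(p.n / 10000 : ℝ)) ≤ 0.01 * (0.84 : ℝ) ^ Real.logb 2 p.n

section Phase

variable {p : Params}

lemma Large.numUsed_ge (h : p.Large) : 990 ≤ (p.numUsed : ℝ) := by
  have := h.thousand_le
  have := h.n_le
  linarith

/-- From `1 - 1 / m ≥ exp (-1 / (m - 1))` the power is at least `exp (-1.012)`, and `0.36 ≤ 1 /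
2.77`. This bounds below the chance that a given bin is missed by up to `n` requests. -/
lemma Large.pow_ge (h : p.Large) {N : ℕ} (hN : N ≤ p.n) :
    0.36 ≤ (1 - 1 / p.numUsed : ℝ) ^ N := by
  have hm := h.numUsed_ge
  set m : ℝ := (p.numUsed : ℝ)
  have h1 : Real.exp (-(1 / (m - 1))) ≤ 1 - 1 / m := by
    have h2 : m / (m - 1) ≤ Real.exp (1 / (m - 1)) := by
      refine le_trans (le_of_eq ?_) (Real.add_one_le_exp _)
      have : m - 1 ≠ 0 := by linarith
      field_simp
      ring
    rw [Real.exp_neg, inv_le_comm₀ (Real.exp_pos _)]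
    · refine le_trans (le_of_eq ?_) h2
      have h3 : m - 1 ≠ 0 := by linarith
      have h4 : m ≠ 0 := by linarith
      field_simp
    · have : 1 / m < 1 := by rw [div_lt_one] <;> linarith
      linarith
  calc (0.36 : ℝ) ≤ Real.exp (-(N / (m - 1))) := by
        have h2 : (N : ℝ) / (m - 1) ≤ 1.012 := by
          rw [div_le_iff₀ (by linarith)]
          have h3 : (N : ℝ) ≤ p.n := by exact_mod_cast hN
          have := h.n_le
          linarith
        have h3 := exp_le_2_77
        calc (0.36 : ℝ) ≤ (2.77)⁻¹ := by norm_num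
          _ ≤ (Real.exp 1.012)⁻¹ := by gcongr
          _ = Real.exp (-1.012) := (Real.exp_neg _).symm
          _ ≤ _ := by gcongr
    _ = Real.exp (-(1 / (m - 1))) ^ N := by
        rw [← Real.exp_nat_mul]; ring_nf
    _ ≤ _ := by gcongr

lemma Large.prob_freeFor_lt (h : p.Large) {pl : p.Ball → Option p.Bin} {i : ℕ}
    (hR : (remaining pl).card * ⌊p.k i⌋₊ ≤ p.n) (b : p.Ball) :
    p.prob {ω | ((freeFor pl i ω b).card : ℝ) < 0.16 * p.numUsed} ≤
      ENNReal.ofReal (Real.exp (-(p.n / 10000 : ℝ))) := by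
  set F := requestCoins ((remaining pl).erase b) i with hF
  have hFn : F.card ≤ p.n := by
    rw [hF, card_requestCoins]
    exact (Nat.mul_le_mul_right _ (Finset.card_erase_le)).trans hR
  have hm := h.numUsed_ge
  have hn := h.n_le
  have hn0 : (0 : ℝ) < p.n := by linarith [h.thousand_le]
  -- The sign is reversed in order to bound the lower tail. The mean is at least `0.495 * 0.36 * m`,
  -- which exceeds `(0.16 + 0.018) * m`.
  have h1 := measure_ge_le_of_bounded_differences p.coinLaw (c := 1) (t := 0.018 * p.numUsed)
    (by positivity) one_pos (F := F) (N := p.n) hn0 (by exact_mod_cast hFn)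
    (f := fun ω => -((freeFor pl i ω b).card : ℝ))
    (fun ω ω' hh => by have := dependsOn_freeFor pl i b hh; simp only at this ⊢; rw [this])
    (fun x hx ω ω' => by
      have := abs_card_freeFor_sub_le pl i b hx ω ω'
      rw [← abs_neg]
      convert this using 2
      ring)
  rw [integral_neg] at h1
  change p.prob {ω | -(∫ ω, ((freeFor pl i ω b).card : ℝ) ∂p.prob) + _ ≤ _} ≤ _ at h1
  rw [integral_card_freeFor] at h1
  refine le_trans (measure_mono fun ω hω => ?_) (h1.trans (ENNReal.ofReal_le_ofReal ?_))
  · simp only [Set.mem_ofPred_eq] at hω ⊢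
    have h2 := h.pow_ge hFn
    have h3 : (2 * p.numUsed : ℝ) ≤ 2 * (nonfull pl).card + p.n := by
      exact_mod_cast two_mul_numUsed_le pl
    have h4 : 0.495 * p.numUsed * 0.36 ≤
        ((nonfull pl).card : ℝ) * (1 - 1 / p.numUsed : ℝ) ^ F.card := by
      gcongr
      linarith
    linarith
  · rw [Real.exp_le_exp, neg_le_neg_iff]
    have : (p.n : ℝ) ^ 2 ≤ (1.01 * p.numUsed) ^ 2 := by gcongr
    rw [div_le_div_iff₀ (by norm_num) (by positivity)]
    nlinarith

lemma prob_forall_request_notMem (b : p.Ball) (i K : ℕ) (A : Finset (Fin p.numUsed)) :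
    p.prob {ω | ∀ s < K, ω (.request b i s) ∉ A} =
      ENNReal.ofReal ((1 - A.card / p.numUsed) ^ K) := by
  have hm : (A.card : ℝ) / p.numUsed ≤ 1 := by
    rw [div_le_one (by exact_mod_cast p.numUsed_pos)]
    exact_mod_cast (Finset.card_le_univ A).trans (by simp)
  have h : {ω : p.Outcome | ∀ s < K, ω (.request b i s) ∉ A} =
      Set.pi ((Finset.range K).image (Coin.request b i) : Finset (Coin p.n))
        fun x => {y | ∀ u ∈ A, y.val ≠ u.val} := by
    ext ω
    simp only [Set.mem_ofPred_eq, Set.mem_pi, Finset.mem_coe, Finset.mem_image, Finset.mem_range]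
    constructor
    · rintro h x ⟨s, hs, rfl⟩ u hu h'
      refine h s hs ?_
      have h3 : ω (.request b i s) = u := Fin.ext h'
      exact h3 ▸ hu
    · exact fun h s hs hA => h _ ⟨s, hs, rfl⟩ _ hA rfl
  rw [h, prob, Measure.infinitePi_pi _ fun x _ => MeasurableSet.of_discrete,
    ENNReal.ofReal_pow (by linarith), Finset.prod_image (fun _ _ _ _ h => by simpa using h)]
  simp only [coinLaw_request_notMem, Finset.prod_const, Finset.card_range]

lemma measurableSet_fails (pl : p.Ball → Option p.Bin) (i : ℕ) (b : p.Ball) :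
    MeasurableSet {ω | Fails pl i ω b} :=
  measurableSet_of_dependsOn p (Finset.finite_toSet _) (dependsOn_fails pl i b)

/-- A remaining ball stays unplaced with small probability. -/
theorem Large.prob_fails_le (h : p.Large) {pl : p.Ball → Option p.Bin} {i : ℕ}
    (hk : 1 ≤ ⌊p.k i⌋₊) (hkn : (⌊p.k i⌋₊ : ℝ) ≤ Real.logb 2 p.n)
    (hR : (remaining pl).card * ⌊p.k i⌋₊ ≤ p.n) (b : p.Ball) :
    p.prob {ω | Fails pl i ω b} ≤ ENNReal.ofReal (0.85 ^ ⌊p.k i⌋₊) := by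
  set K := ⌊p.k i⌋₊
  have hm := h.numUsed_ge
  set D : Set p.Outcome := {ω | ((freeFor pl i ω b).card : ℝ) < 0.16 * p.numUsed}
  have mD : MeasurableSet D := measurableSet_of_dependsOn p (Finset.finite_toSet _)
    (fun ω ω' hh => by
      have := dependsOn_freeFor pl i b hh
      simp only at this
      simp only [D, Set.mem_ofPred_eq, this])
  -- Only the coins of `b` are resampled. Unless the bad event `D` occurs, each request hits one of
  -- the free bins with probability at least `0.16`.
  have h1 : p.prob {ω | Fails pl i ω b} ≤
      ∫⁻ ω, (ENNReal.ofReal (0.84 ^ K) + D.indicator 1 ω) ∂p.prob := by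
    refine measure_le_of_splice p.coinLaw {x | ∃ s, x = .request b i s}
      (measurableSet_fails pl i b) fun ω => ?_
    by_cases hD : ω ∈ D
    · calc _ ≤ (1 : ℝ≥0∞) := prob_le_one
        _ ≤ _ := by simp [hD]
    · simp only [hD, not_false_eq_true, Set.indicator_of_notMem, add_zero]
      calc _ ≤ p.prob {ω' | ∀ s < K, ω' (.request b i s) ∉ freeFor pl i ω b} := by
            refine measure_mono fun ω' hω' s hs hA => ?_
            refine hω'.2 s hs ?_
            rw [splice_of_mem (by exact ⟨s, rfl⟩)]
            have h2 := mem_freeFor.1 hA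
            refine ⟨h2.1, ?_⟩
            have h3 := DependsOn.splice_eq_left (dependsOn_lone pl i b (ω' (.request b i s)))
              (S := {x | ∃ s, x = .request b i s}) ?_ ω ω'
            · rw [h3]; exact h2.2
            · rw [Set.disjoint_left]
              rintro x hx ⟨s', rfl⟩
              obtain ⟨b', hb', s, -, h4⟩ := mem_requestCoins.1 hx
              simp only [Coin.request.injEq] at h4
              exact Finset.ne_of_mem_erase hb' h4.1.symm
        _ = ENNReal.ofReal ((1 - (freeFor pl i ω b).card / p.numUsed) ^ K) :=
            prob_forall_request_notMem b i K _
        _ ≤ _ := by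
            have h3 : ((freeFor pl i ω b).card : ℝ) / p.numUsed ≤ 1 := by
              rw [div_le_one (by linarith)]
              exact_mod_cast (Finset.card_le_univ _).trans (by simp)
            have h4 : (0.16 : ℝ) ≤ (freeFor pl i ω b).card / p.numUsed := by
              rw [le_div_iff₀ (by linarith)]
              simpa [D] using hD
            refine ENNReal.ofReal_le_ofReal (pow_le_pow_left₀ (by linarith) (by linarith) _)
  rw [lintegral_add_left measurable_const, lintegral_indicator_one mD] at h1
  simp only [lintegral_const, measure_univ, mul_one] at h1
  refine h1.trans ((add_le_add_right (h.prob_freeFor_lt hR b) _).trans ?_)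
  rw [← ENNReal.ofReal_add (by positivity) (Real.exp_nonneg _)]
  refine ENNReal.ofReal_le_ofReal ?_
  -- By `Large.exp_le`, the probability of `D` is at most `0.01 * 0.84 ^ K`. It is absorbed by
  -- passing from `0.84` to `0.85`, which is possible because `K ≥ 1`.
  have h2 : (0.84 : ℝ) ^ Real.logb 2 p.n ≤ 0.84 ^ K := by
    rw [← Real.rpow_natCast]
    exact Real.rpow_le_rpow_of_exponent_ge (by norm_num) (by norm_num) hkn
  have h3 : (0.84 : ℝ) ^ K + 0.01 * 0.84 ^ K ≤ 0.85 ^ K := by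
    have : ∀ K : ℕ, 1 ≤ K → (0.84 : ℝ) ^ K + 0.01 * 0.84 ^ K ≤ 0.85 ^ K := by
      intro K hK
      induction K, hK using Nat.le_induction with
      | base => norm_num
      | succ K _ ih => rw [pow_succ, pow_succ]; nlinarith [pow_pos (by norm_num : (0 : ℝ) < 0.84) K]
    exact this K hk
  linarith [h.exp_le]

/-- The number of balls that stay unplaced is concentrated. -/
theorem Large.prob_card_fails_ge (h : p.Large) {pl : p.Ball → Option p.Bin} {i : ℕ}
    (hk : 1 ≤ ⌊p.k i⌋₊) (hkn : (⌊p.k i⌋₊ : ℝ) ≤ Real.logb 2 p.n)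
    (hR : (remaining pl).card * ⌊p.k i⌋₊ ≤ p.n) :
    p.prob {ω | (0.85 : ℝ) ^ ⌊p.k i⌋₊ * (remaining pl).card + (p.n : ℝ) ^ (3 / 4 : ℝ) ≤
      (Finset.univ.filter fun b => Fails pl i ω b).card} ≤
      ENNReal.ofReal (Real.exp (-(√p.n / 8))) := by
  set F := requestCoins (remaining pl) i with hF
  have hFn : F.card ≤ p.n := by rw [hF, card_requestCoins]; exact hR
  have hn0 : (0 : ℝ) < p.n := by linarith [h.thousand_le]
  -- At most `n` coins with differences of at most two: the exponent becomes `n ^ (3 / 2) / (8 * n)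
  -- = √n / 8`.
  have h1 := measure_ge_le_of_bounded_differences p.coinLaw (c := 2) (t := (p.n : ℝ) ^ (3 / 4 : ℝ))
    (by positivity) two_pos (F := F) (N := p.n) hn0 (by exact_mod_cast hFn)
    (f := fun ω => ((Finset.univ.filter fun b => Fails pl i ω b).card : ℝ))
    (fun ω ω' hh => by
      have : ∀ b, Fails pl i ω b ↔ Fails pl i ω' b := fun b => by
        have := dependsOn_fails pl i b hh
        simpa using this
      simp only [this])
    (fun x hx ω ω' => abs_card_fails_sub_le pl i hx ω ω')
  have h2 : ∫ ω, ((Finset.univ.filter fun b => Fails pl i ω b).card : ℝ) ∂p.prob ≤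
      (0.85 : ℝ) ^ ⌊p.k i⌋₊ * (remaining pl).card := by
    have h3 : ∀ ω, ((Finset.univ.filter fun b => Fails pl i ω b).card : ℝ) =
        ∑ b ∈ remaining pl, {ω | Fails pl i ω b}.indicator (1 : p.Outcome → ℝ) ω := by
      intro ω
      have : (Finset.univ.filter fun b => Fails pl i ω b) =
          (remaining pl).filter fun b => Fails pl i ω b := by
        ext b
        simp only [Finset.mem_filter, Finset.mem_univ, true_and, mem_remaining]
        exact ⟨fun h => ⟨h.1, h⟩, fun h => h.2⟩
      rw [this, Finset.card_filter]
      push_cast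
      rfl
    simp only [h3]
    rw [integral_finsetSum]
    · simp only [integral_indicator_one (measurableSet_fails pl i _)]
      calc _ ≤ ∑ b ∈ remaining pl, (0.85 : ℝ) ^ ⌊p.k i⌋₊ := by
            refine Finset.sum_le_sum fun b _ => ?_
            exact ENNReal.toReal_le_of_le_ofReal (by positivity) (h.prob_fails_le hk hkn hR b)
        _ = _ := by simp [mul_comm]
    · intro b _
      exact (integrable_const 1).indicator (measurableSet_fails pl i b)
  refine le_trans (measure_mono fun ω hω => ?_) (h1.trans (ENNReal.ofReal_le_ofReal ?_))
  · exact le_trans (add_le_add_left h2 _) hω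
  · rw [Real.exp_le_exp, neg_le_neg_iff]
    have h3 : ((p.n : ℝ) ^ (3 / 4 : ℝ)) ^ 2 = p.n * √p.n := by
      rw [Real.sqrt_eq_rpow, ← Real.rpow_natCast, ← Real.rpow_mul hn0.le, ← Real.rpow_one_add' hn0.le]
      all_goals norm_num
    rw [h3]
    apply le_of_eq
    field_simp
    norm_num

/-- With positive probability some request reaches a bin with at most one ball. -/
lemma prob_forall_request_full_le {pl : p.Ball → Option p.Bin} {i : ℕ}
    (hk : 1 ≤ ⌊p.k i⌋₊) (b : p.Ball) :
    p.prob {ω | ∀ s < ⌊p.k i⌋₊, ω (.request b i s) ∉ nonfull pl} ≤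
      ENNReal.ofReal (p.n / (2 * p.numUsed)) := by
  have hm : (0 : ℝ) < p.numUsed := by exact_mod_cast p.numUsed_pos
  calc _ ≤ p.prob {ω | ∀ s < 1, ω (.request b i s) ∉ nonfull pl} :=
        measure_mono fun ω hω s hs => (show ∀ s < ⌊p.k i⌋₊, _ from hω) s (by omega)
    _ = ENNReal.ofReal ((1 - (nonfull pl).card / p.numUsed) ^ 1) := prob_forall_request_notMem b i 1 _
    _ ≤ _ := by
      refine ENNReal.ofReal_le_ofReal ?_
      have h3 : (2 * p.numUsed : ℝ) ≤ 2 * (nonfull pl).card + p.n := by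
        exact_mod_cast two_mul_numUsed_le pl
      rw [pow_one, ← sub_nonneg]
      have : (p.n : ℝ) / (2 * p.numUsed) - (1 - (nonfull pl).card / p.numUsed) =
          (2 * (nonfull pl).card + p.n - 2 * p.numUsed) / (2 * p.numUsed) := by
        field_simp; ring
      rw [this]
      exact div_nonneg (by linarith) (by linarith)

lemma sum_requests_eq_card (pl : p.Ball → Option p.Bin) (i : ℕ) (ω : p.Outcome) (v : p.Bin) :
    ∑ b, p.requests ω pl i b v = ((remaining pl ×ˢ Finset.range ⌊p.k i⌋₊).filter fun z =>
      p.requestBin ω z.1 i z.2 = v).card := by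
  rw [Finset.card_filter, Finset.sum_product, remaining, Finset.sum_filter]
  refine Finset.sum_congr rfl fun b _ => ?_
  simp only [requests, Finset.card_filter]

lemma measurableSet_requestBin (i : ℕ) (v : p.Bin) (z : p.Ball × ℕ) :
    MeasurableSet {ω | p.requestBin ω z.1 i z.2 = v} :=
  measurableSet_of_dependsOn p (Set.finite_singleton (Coin.request z.1 i z.2)) fun ω ω' h => by
    simp only [Set.mem_ofPred_eq, requestBin, h _ rfl]

lemma prob_requestBin_le (i : ℕ) (v : p.Bin) (z : p.Ball × ℕ) :
    p.prob {ω | p.requestBin ω z.1 i z.2 = v} ≤ ENNReal.ofReal (1 / p.numUsed) := by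
  by_cases hv : (v : ℕ) < p.numUsed
  · refine le_trans (measure_mono fun ω hω => ?_)
      (p.prob_coin_eq (.request z.1 i z.2) ⟨v, hv⟩).le
    have hω' : p.requestBin ω z.1 i z.2 = v := hω
    subst hω'
    exact Fin.ext rfl
  · rw [show {ω | p.requestBin ω z.1 i z.2 = v} = ∅ from ?_]
    · simp
    · ext ω
      simp only [Set.mem_ofPred_eq, Set.mem_empty_iff_false, iff_false]
      intro h
      refine hv ?_
      rw [← h]
      exact (ω (.request z.1 i z.2)).isLt

/-- The exponential moments of the number of requests received by a bin. -/
lemma lintegral_pow_sum_requests_le (pl : p.Ball → Option p.Bin) (i : ℕ) (v : p.Bin) {y : ℝ}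
    (hy : 0 ≤ y) :
    ∫⁻ ω, ENNReal.ofReal (1 + y) ^ (∑ b, p.requests ω pl i b v) ∂p.prob ≤
      ENNReal.ofReal (Real.exp (y * (1 / p.numUsed * ((remaining pl).card * ⌊p.k i⌋₊)))) := by
  simp only [sum_requests_eq_card]
  have := lintegral_pow_card_le p.coinLaw (remaining pl ×ˢ Finset.range ⌊p.k i⌋₊)
    (fun z => {Coin.request z.1 i z.2})
    (fun z z' hz => by
      refine Set.disjoint_singleton.2 fun h => ?_
      simp only [Coin.request.injEq, true_and] at h
      exact hz (Prod.ext h.1 h.2)) (fun z => {ω | p.requestBin ω z.1 i z.2 = v})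
    (fun z ω ω' h => by simp only [Set.mem_ofPred_eq, requestBin, h _ rfl])
    (measurableSet_requestBin i v) (q := 1 / p.numUsed) (by positivity) hy
    (fun z _ => prob_requestBin_le i v z)
  rw [Finset.card_product, Finset.card_range, Nat.cast_mul] at this
  convert this using 4
  · rfl
  · congr

lemma lintegral_sum_requests_le (pl : p.Ball → Option p.Bin) (i : ℕ) (v : p.Bin) :
    ∫⁻ ω, ((∑ b, p.requests ω pl i b v : ℕ) : ℝ≥0∞) ∂p.prob ≤
      ENNReal.ofReal (1 / p.numUsed) * ((remaining pl).card * ⌊p.k i⌋₊ : ℕ) := by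
  simp only [sum_requests_eq_card, Finset.card_filter]
  push_cast
  have h : ∀ ω, (∑ z ∈ remaining pl ×ˢ Finset.range ⌊p.k i⌋₊,
      (if p.requestBin ω z.1 i z.2 = v then 1 else 0 : ℝ≥0∞)) =
      ∑ z ∈ remaining pl ×ˢ Finset.range ⌊p.k i⌋₊,
        {ω | p.requestBin ω z.1 i z.2 = v}.indicator 1 ω := fun ω =>
    Finset.sum_congr rfl fun z _ => by simp [Set.indicator_apply]
  simp only [h]
  rw [lintegral_finsetSum _ fun z _ => measurable_one.indicator (measurableSet_requestBin i v z)]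
  simp only [lintegral_indicator_one (measurableSet_requestBin i v _)]
  calc _ ≤ ∑ z ∈ remaining pl ×ˢ Finset.range ⌊p.k i⌋₊, ENNReal.ofReal (1 / p.numUsed) :=
        Finset.sum_le_sum fun z _ => prob_requestBin_le i v z
    _ = _ := by
        rw [Finset.sum_const, Finset.card_product, Finset.card_range, nsmul_eq_mul, mul_comm]
        push_cast
        rfl

end Phase

end Params

end BallsIntoBins

namespace BallsIntoBins

namespace Params

/-! ## The search for coordinators -/

section Search

variable {p : Params}

/-- The coins that determine which intervals ball `b` contacts. -/
def contactCoins (b : p.Ball) : Set (Coin p.n) := {.participate b, .interval b}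

lemma finite_contactCoins (b : p.Ball) : (contactCoins b).Finite := by
  simp [contactCoins]

lemma disjoint_contactCoins {b b' : p.Ball} (h : b ≠ b') :
    Disjoint (contactCoins b) (contactCoins b') := by
  rw [Set.disjoint_left]
  rintro x (rfl | rfl) (h' | h') <;> simp_all

lemma dependsOn_contacts (b : p.Ball) (j : Fin p.numIntervals) :
    DependsOn (fun ω => p.Contacts ω b j) (contactCoins b) := by
  intro ω ω' h
  simp only [Contacts]
  rw [h (.participate b) (Or.inl rfl), h (.interval b) (Or.inr rfl)]

lemma dependsOn_contacts_mem (b : p.Ball) (J : Finset (Fin p.numIntervals)) :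
    DependsOn (fun ω => ∃ j ∈ J, p.Contacts ω b j) (contactCoins b) := by
  intro ω ω' h
  have := fun j => dependsOn_contacts b j h
  simp only at this
  simp only [this]

lemma measurableSet_contacts_mem (b : p.Ball) (J : Finset (Fin p.numIntervals)) :
    MeasurableSet {ω | ∃ j ∈ J, p.Contacts ω b j} :=
  measurableSet_of_dependsOn p (finite_contactCoins b) (dependsOn_contacts_mem b J)

lemma prob_participate (b : p.Ball) :
    p.prob {ω | (ω (.participate b)).val = 0} = ENNReal.ofReal (1 / p.l) := by
  have h : p.prob {ω | ω (.participate b) = (⟨0, p.one_le_l⟩ : Fin p.l)} =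
      ENNReal.ofReal (1 / p.l) := p.prob_coin_eq (.participate b) ⟨0, p.one_le_l⟩
  rw [← h]
  congr 1
  ext ω
  exact ⟨fun h => Fin.ext h, fun h => congrArg Fin.val h⟩

lemma prob_contacts_mem (b : p.Ball) (J : Finset (Fin p.numIntervals)) :
    p.prob {ω | ∃ j ∈ J, p.Contacts ω b j} = ENNReal.ofReal (J.card / p.numUsed) := by
  have h : {ω : p.Outcome | ∃ j ∈ J, p.Contacts ω b j} =
      {ω | (ω (.participate b)).val = 0} ∩ {ω | ω (.interval b) ∈ J} := by
    ext ω
    constructor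
    · rintro ⟨j, hj, h1, h2⟩
      subst h2
      exact ⟨h1, hj⟩
    · rintro ⟨h1, h2⟩
      exact ⟨_, h2, h1, rfl⟩
  have d1 : DependsOn (fun ω : p.Outcome => ω ∈ {ω : p.Outcome | (ω (.participate b)).val = 0})
      {Coin.participate b} := fun ω ω' h => by simp only [Set.mem_ofPred_eq, h _ rfl]
  have d2 : DependsOn (fun ω : p.Outcome => ω ∈ {ω : p.Outcome | ω (.interval b) ∈ J})
      {Coin.interval b} := fun ω ω' h => by
    simp only [Set.mem_ofPred_eq]
    rw [h _ rfl]
  have h2 : p.prob {ω | ω (.interval b) ∈ J} = ENNReal.ofReal (J.card / p.numIntervals) :=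
    p.prob_coin (.interval b) J
  rw [h]
  have h3 := measure_inter_of_dependsOn p.coinLaw (by simp) d1 d2
    (measurableSet_of_dependsOn p (Set.finite_singleton _) d1)
    (measurableSet_of_dependsOn p (Set.finite_singleton _) d2)
  refine h3.trans ((congrArg₂ (· * ·) (prob_participate b) h2).trans ?_)
  rw [← ENNReal.ofReal_mul (by positivity)]
  congr 1
  rw [numUsed]
  push_cast
  rw [div_mul_div_comm, one_mul, mul_comm (p.l : ℝ)]

lemma prob_contacts (b : p.Ball) (j : Fin p.numIntervals) :
    p.prob {ω | p.Contacts ω b j} = ENNReal.ofReal (1 / p.numUsed) := by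
  simpa using prob_contacts_mem b {j}

lemma measurableSet_contacts (b : p.Ball) (j : Fin p.numIntervals) :
    MeasurableSet {ω | p.Contacts ω b j} :=
  measurableSet_of_dependsOn p (finite_contactCoins b) (dependsOn_contacts b j)

/-- Two of the balls in `E` contact the same interval in `J` with identical strings. -/
def Collide (E : Finset p.Ball) (J : Finset (Fin p.numIntervals)) (ω : p.Outcome) : Prop :=
  ∃ b ∈ E, ∃ b' ∈ E, b ≠ b' ∧ ∃ j ∈ J, p.Contacts ω b j ∧ p.Contacts ω b' j ∧
    (ω (.bits b)).val = (ω (.bits b')).val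

/-- No ball of `E` contacts an interval in `J`, or there is a collision. -/
def Quiet (E : Finset p.Ball) (J : Finset (Fin p.numIntervals)) (ω : p.Outcome) : Prop :=
  (∀ b ∈ E, ¬ ∃ j ∈ J, p.Contacts ω b j) ∨ Collide E J ω

/-- Without collisions, the ball with the smallest string wins. The set `E` need only contain the
balls that contact `j`; this allows a ball to be left out whose coins must stay independent of the
event. -/
lemma exists_acknowledged {ω : p.Outcome} {E : Finset p.Ball} {J : Finset (Fin p.numIntervals)}
    {j : Fin p.numIntervals} (hj : j ∈ J) (hE : ∀ b, p.Contacts ω b j → b ∈ E)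
    (hb : ∃ b, p.Contacts ω b j) (hc : ¬ Collide E J ω) : ∃ b, p.Acknowledged ω b j := by
  obtain ⟨b, hb⟩ := hb
  obtain ⟨a, ha, hmin⟩ := Finset.exists_min_image (Finset.univ.filter fun b => p.Contacts ω b j)
    (fun b => (ω (.bits b)).val) ⟨b, by simpa using hb⟩
  refine ⟨a, by simpa using ha, fun b₁ b₂ h1 h2 h3 => ?_, fun b' hb' => hmin b' (by simpa using hb')⟩
  by_contra h4
  exact hc ⟨b₁, hE _ h1, b₂, hE _ h2, h4, j, hj, h1, h2, h3⟩

/-- The coins used by the balls `E` in the search for coordinators. -/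
def searchCoins (E : Finset p.Ball) : Set (Coin p.n) :=
  {x | ∃ b ∈ E, x = .participate b ∨ x = .interval b ∨ x = .bits b}

lemma finite_searchCoins (E : Finset p.Ball) : (searchCoins E).Finite := by
  refine ((Set.finite_range (Coin.participate (n := p.n))).union
    ((Set.finite_range (Coin.interval (n := p.n))).union
    (Set.finite_range (Coin.bits (n := p.n))))).subset ?_
  rintro x ⟨b, -, rfl | rfl | rfl⟩ <;> simp

lemma contactCoins_subset {E : Finset p.Ball} {b : p.Ball} (hb : b ∈ E) :
    contactCoins b ⊆ searchCoins E := by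
  rintro x (rfl | rfl)
  exacts [⟨b, hb, Or.inl rfl⟩, ⟨b, hb, Or.inr (Or.inl rfl)⟩]

lemma dependsOn_collide (E : Finset p.Ball) (J : Finset (Fin p.numIntervals)) :
    DependsOn (Collide E J) (searchCoins E) := by
  intro ω ω' h
  simp only [Collide, eq_iff_iff]
  refine exists_congr fun b => and_congr_right fun hb => exists_congr fun b' =>
    and_congr_right fun hb' => and_congr_right fun _ => exists_congr fun j =>
    and_congr_right fun _ => ?_
  have h1 := (dependsOn_contacts b j).mono (contactCoins_subset hb) h
  have h2 := (dependsOn_contacts b' j).mono (contactCoins_subset hb') h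
  rw [h1, h2, h (.bits b) ⟨b, hb, by simp⟩, h (.bits b') ⟨b', hb', by simp⟩]

lemma dependsOn_quiet (E : Finset p.Ball) (J : Finset (Fin p.numIntervals)) :
    DependsOn (Quiet E J) (searchCoins E) := by
  intro ω ω' h
  have h1 : ∀ b ∈ E, (∃ j ∈ J, p.Contacts ω b j) = (∃ j ∈ J, p.Contacts ω' b j) := fun b hb =>
    (dependsOn_contacts_mem b J).mono (contactCoins_subset hb) h
  simp only [Quiet, eq_iff_iff]
  refine or_congr (forall_congr' fun b => forall_congr' fun hb => ?_) ?_
  · rw [h1 b hb]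
  · rw [dependsOn_collide E J h]

lemma measurableSet_quiet (E : Finset p.Ball) (J : Finset (Fin p.numIntervals)) :
    MeasurableSet {ω | Quiet E J ω} :=
  measurableSet_of_dependsOn p (finite_searchCoins E) (dependsOn_quiet E J)

lemma prob_no_contact (E : Finset p.Ball) (J : Finset (Fin p.numIntervals)) :
    p.prob {ω | ∀ b ∈ E, ¬ ∃ j ∈ J, p.Contacts ω b j} =
      ENNReal.ofReal ((1 - J.card / p.numUsed) ^ E.card) := by
  have hm : (J.card : ℝ) / p.numUsed ≤ 1 := by
    rw [div_le_one (by exact_mod_cast p.numUsed_pos)]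
    have h1 : J.card ≤ p.numIntervals := (Finset.card_le_univ J).trans (by simp)
    exact_mod_cast h1.trans (Nat.le_mul_of_pos_right _ p.one_le_l)
  have mE : MeasurableSet {ω | ∀ b ∈ E, ¬ ∃ j ∈ J, p.Contacts ω b j} := by
    have : {ω | ∀ b ∈ E, ¬ ∃ j ∈ J, p.Contacts ω b j} =
        ⋂ b ∈ E, {ω | ∃ j ∈ J, p.Contacts ω b j}ᶜ := by
      ext ω
      simp
    rw [this]
    exact Finset.measurableSet_biInter _ fun b _ => (measurableSet_contacts_mem b J).compl
  have h1 := lintegral_prod_of_dependsOn p.coinLaw E contactCoins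
    (fun b b' hb => disjoint_contactCoins hb)
    (fun b => ({ω | ∃ j ∈ J, p.Contacts ω b j}ᶜ).indicator 1)
    (fun b ω ω' h => by
      have := dependsOn_contacts_mem b J h
      simp only at this
      simp only [Set.indicator_apply, Set.mem_compl_iff, Set.mem_ofPred_eq, this,
        Pi.one_apply])
    (fun b => measurable_one.indicator (measurableSet_contacts_mem b J).compl)
  rw [← lintegral_indicator_one mE]
  refine Eq.trans ?_ (h1.trans ?_)
  · refine lintegral_congr fun ω => ?_
    by_cases h : ∀ b ∈ E, ¬ ∃ j ∈ J, p.Contacts ω b j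
    · rw [Set.indicator_of_mem (by exact h), Finset.prod_eq_one]
      · rfl
      · intro b hb
        rw [Set.indicator_of_mem (by exact h b hb)]
        rfl
    · rw [Set.indicator_of_notMem (by exact h)]
      push Not at h
      obtain ⟨b, hb, h⟩ := h
      refine (Finset.prod_eq_zero hb ?_).symm
      rw [Set.indicator_of_notMem]
      exact fun h' => h' h
  · rw [ENNReal.ofReal_pow (by linarith), ← Finset.prod_const]
    refine Finset.prod_congr rfl fun b _ => ?_
    rw [lintegral_indicator_one (measurableSet_contacts_mem b J).compl]
    change p.prob _ = _
    rw [prob_compl_eq_one_sub (measurableSet_contacts_mem b J), prob_contacts_mem,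
      ENNReal.ofReal_sub _ (by positivity), ENNReal.ofReal_one]

/-- Resampling the string of `b` alone leaves both contacts unchanged, and it has to hit one
prescribed value, the string of `b'`. -/
lemma prob_collide_pair_le {b b' : p.Ball} (hb : b ≠ b') (j : Fin p.numIntervals) :
    p.prob {ω | p.Contacts ω b j ∧ p.Contacts ω b' j ∧
      (ω (.bits b)).val = (ω (.bits b')).val} ≤
      ENNReal.ofReal (1 / (p.numUsed : ℝ) ^ 2 * (1 / 2 ^ p.numBits)) := by
  have d1 : DependsOn (fun ω => ω ∈ {ω | p.Contacts ω b j ∧ p.Contacts ω b' j ∧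
      (ω (.bits b)).val = (ω (.bits b')).val}) (searchCoins {b, b'}) := by
    intro ω ω' h
    have h1 := (dependsOn_contacts b j).mono (contactCoins_subset (by simp)) h
    have h2 := (dependsOn_contacts b' j).mono (contactCoins_subset (by simp)) h
    simp only [Set.mem_ofPred_eq]
    rw [h1, h2, h (.bits b) ⟨b, by simp⟩, h (.bits b') ⟨b', by simp⟩]
  have mC : MeasurableSet ({ω | p.Contacts ω b j} ∩ {ω | p.Contacts ω b' j}) :=
    (measurableSet_contacts b j).inter (measurableSet_contacts b' j)
  have h1 := measure_le_of_splice p.coinLaw {Coin.bits b}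
    (measurableSet_of_dependsOn p (finite_searchCoins _) d1)
    (g := fun ω => ENNReal.ofReal (1 / 2 ^ p.numBits) *
      ({ω | p.Contacts ω b j} ∩ {ω | p.Contacts ω b' j}).indicator 1 ω) fun ω => by
    have e1 : ∀ b₀ ω', p.Contacts (splice {Coin.bits b} ω ω') b₀ j = p.Contacts ω b₀ j := fun b₀ ω' =>
      DependsOn.splice_eq_left (dependsOn_contacts b₀ j) (by simp [contactCoins]) _ _
    by_cases h : p.Contacts ω b j ∧ p.Contacts ω b' j
    · rw [Set.indicator_of_mem (by exact h), Pi.one_apply, mul_one]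
      have h2 : p.prob {ω' | ω' (.bits b) = (ω (.bits b') : Fin (2 ^ p.numBits))} =
          ENNReal.ofReal (1 / (2 ^ p.numBits : ℕ)) := p.prob_coin_eq (.bits b) (ω (.bits b'))
      push_cast at h2
      rw [← h2]
      refine measure_mono fun ω' hω' => ?_
      have h3 := hω'.2.2
      rw [splice_of_mem (by simp), splice_of_notMem (by simpa using hb.symm)] at h3
      exact Fin.ext h3
    · have : {ω' | splice {Coin.bits b} ω ω' ∈ {ω | p.Contacts ω b j ∧ p.Contacts ω b' j ∧
          (ω (.bits b)).val = (ω (.bits b')).val}} = ∅ := by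
        ext ω'
        simp only [Set.mem_ofPred_eq, e1, Set.mem_empty_iff_false, iff_false]
        exact fun h' => h ⟨h'.1, h'.2.1⟩
      rw [this]
      simp
  refine h1.trans ?_
  have h2 : p.prob ({ω | p.Contacts ω b j} ∩ {ω | p.Contacts ω b' j}) =
      p.prob {ω | p.Contacts ω b j} * p.prob {ω | p.Contacts ω b' j} :=
    measure_inter_of_dependsOn p.coinLaw (disjoint_contactCoins hb) (dependsOn_contacts b j)
      (dependsOn_contacts b' j) (measurableSet_contacts b j) (measurableSet_contacts b' j)
  rw [lintegral_const_mul _ (measurable_one.indicator mC), lintegral_indicator_one mC]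
  change _ * p.prob _ ≤ _
  rw [h2, prob_contacts, prob_contacts, ← ENNReal.ofReal_mul (by positivity),
    ← ENNReal.ofReal_mul (by positivity)]
  refine ENNReal.ofReal_le_ofReal (le_of_eq ?_)
  ring

lemma sq_div_two_pow_numBits_le (hc : 0 < p.c) : (p.n : ℝ) ^ 2 * (1 / 2 ^ p.numBits) ≤ 1 := by
  have hn : (1 : ℝ) ≤ p.n := by
    exact_mod_cast (Nat.one_le_pow _ _ p.one_le_l).trans p.sq_le_n
  have h0 : 0 ≤ Real.logb 2 p.n := Real.logb_nonneg one_lt_two hn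
  have h1 : (2 : ℝ) * Real.logb 2 p.n ≤ p.numBits :=
    (mul_le_mul_of_nonneg_right (by linarith) h0).trans (Nat.le_ceil _)
  have h2 : (p.n : ℝ) ^ 2 ≤ 2 ^ p.numBits := by
    calc (p.n : ℝ) ^ 2 = (2 : ℝ) ^ (2 * Real.logb 2 p.n) := by
          rw [mul_comm, Real.rpow_mul two_pos.le, Real.rpow_logb two_pos (by norm_num) (by linarith)]
          norm_num
      _ ≤ (2 : ℝ) ^ (p.numBits : ℝ) := Real.rpow_le_rpow_of_exponent_le one_le_two h1
      _ = _ := Real.rpow_natCast _ _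
  rw [mul_one_div, div_le_one (by positivity)]
  exact h2

/-- A union bound over at most `n ^ 2` ordered pairs for each interval. The strings have at least `2
* log n` bits, which cancels the factor `n ^ 2`. -/
lemma prob_collide_le (hc : 0 < p.c) (E : Finset p.Ball) (J : Finset (Fin p.numIntervals)) :
    p.prob {ω | Collide E J ω} ≤ ENNReal.ofReal (J.card / (p.numUsed : ℝ) ^ 2) := by
  have h : {ω | Collide E J ω} ⊆ ⋃ z ∈ (E ×ˢ E ×ˢ J).filter fun z => z.1 ≠ z.2.1,
      {ω | p.Contacts ω z.1 z.2.2 ∧ p.Contacts ω z.2.1 z.2.2 ∧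
        (ω (.bits z.1)).val = (ω (.bits z.2.1)).val} := by
    rintro ω ⟨b, hb, b', hb', hne, j, hj, h1⟩
    exact Set.mem_biUnion (x := (b, b', j)) (by simp [hb, hb', hne, hj]) h1
  have hE : (E.card : ℝ) ≤ p.n := by exact_mod_cast (Finset.card_le_univ E).trans (by simp)
  calc _ ≤ ∑ z ∈ (E ×ˢ E ×ˢ J).filter fun z => z.1 ≠ z.2.1,
        ENNReal.ofReal (1 / (p.numUsed : ℝ) ^ 2 * (1 / 2 ^ p.numBits)) :=
        (measure_mono h).trans ((measure_biUnion_finset_le _ _).trans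
          (Finset.sum_le_sum fun z hz => prob_collide_pair_le (Finset.mem_filter.1 hz).2 _))
    _ ≤ (E ×ˢ E ×ˢ J).card • ENNReal.ofReal (1 / (p.numUsed : ℝ) ^ 2 * (1 / 2 ^ p.numBits)) := by
        rw [Finset.sum_const]
        gcongr
        exact Finset.filter_subset _ _
    _ = ENNReal.ofReal ((E.card * E.card * J.card) *
          (1 / (p.numUsed : ℝ) ^ 2 * (1 / 2 ^ p.numBits))) := by
        rw [nsmul_eq_mul, ← ENNReal.ofReal_natCast, ← ENNReal.ofReal_mul (by positivity),
          Finset.card_product, Finset.card_product]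
        congr 1
        push_cast
        ring
    _ ≤ _ := by
        refine ENNReal.ofReal_le_ofReal ?_
        have h1 := sq_div_two_pow_numBits_le hc
        have h2 : (E.card * E.card : ℝ) * (1 / 2 ^ p.numBits) ≤ 1 := by
          refine le_trans ?_ h1
          rw [sq]
          gcongr
        calc _ = ((E.card * E.card : ℝ) * (1 / 2 ^ p.numBits)) * (J.card / (p.numUsed : ℝ) ^ 2) := by
              ring
          _ ≤ 1 * (J.card / (p.numUsed : ℝ) ^ 2) := by gcongr
          _ = _ := one_mul _

lemma prob_quiet_le (hc : 0 < p.c) (E : Finset p.Ball) (J : Finset (Fin p.numIntervals)) :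
    p.prob {ω | Quiet E J ω} ≤ ENNReal.ofReal
      (Real.exp (-(E.card * J.card / p.numUsed)) + J.card / (p.numUsed : ℝ) ^ 2) := by
  have hm : (J.card : ℝ) / p.numUsed ≤ 1 := by
    rw [div_le_one (by exact_mod_cast p.numUsed_pos)]
    have h1 : J.card ≤ p.numIntervals := (Finset.card_le_univ J).trans (by simp)
    exact_mod_cast h1.trans (Nat.le_mul_of_pos_right _ p.one_le_l)
  have h1 := measure_union_le (μ := p.prob) {ω | ∀ b ∈ E, ¬ ∃ j ∈ J, p.Contacts ω b j}
    {ω | Collide E J ω}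
  refine h1.trans ?_
  rw [prob_no_contact, ENNReal.ofReal_add (Real.exp_nonneg _) (by positivity)]
  refine add_le_add (ENNReal.ofReal_le_ofReal ?_) (prob_collide_le hc E J)
  calc _ ≤ (Real.exp (-(J.card / p.numUsed))) ^ E.card :=
        pow_le_pow_left₀ (by linarith) (Real.one_sub_le_exp_neg _) _
    _ = _ := by
        rw [← Real.exp_nat_mul]
        ring_nf

/-! ### Intervals without coordinator -/

/-- The intervals without coordinator. -/
noncomputable def uncovered (ω : p.Outcome) : Finset (Fin p.numIntervals) :=
  Finset.univ.filter fun i => ¬ Covered ω i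

/-- Changing the search coins of `b₀` affects only its old and its new interval. This supplies the
bounded differences for `uncovered`. -/
lemma acknowledged_congr {ω ω' : p.Outcome} {b₀ : p.Ball}
    (h : ∀ x, x ∉ searchCoins {b₀} → ω x = ω' x) {j : Fin p.numIntervals}
    (hj : ω (.interval b₀) ≠ j) (hj' : ω' (.interval b₀) ≠ j) (b : p.Ball) :
    p.Acknowledged ω b j ↔ p.Acknowledged ω' b j := by
  have e1 : ∀ b, p.Contacts ω b j ↔ p.Contacts ω' b j := by
    intro b
    by_cases hb : b = b₀
    · subst hb
      exact ⟨fun h => absurd h.2 hj, fun h => absurd h.2 hj'⟩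
    · rw [Contacts, Contacts, h (.participate b) (by simpa [searchCoins] using hb),
        h (.interval b) (by simpa [searchCoins] using hb)]
  have e2 : ∀ b, p.Contacts ω' b j → ω (.bits b) = ω' (.bits b) := by
    intro b hb
    refine h _ ?_
    simp only [searchCoins, Finset.mem_singleton, Set.mem_ofPred_eq, exists_eq_left]
    simp only [reduceCtorEq, Coin.bits.injEq, false_or]
    rintro rfl
    exact hj' hb.2
  simp only [Acknowledged, e1]
  refine and_congr_right fun hb => and_congr ?_ ?_
  · refine forall_congr' fun b₁ => forall_congr' fun b₂ => forall_congr' fun h1 =>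
      forall_congr' fun h2 => ?_
    rw [e2 _ h1, e2 _ h2]
  · refine forall_congr' fun b' => forall_congr' fun hb' => ?_
    rw [e2 _ hb, e2 _ hb']

lemma dependsOn_acknowledged (b : p.Ball) (j : Fin p.numIntervals) :
    DependsOn (fun ω => p.Acknowledged ω b j) (searchCoins Finset.univ) := by
  intro ω ω' h
  have e1 : ∀ b, p.Contacts ω b j = p.Contacts ω' b j := fun b =>
    (dependsOn_contacts b j).mono (contactCoins_subset (Finset.mem_univ b)) h
  have e2 : ∀ b, ω (.bits b) = ω' (.bits b) := fun b => h _ ⟨b, by simp⟩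
  simp only [Acknowledged, e1, e2]

lemma dependsOn_uncovered : DependsOn (uncovered (p := p)) (searchCoins Finset.univ) := by
  intro ω ω' h
  have := fun b j => dependsOn_acknowledged b j h
  simp only at this
  ext i
  simp [uncovered, Covered, this]

lemma dependsOn_block (b : p.Ball) :
    DependsOn (fun ω => p.block ω b) (searchCoins Finset.univ) := by
  intro ω ω' h
  have := fun b j => dependsOn_acknowledged b j h
  simp only at this
  ext v
  simp [block, Coordinates, this]

/-- The `l` intervals that come last up to interval `i`. -/
noncomputable def window (i : Fin p.numIntervals) : Finset (Fin p.numIntervals) :=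
  Finset.univ.filter fun j => ∃ s < p.l, i = p.shift j s

lemma card_window (i : Fin p.numIntervals) : (window i).card = p.l := by
  choose g hg using fun s => shift_left_surjective (p := p) s i
  have : window i = (Finset.range p.l).image g := by
    ext j
    simp only [window, Finset.mem_filter, Finset.mem_univ, true_and, Finset.mem_image,
      Finset.mem_range]
    refine exists_congr fun s => and_congr_right fun _ => ?_
    constructor
    · intro h
      exact shift_left_injective s ((hg s).trans h)
    · rintro rfl
      exact (hg s).symm
  rw [this, Finset.card_image_of_injOn, Finset.card_range]
  intro s hs t ht h
  refine shift_right_injOn (g s) (by simpa using hs) (by simpa using ht) ?_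
  have h1 : p.shift (g s) s = i := hg s
  have h2 : p.shift (g t) t = i := hg t
  rw [h1, h, h2]

/-- A contact in the window without collisions would produce an acknowledgement, and then `i` would
be covered. -/
lemma quiet_window_of_mem_uncovered {ω : p.Outcome} {i : Fin p.numIntervals}
    (h : i ∈ uncovered ω) : Quiet Finset.univ (window i) ω := by
  by_contra hq
  simp only [Quiet, not_or, Finset.mem_univ, forall_true_left, not_forall, not_not] at hq
  obtain ⟨⟨b, j, hj, hb⟩, hc⟩ := hq
  have h1 := exists_acknowledged hj (fun _ _ => Finset.mem_univ _) ⟨b, hb⟩ hc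
  simp only [uncovered, Finset.mem_filter, Finset.mem_univ, true_and] at h
  simp only [window, Finset.mem_filter, Finset.mem_univ, true_and] at hj
  obtain ⟨s, hs, rfl⟩ := hj
  exact h ⟨j, s, hs, rfl, h1⟩

lemma measurableSet_mem_uncovered (i : Fin p.numIntervals) :
    MeasurableSet {ω | i ∈ uncovered ω} :=
  measurableSet_of_dependsOn p (finite_searchCoins _) fun ω ω' h => by
    simp only [Set.mem_ofPred_eq]
    rw [dependsOn_uncovered h]

lemma prob_mem_uncovered_le (hc : 0 < p.c) (i : Fin p.numIntervals) :
    p.prob {ω | i ∈ uncovered ω} ≤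
      ENNReal.ofReal (Real.exp (-p.l) + p.l / (p.numUsed : ℝ) ^ 2) := by
  refine (measure_mono (show {ω | i ∈ uncovered ω} ⊆ {ω | Quiet Finset.univ (window i) ω} from
    fun ω hω => quiet_window_of_mem_uncovered hω)).trans ((prob_quiet_le hc Finset.univ (window i)).trans (ENNReal.ofReal_le_ofReal ?_))
  rw [card_window, Finset.card_univ, Fintype.card_fin]
  gcongr
  rw [le_div_iff₀ (by exact_mod_cast p.numUsed_pos), mul_comm]
  gcongr
  exact_mod_cast p.numUsed_le

lemma card_uncovered_eq (ω : p.Outcome) : ((uncovered ω).card : ℝ) =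
    ∑ i, {ω | i ∈ uncovered ω}.indicator (1 : p.Outcome → ℝ) ω := by
  simp only [Set.indicator_apply, Set.mem_ofPred_eq, Pi.one_apply, Finset.sum_boole,
    Finset.filter_univ_mem]

lemma integral_card_uncovered_le (hc : 0 < p.c) :
    ∫ ω, ((uncovered ω).card : ℝ) ∂p.prob ≤
      p.numIntervals * (Real.exp (-p.l) + p.l / (p.numUsed : ℝ) ^ 2) := by
  simp only [card_uncovered_eq]
  rw [integral_finsetSum]
  · simp only [integral_indicator_one (measurableSet_mem_uncovered _)]
    calc _ ≤ ∑ i : Fin p.numIntervals, (Real.exp (-p.l) + p.l / (p.numUsed : ℝ) ^ 2) := by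
          refine Finset.sum_le_sum fun i _ => ?_
          exact ENNReal.toReal_le_of_le_ofReal (by positivity) (prob_mem_uncovered_le hc i)
      _ = _ := by rw [Finset.sum_const, Finset.card_univ, Fintype.card_fin, nsmul_eq_mul]
  · intro i _
    exact (integrable_const 1).indicator (measurableSet_mem_uncovered i)

/-- Two intervals may change their acknowledgement, and each of them covers only itself and the `l -
1` intervals that follow. -/
lemma card_uncovered_le {ω ω' : p.Outcome} {b₀ : p.Ball}
    (h : ∀ x, x ∉ searchCoins {b₀} → ω x = ω' x) :
    (uncovered ω).card ≤ (uncovered ω').card + 2 * p.l := by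
  have h1 : ∀ j : Fin p.numIntervals, ((Finset.range p.l).image (p.shift j)).card ≤ p.l :=
    fun j => Finset.card_image_le.trans (by simp)
  unfold uncovered
  refine (card_filter_le_add _ ((Finset.range p.l).image (p.shift (ω (.interval b₀))) ∪
    (Finset.range p.l).image (p.shift (ω' (.interval b₀)))) ?_).trans
    (Nat.add_le_add_left ((Finset.card_union_le _ _).trans
      ((Nat.add_le_add (h1 _) (h1 _)).trans (two_mul p.l).ge)) _)
  intro i _ h2 h3
  rw [not_not] at h3
  obtain ⟨j, s, hs, rfl, b, hb⟩ := h3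
  by_contra h4
  simp only [Finset.mem_union, Finset.mem_image, Finset.mem_range, not_or, not_exists,
    not_and] at h4
  refine h2 ⟨j, s, hs, rfl, b, (acknowledged_congr h ?_ ?_ b).2 hb⟩
  · rintro rfl; exact h4.1 s hs rfl
  · rintro rfl; exact h4.2 s hs rfl

/-- The number of intervals without coordinator is concentrated. -/
theorem prob_card_uncovered_ge (hc : 0 < p.c) (hn : 0 < p.n) :
    p.prob {ω | p.numIntervals * (Real.exp (-p.l) + p.l / (p.numUsed : ℝ) ^ 2) +
      (p.n : ℝ) ^ (3 / 4 : ℝ) ≤ (uncovered ω).card} ≤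
      ENNReal.ofReal (Real.exp (-(√p.n / (24 * p.l ^ 2)))) := by
  have hn0 : (0 : ℝ) < p.n := by exact_mod_cast hn
  have hl : (1 : ℝ) ≤ p.l := by exact_mod_cast p.one_le_l
  set F : Finset (Coin p.n) := (finite_searchCoins (p := p) Finset.univ).toFinset with hF
  have hFn : F.card ≤ 3 * p.n := by
    have : F ⊆ Finset.univ.image Coin.participate ∪
        (Finset.univ.image Coin.interval ∪ Finset.univ.image Coin.bits) := by
      intro x hx
      rw [hF, Set.Finite.mem_toFinset] at hx
      obtain ⟨b, -, rfl | rfl | rfl⟩ := hx <;> simp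
    have h1 : ∀ f : Fin p.n → Coin p.n, (Finset.univ.image f).card ≤ p.n := fun f =>
      Finset.card_image_le.trans (by simp)
    refine (Finset.card_le_card this).trans ((Finset.card_union_le _ _).trans ?_)
    have := Finset.card_union_le ((Finset.univ : Finset (Fin p.n)).image Coin.interval)
      (Finset.univ.image Coin.bits)
    have := h1 Coin.participate
    have := h1 Coin.interval
    have := h1 Coin.bits
    omega
  -- Three coins per ball and differences of at most `2 * l`: the exponent is `n ^ (3 / 2) / (2 * 3
  -- * n * 4 * l ^ 2)`.
  have h1 := measure_ge_le_of_bounded_differences p.coinLaw (c := 2 * p.l)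
    (t := (p.n : ℝ) ^ (3 / 4 : ℝ)) (by positivity) (by positivity) (F := F) (N := 3 * p.n)
    (by positivity) (by exact_mod_cast hFn)
    (f := fun ω => ((uncovered ω).card : ℝ))
    (fun ω ω' hh => by
      simp only
      rw [dependsOn_uncovered fun x hx => hh x (by simpa [hF] using hx)])
    (fun x hx ω ω' => by
      rw [hF, Set.Finite.mem_toFinset] at hx
      obtain ⟨b, -, hx⟩ := hx
      have hxb : x ∈ searchCoins (p := p) {b} := ⟨b, by simpa using hx⟩
      have e1 : ∀ y, y ∉ searchCoins {b} → splice {x} ω ω' y = ω y := fun y hy =>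
        splice_of_notMem (fun h => hy (by rw [Set.mem_singleton_iff.1 h]; exact hxb)) _ _
      have h1 := (Nat.cast_le (α := ℝ)).2 (card_uncovered_le e1)
      have h2 := (Nat.cast_le (α := ℝ)).2 (card_uncovered_le fun y hy => (e1 y hy).symm)
      push_cast at h1 h2
      rw [abs_le]
      constructor <;> linarith)
  refine le_trans (measure_mono fun ω hω => ?_) (h1.trans (ENNReal.ofReal_le_ofReal ?_))
  · exact le_trans (add_le_add_left (integral_card_uncovered_le hc) _) hω
  · rw [Real.exp_le_exp, neg_le_neg_iff]
    have h3 : ((p.n : ℝ) ^ (3 / 4 : ℝ)) ^ 2 = p.n * √p.n := by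
      rw [Real.sqrt_eq_rpow, ← Real.rpow_natCast, ← Real.rpow_mul hn0.le, ← Real.rpow_one_add' hn0.le]
      all_goals norm_num
    rw [h3]
    apply le_of_eq
    field_simp
    norm_num

end Search

end Params

end BallsIntoBins

namespace BallsIntoBins

namespace Params

/-! ## Placing balls by coordinators -/

section Assign

variable {p : Params}

/-- The coins that determine the bins contacted in the third round. -/
def targetCoins (p : Params) : Set (Coin p.n) := {x | ∃ b, x = .target b}

lemma finite_targetCoins : (targetCoins p).Finite :=
  (Set.finite_range (Coin.target (n := p.n))).subset fun _ ⟨b, hb⟩ => ⟨b, hb.symm⟩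

lemma disjoint_searchCoins_targetCoins (E : Finset p.Ball) :
    Disjoint (searchCoins E) (targetCoins p) := by
  rw [Set.disjoint_left]
  rintro x ⟨b, -, rfl | rfl | rfl⟩ ⟨b', hb'⟩ <;> simp at hb'

lemma dependsOn_target (b : p.Ball) : DependsOn (fun ω => p.target ω b) {Coin.target b} :=
  fun ω ω' h => by simp only [target, h _ rfl]

lemma target_splice (ω ω' : p.Outcome) (b : p.Ball) :
    p.target (splice (targetCoins p) ω ω') b = p.target ω' b :=
  DependsOn.splice_eq (dependsOn_target b) (by rintro _ rfl; exact ⟨b, rfl⟩) ω ω'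

lemma block_splice (ω ω' : p.Outcome) (b : p.Ball) :
    p.block (splice (targetCoins p) ω ω') b = p.block ω b :=
  DependsOn.splice_eq_left (dependsOn_block b) (disjoint_searchCoins_targetCoins _) ω ω'

lemma dependsOn_target_mem (b : p.Ball) (B : Finset p.Bin) :
    DependsOn (fun ω => ω ∈ {ω | p.target ω b ∈ B}) {Coin.target b} := fun ω ω' h => by
  have := dependsOn_target b h
  simp only at this
  simp only [Set.mem_ofPred_eq, this]

lemma measurableSet_target_mem (b : p.Ball) (B : Finset p.Bin) :
    MeasurableSet {ω | p.target ω b ∈ B} :=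
  measurableSet_of_dependsOn p (Set.finite_singleton _) (dependsOn_target_mem b B)

lemma prob_target_eq_le (b : p.Ball) (v : p.Bin) :
    p.prob {ω | p.target ω b = v} ≤ ENNReal.ofReal (1 / p.numUsed) := by
  by_cases hv : (v : ℕ) < p.numUsed
  · refine le_trans (measure_mono fun ω hω => ?_)
      (p.prob_coin_eq (.target b) ⟨v, hv⟩).le
    have hω' : p.target ω b = v := hω
    subst hω'
    exact Fin.ext rfl
  · rw [show {ω | p.target ω b = v} = ∅ from ?_]
    · simp
    · ext ω
      simp only [Set.mem_ofPred_eq, Set.mem_empty_iff_false, iff_false]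
      rintro rfl
      exact hv (target_lt b)

lemma prob_target_mem_le (b : p.Ball) (B : Finset p.Bin) :
    p.prob {ω | p.target ω b ∈ B} ≤ ENNReal.ofReal (B.card / p.numUsed) := by
  calc _ ≤ p.prob (⋃ v ∈ B, {ω | p.target ω b = v}) := by
        refine measure_mono fun ω hω => Set.mem_biUnion (x := p.target ω b) hω rfl
    _ ≤ ∑ v ∈ B, ENNReal.ofReal (1 / p.numUsed) :=
        (measure_biUnion_finset_le _ _).trans (Finset.sum_le_sum fun v _ => prob_target_eq_le b v)
    _ = _ := by
        rw [Finset.sum_const, nsmul_eq_mul, ← ENNReal.ofReal_natCast,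
          ← ENNReal.ofReal_mul (by positivity)]
        congr 1
        ring

/-- The exponential moments of the number of balls among `s` that contact a bin of `B`. -/
lemma lintegral_pow_card_target_le (s : Finset p.Ball) (B : Finset p.Bin) {y : ℝ} (hy : 0 ≤ y) :
    ∫⁻ ω, ENNReal.ofReal (1 + y) ^ (s.filter fun b => p.target ω b ∈ B).card ∂p.prob ≤
      ENNReal.ofReal (Real.exp (y * (B.card / p.numUsed * s.card))) := by
  have := lintegral_pow_card_le p.coinLaw s (fun b => {Coin.target b})
    (fun b b' hb => Set.disjoint_singleton.2 fun h => hb (by simpa using h))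
    (fun b => {ω | p.target ω b ∈ B}) (fun b => dependsOn_target_mem b B)
    (fun b => measurableSet_target_mem b B) (q := B.card / p.numUsed) (by positivity) hy
    (fun b _ => prob_target_mem_le b B)
  convert this using 4
  · rfl
  · congr

lemma measurable_card_target (s : Finset p.Ball) (B : Finset p.Bin) :
    Measurable fun ω => (s.filter fun b => p.target ω b ∈ B).card :=
  DependsOn.measurable (S := targetCoins p) (fun ω ω' h => by
    have : ∀ b, p.target ω b = p.target ω' b := fun b =>
      (dependsOn_target b).mono (by rintro _ rfl; exact ⟨b, rfl⟩) h
    simp only [this]) finite_targetCoins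

/-- If `b` arrives at `B` and `B` overflows, at least `3 * |B|` of the other balls arrive as well.
This is independent of the target of `b` and has probability at most `2 ^ (-3 * |B|) * exp (1.012 *
|B|) ≤ (2.77 / 8) ^ |B|`. -/
lemma Large.prob_excess_le (h : p.Large) (b : p.Ball) (B : Finset p.Bin) :
    p.prob {ω | p.target ω b ∈ B ∧
      3 * B.card < (Finset.univ.filter fun b' => p.target ω b' ∈ B).card} ≤
      ENNReal.ofReal (B.card / p.numUsed * 0.4 ^ B.card) := by
  set N : p.Outcome → ℕ := fun ω => ((Finset.univ.erase b).filter fun b' => p.target ω b' ∈ B).card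
  have hsub : {ω | p.target ω b ∈ B ∧
      3 * B.card < (Finset.univ.filter fun b' => p.target ω b' ∈ B).card} ⊆
      {ω | p.target ω b ∈ B} ∩ {ω | ((3 * B.card : ℕ) : ℝ) ≤ N ω} := by
    intro ω hω
    obtain ⟨h1, h2⟩ : p.target ω b ∈ B ∧
      3 * B.card < (Finset.univ.filter fun b' => p.target ω b' ∈ B).card := hω
    refine ⟨h1, ?_⟩
    have h3 : N ω = (Finset.univ.filter fun b' => p.target ω b' ∈ B).card - 1 := by
      simp only [N]
      rw [Finset.filter_erase, Finset.card_erase_of_mem (by simpa using h1)]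
    show ((3 * B.card : ℕ) : ℝ) ≤ N ω
    rw [h3]
    exact_mod_cast Nat.le_sub_one_of_lt h2
  have dN : DependsOn (fun ω => ω ∈ {ω | ((3 * B.card : ℕ) : ℝ) ≤ N ω})
      {x | ∃ b', b' ≠ b ∧ x = Coin.target b'} := by
    intro ω ω' h
    have : N ω = N ω' := by
      simp only [N]
      congr 1
      refine Finset.filter_congr fun b' hb' => ?_
      have h1 : p.target ω b' = p.target ω' b' := dependsOn_target b' fun x hx =>
        h x ⟨b', Finset.ne_of_mem_erase hb', hx⟩
      rw [h1]
    simp only [Set.mem_ofPred_eq, this]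
  have mN : MeasurableSet {ω | ((3 * B.card : ℕ) : ℝ) ≤ N ω} :=
    measurableSet_of_dependsOn p (finite_targetCoins.subset
      (by rintro x ⟨b', -, hb'⟩; exact ⟨b', hb'⟩)) dN
  have h1 : p.prob ({ω | p.target ω b ∈ B} ∩ {ω | ((3 * B.card : ℕ) : ℝ) ≤ N ω}) =
      p.prob {ω | p.target ω b ∈ B} * p.prob {ω | ((3 * B.card : ℕ) : ℝ) ≤ N ω} := by
    refine measure_inter_of_dependsOn p.coinLaw ?_ (dependsOn_target_mem b B) dN
      (measurableSet_target_mem b B) mN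
    rw [Set.disjoint_singleton_left]
    rintro ⟨b', hb', hb''⟩
    exact hb' (by simpa using hb''.symm)
  have h2 := measure_card_ge_le_of_lintegral_pow p.prob N (measurable_card_target _ B)
    (z := 1 + 1) (t := (3 * B.card : ℕ)) (by norm_num)
    (lintegral_pow_card_target_le (Finset.univ.erase b) B zero_le_one)
  have hm := h.numUsed_ge
  refine (measure_mono hsub).trans ?_
  rw [h1, ENNReal.ofReal_mul (by positivity)]
  refine mul_le_mul' (prob_target_mem_le b B) (h2.trans (ENNReal.ofReal_le_ofReal ?_))
  have h3 : Real.exp (1 * (B.card / p.numUsed * (Finset.univ.erase b).card)) ≤ 2.77 ^ B.card := by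
    calc _ ≤ Real.exp (B.card * 1.012) := by
          rw [Real.exp_le_exp, one_mul, div_mul_eq_mul_div, mul_div_assoc]
          refine mul_le_mul_of_nonneg_left ?_ (by positivity)
          rw [div_le_iff₀ (by linarith)]
          have h4 : ((Finset.univ.erase b).card : ℝ) ≤ p.n := by
            exact_mod_cast (Finset.card_le_univ _).trans (by simp)
          linarith [h.n_le]
      _ = Real.exp 1.012 ^ B.card := by rw [Real.exp_nat_mul]
      _ ≤ _ := pow_le_pow_left₀ (Real.exp_nonneg _) exp_le_2_77 _
  have h4 : ((1 : ℝ) + 1) ^ (-((3 * B.card : ℕ) : ℝ)) = (1 / 8) ^ B.card := by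
    rw [Real.rpow_neg (by norm_num), Real.rpow_natCast, pow_mul, one_div, inv_pow]
    norm_num
  rw [h4]
  calc _ ≤ (1 / 8 : ℝ) ^ B.card * 2.77 ^ B.card := by gcongr
    _ = (1 / 8 * 2.77) ^ B.card := (mul_pow _ _ _).symm
    _ ≤ _ := by
      gcongr
      norm_num

variable {ρ : Rules p.n}

lemma biUnion_arrivals (ω : p.Outcome) (B : Finset p.Bin) :
    B.biUnion (p.arrivals ω) = Finset.univ.filter fun b => p.target ω b ∈ B := by
  ext b
  simp [arrivals]

/-- By `assign_maximal`, a coordinator with at most three arrivals per bin of its block assigns all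
of them. -/
lemma assigned_eq_none {ω : p.Outcome} {b : p.Ball} (h : p.assigned ρ ω b = none) :
    (∀ a, p.target ω b ∉ p.block ω a) ∨ ∃ a, p.target ω b ∈ p.block ω a ∧
      3 * (p.block ω a).card <
        (Finset.univ.filter fun b' => p.target ω b' ∈ p.block ω a).card := by
  by_contra! hh
  obtain ⟨⟨a, ha⟩, h2⟩ := hh
  have h3 := h2 a ha
  rw [assigned_of_mem_block ha] at h
  have h4 := ρ.assign_maximal (p.block ω a) (p.arrivals ω)
  rw [biUnion_arrivals, min_eq_left h3, ← biUnion_arrivals] at h4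
  have h5 := Finset.eq_of_subset_of_card_le (s := Finset.univ.filter fun b =>
    (ρ.assign (p.block ω a) (p.arrivals ω) b).isSome) (t := (p.block ω a).biUnion (p.arrivals ω))
    (fun b hb => by
      obtain ⟨w, hw⟩ := Option.isSome_iff_exists.1 (Finset.mem_filter.1 hb).2
      exact (ρ.assign_mem _ _ _ _ hw).1) h4.ge
  have h6 : b ∈ (p.block ω a).biUnion (p.arrivals ω) := by
    rw [biUnion_arrivals]
    simpa using ha
  rw [← h5, Finset.mem_filter, h] at h6
  simp at h6

/-- The number of balls placed by coordinators. -/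
lemma card_remaining_assigned (ω : p.Outcome) :
    (remaining (p.assigned ρ ω)).card +
      ∑ a, min (Finset.univ.filter fun b => p.target ω b ∈ p.block ω a).card
        (3 * (p.block ω a).card) = p.n := by
  have h1 : (Finset.univ.filter fun b => ¬ p.assigned ρ ω b = none) =
      Finset.univ.biUnion fun a => Finset.univ.filter fun b =>
        (ρ.assign (p.block ω a) (p.arrivals ω) b).isSome := by
    ext b
    simp only [Finset.mem_filter, Finset.mem_univ, true_and, Finset.mem_biUnion]
    constructor
    · intro hb
      obtain ⟨w, hw⟩ := Option.ne_none_iff_exists'.1 hb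
      obtain ⟨a, -, -, h3⟩ := assigned_eq_some hw
      exact ⟨a, by simp [h3]⟩
    · rintro ⟨a, ha⟩
      obtain ⟨w, hw⟩ := Option.isSome_iff_exists.1 ha
      have h2 := (ρ.assign_mem _ _ _ _ hw).1
      rw [biUnion_arrivals, Finset.mem_filter] at h2
      rw [assigned_of_mem_block h2.2, hw]
      simp
  have h2 : (Finset.univ.filter fun b => ¬ p.assigned ρ ω b = none).card =
      ∑ a, min (Finset.univ.filter fun b => p.target ω b ∈ p.block ω a).card
        (3 * (p.block ω a).card) := by
    rw [h1, Finset.card_biUnion]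
    · refine Finset.sum_congr rfl fun a _ => ?_
      rw [ρ.assign_maximal, biUnion_arrivals]
    · intro a _ a' _ haa
      refine Finset.disjoint_left.2 fun b hb hb' => haa ?_
      obtain ⟨w, hw⟩ := Option.isSome_iff_exists.1 (Finset.mem_filter.1 hb).2
      obtain ⟨w', hw'⟩ := Option.isSome_iff_exists.1 (Finset.mem_filter.1 hb').2
      have h2 := (ρ.assign_mem _ _ _ _ hw).1
      have h2' := (ρ.assign_mem _ _ _ _ hw').1
      rw [biUnion_arrivals, Finset.mem_filter] at h2 h2'
      exact eq_of_mem_block h2.2 h2'.2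
  rw [← h2, remaining, Finset.card_filter_add_card_filter_not]
  simp

lemma card_block_eq_zero_or (ω : p.Outcome) (a : p.Ball) :
    (p.block ω a).card = 0 ∨ p.l ≤ (p.block ω a).card := by
  rcases (p.block ω a).eq_empty_or_nonempty with h | h
  · left; simp [h]
  · right; exact l_le_card_block h

lemma dependsOn_assigned_splice (ω : p.Outcome) :
    DependsOn (fun ω' => p.assigned ρ (splice (targetCoins p) ω ω')) (targetCoins p) := by
  intro ω₁ ω₂ h
  have h1 : ∀ b, p.target ω₁ b = p.target ω₂ b := fun b =>
    (dependsOn_target b).mono (by rintro _ rfl; exact ⟨b, rfl⟩) h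
  have h2 : splice (targetCoins p) ω ω₁ = splice (targetCoins p) ω ω₂ := by
    funext x
    by_cases hx : x ∈ targetCoins p
    · rw [splice_of_mem hx, splice_of_mem hx, h x hx]
    · rw [splice_of_notMem hx, splice_of_notMem hx]
  simp only [h2]

/-- Given the outcome of the search for coordinators, a ball is assigned with high probability. -/
theorem Large.prob_assigned_splice_le (h : p.Large) (ω : p.Outcome) (b : p.Ball) :
    p.prob {ω' | p.assigned ρ (splice (targetCoins p) ω ω') b = none} ≤
      ENNReal.ofReal ((uncovered ω).card / p.numIntervals + 0.4 ^ p.l) := by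
  set V : Finset p.Bin := (uncovered ω ×ˢ Finset.univ).image fun z => p.binAt z.1 z.2
  have hV : V.card ≤ (uncovered ω).card * p.l :=
    Finset.card_image_le.trans (by simp [Finset.card_product])
  have hI : (0 : ℝ) < p.numIntervals := by exact_mod_cast p.numIntervals_pos
  have hl : (0 : ℝ) < p.l := by exact_mod_cast p.one_le_l
  have hm : (p.numUsed : ℝ) = p.numIntervals * p.l := by rw [numUsed]; push_cast; rfl
  -- With the search frozen, the blocks are fixed sets. An unassigned ball has its target either in
  -- an uncovered interval, whose bins form `V`, or in an overflowing block.
  have hsub : {ω' | p.assigned ρ (splice (targetCoins p) ω ω') b = none} ⊆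
      {ω' | p.target ω' b ∈ V} ∪ ⋃ a ∈ (Finset.univ : Finset p.Ball),
        {ω' | p.target ω' b ∈ p.block ω a ∧ 3 * (p.block ω a).card <
          (Finset.univ.filter fun b' => p.target ω' b' ∈ p.block ω a).card} := by
    intro ω' hω'
    have h1 := assigned_eq_none hω'
    simp only [target_splice, block_splice] at h1
    rcases h1 with h1 | ⟨a, ha⟩
    · left
      obtain ⟨i, s, his⟩ := exists_binAt (target_lt (ω := ω') b)
      refine Finset.mem_image.2 ⟨(i, s), ?_, his.symm⟩
      simp only [Finset.mem_product, Finset.mem_univ, and_true, uncovered, Finset.mem_filter,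
        true_and]
      intro hc
      obtain ⟨a, ha⟩ := exists_mem_block_of_covered hc s
      exact h1 a (his ▸ ha)
    · right
      exact Set.mem_biUnion (Finset.mem_coe.2 (Finset.mem_univ a)) ha
  have h3 : ∀ a, p.prob {ω' | p.target ω' b ∈ p.block ω a ∧ 3 * (p.block ω a).card <
      (Finset.univ.filter fun b' => p.target ω' b' ∈ p.block ω a).card} ≤
      ENNReal.ofReal ((p.block ω a).card / p.numUsed * 0.4 ^ p.l) := by
    intro a
    refine (h.prob_excess_le b _).trans (ENNReal.ofReal_le_ofReal ?_)
    rcases card_block_eq_zero_or ω a with h4 | h4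
    · simp [h4]
    · exact mul_le_mul_of_nonneg_left (pow_le_pow_of_le_one (by norm_num) (by norm_num) h4)
        (by positivity)
  refine (measure_mono hsub).trans ((measure_union_le _ _).trans ?_)
  rw [ENNReal.ofReal_add (by positivity) (by positivity)]
  refine add_le_add ((prob_target_mem_le b V).trans (ENNReal.ofReal_le_ofReal ?_))
    ((measure_biUnion_finset_le _ _).trans ((Finset.sum_le_sum fun a _ => h3 a).trans ?_))
  · rw [hm, div_le_div_iff₀ (by positivity) hI]
    have : (V.card : ℝ) ≤ (uncovered ω).card * p.l := by exact_mod_cast hV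
    nlinarith
  -- The blocks are disjoint, so the chances `|B| / m` of hitting them add up to at most one, and
  -- the union bound costs nothing.
  · rw [← ENNReal.ofReal_sum_of_nonneg fun a _ => by positivity, ← Finset.sum_mul,
      ← Finset.sum_div]
    refine ENNReal.ofReal_le_ofReal ?_
    have h4 : (∑ a, ((p.block ω a).card : ℝ)) / p.numUsed ≤ 1 := by
      rw [div_le_one (by rw [hm]; positivity)]
      exact_mod_cast sum_card_block_le
    calc _ ≤ 1 * (0.4 : ℝ) ^ p.l := by gcongr
      _ = _ := one_mul _

/-- By `card_remaining_assigned` this sum counts the assigned balls, independently of the rule. A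
rule may thus react arbitrarily to a moved target without spoiling bounded differences. Only the
block hit under `ω₁` can gain, by disjointness there is at most one, and it gains at most one
arrival. -/
lemma sum_min_target_le {ω : p.Outcome} {ω₁ ω₂ : p.Outcome} {b₀ : p.Ball}
    (h : ∀ x, x ≠ Coin.target b₀ → ω₁ x = ω₂ x) :
    ∑ a, min (Finset.univ.filter fun b => p.target ω₁ b ∈ p.block ω a).card
        (3 * (p.block ω a).card) ≤
      ∑ a, min (Finset.univ.filter fun b => p.target ω₂ b ∈ p.block ω a).card
        (3 * (p.block ω a).card) + 1 := by
  have h1 : ∀ a, min (Finset.univ.filter fun b => p.target ω₁ b ∈ p.block ω a).card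
        (3 * (p.block ω a).card) ≤
      min (Finset.univ.filter fun b => p.target ω₂ b ∈ p.block ω a).card
        (3 * (p.block ω a).card) + if p.target ω₁ b₀ ∈ p.block ω a then 1 else 0 := by
    intro a
    have h2 : (Finset.univ.filter fun b => p.target ω₁ b ∈ p.block ω a).card ≤
        (Finset.univ.filter fun b => p.target ω₂ b ∈ p.block ω a).card +
          if p.target ω₁ b₀ ∈ p.block ω a then 1 else 0 := by
      refine (card_filter_le_add (Q := fun b => p.target ω₂ b ∈ p.block ω a) _
        (if p.target ω₁ b₀ ∈ p.block ω a then {b₀} else ∅) ?_).trans ?_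
      · intro b _ h3 h4
        by_cases hb : b = b₀
        · subst hb
          simp [h3]
        · have : p.target ω₁ b = p.target ω₂ b := dependsOn_target b fun x hx => h x (by
            rw [Set.mem_singleton_iff.1 hx]
            simpa using hb)
          rw [this] at h3
          exact absurd h3 h4
      · split_ifs <;> simp
    omega
  refine (Finset.sum_le_sum fun a _ => h1 a).trans ?_
  rw [Finset.sum_add_distrib, Finset.sum_boole]
  exact Nat.add_le_add_left (card_filter_mem_block_le_one _) _

/-- Given the outcome of the search for coordinators, the number of balls that are not assigned is
concentrated. -/
theorem Large.prob_card_remaining_splice_ge (h : p.Large) (ω : p.Outcome) :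
    p.prob {ω' | p.n * ((uncovered ω).card / p.numIntervals + 0.4 ^ p.l) + (p.n : ℝ) ^ (3 / 4 : ℝ) ≤
      (remaining (p.assigned ρ (splice (targetCoins p) ω ω'))).card} ≤
      ENNReal.ofReal (Real.exp (-(√p.n / 2))) := by
  have hn0 : (0 : ℝ) < p.n := by linarith [h.thousand_le]
  set F : Finset (Coin p.n) := finite_targetCoins.toFinset with hF
  have hFn : F.card ≤ p.n := by
    have : F ⊆ Finset.univ.image Coin.target := by
      intro x hx
      rw [hF, Set.Finite.mem_toFinset] at hx
      obtain ⟨b, rfl⟩ := hx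
      simp
    exact (Finset.card_le_card this).trans (Finset.card_image_le.trans (by simp))
  have dA := dependsOn_assigned_splice (ρ := ρ) ω
  have key : ∀ {b₀} {ω₁ ω₂ : p.Outcome}, (∀ x, x ≠ Coin.target b₀ → ω₁ x = ω₂ x) →
      (remaining (p.assigned ρ (splice (targetCoins p) ω ω₁))).card ≤
      (remaining (p.assigned ρ (splice (targetCoins p) ω ω₂))).card + 1 := by
    intro b₀ ω₁ ω₂ hh
    have h1 := card_remaining_assigned (ρ := ρ) (splice (targetCoins p) ω ω₁)
    have h2 := card_remaining_assigned (ρ := ρ) (splice (targetCoins p) ω ω₂)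
    simp only [target_splice, block_splice] at h1 h2
    have h3 := sum_min_target_le (ω := ω) fun x hx => (hh x hx).symm
    omega
  have mA : ∀ b, MeasurableSet {ω' | p.assigned ρ (splice (targetCoins p) ω ω') b = none} := fun b =>
    measurableSet_of_dependsOn p finite_targetCoins fun ω₁ ω₂ hh => by
      have := dA hh
      simp only at this
      simp only [Set.mem_ofPred_eq, this]
  have h1 := measure_ge_le_of_bounded_differences p.coinLaw (c := 1) (t := (p.n : ℝ) ^ (3 / 4 : ℝ))
    (by positivity) one_pos (F := F) (N := p.n) hn0 (by exact_mod_cast hFn)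
    (f := fun ω' => ((remaining (p.assigned ρ (splice (targetCoins p) ω ω'))).card : ℝ))
    (fun ω₁ ω₂ hh => by
      have := dA fun x hx => hh x (by simpa [hF] using hx)
      simp only at this
      simp only [this])
    (fun x hx ω₁ ω₂ => by
      rw [hF, Set.Finite.mem_toFinset] at hx
      obtain ⟨b, rfl⟩ := hx
      have e1 : ∀ y, y ≠ Coin.target b → splice {Coin.target b} ω₁ ω₂ y = ω₁ y := fun y hy =>
        splice_of_notMem (by simpa) _ _
      have h1 := (Nat.cast_le (α := ℝ)).2 (key e1)
      have h2 := (Nat.cast_le (α := ℝ)).2 (key fun y hy => (e1 y hy).symm)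
      push_cast at h1 h2
      rw [abs_le]
      constructor <;> linarith)
  have h2 : ∫ ω', ((remaining (p.assigned ρ (splice (targetCoins p) ω ω'))).card : ℝ) ∂p.prob ≤
      p.n * ((uncovered ω).card / p.numIntervals + 0.4 ^ p.l) := by
    have h3 : ∀ ω', ((remaining (p.assigned ρ (splice (targetCoins p) ω ω'))).card : ℝ) =
        ∑ b, {ω' | p.assigned ρ (splice (targetCoins p) ω ω') b = none}.indicator
          (1 : p.Outcome → ℝ) ω' := by
      intro ω'
      simp [Set.indicator_apply, remaining]
    simp only [h3]
    rw [integral_finsetSum]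
    · simp only [integral_indicator_one (mA _)]
      calc _ ≤ ∑ b : p.Ball, ((uncovered ω).card / p.numIntervals + 0.4 ^ p.l : ℝ) := by
            refine Finset.sum_le_sum fun b _ => ?_
            exact ENNReal.toReal_le_of_le_ofReal (by positivity) (h.prob_assigned_splice_le ω b)
        _ = _ := by rw [Finset.sum_const, Finset.card_univ, Fintype.card_fin, nsmul_eq_mul]
    · intro b _
      exact (integrable_const 1).indicator (mA b)
  refine le_trans (measure_mono fun ω' hω' => ?_) (h1.trans (ENNReal.ofReal_le_ofReal ?_))
  · exact le_trans (add_le_add_left h2 _) hω'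
  · rw [Real.exp_le_exp, neg_le_neg_iff]
    have h3 : ((p.n : ℝ) ^ (3 / 4 : ℝ)) ^ 2 = p.n * √p.n := by
      rw [Real.sqrt_eq_rpow, ← Real.rpow_natCast, ← Real.rpow_mul hn0.le, ← Real.rpow_one_add' hn0.le]
      all_goals norm_num
    rw [h3]
    apply le_of_eq
    field_simp

lemma dependsOn_assigned :
    DependsOn (fun ω => p.assigned ρ ω) (searchCoins Finset.univ ∪ targetCoins p) := by
  intro ω ω' h
  have h1 : ∀ b, p.target ω b = p.target ω' b := fun b =>
    (dependsOn_target b).mono (by rintro _ rfl; exact Or.inr ⟨b, rfl⟩) h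
  have h2 : ∀ b, p.block ω b = p.block ω' b := fun b =>
    (dependsOn_block b).mono Set.subset_union_left h
  have h3 : p.arrivals ω = p.arrivals ω' := by
    funext v
    simp only [arrivals, h1]
  funext b
  show p.assigned ρ ω b = p.assigned ρ ω' b
  by_cases hb : ∃ a, p.target ω b ∈ p.block ω a
  · obtain ⟨a, ha⟩ := hb
    rw [assigned_of_mem_block ha, assigned_of_mem_block (a := a) (by rw [← h1, ← h2]; exact ha),
      h2, h3]
  · have hb' := hb
    simp only [h1, h2] at hb'
    simp only [assigned, dif_neg hb, dif_neg hb']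

lemma exp_neg_l_le : Real.exp (-p.l) ≤ 0.4 ^ p.l := by
  have h1 : Real.exp (-1) ≤ 0.4 := by
    rw [Real.exp_neg, inv_le_comm₀ (Real.exp_pos 1) (by norm_num)]
    have := Real.exp_one_gt_d9
    norm_num
    linarith
  calc Real.exp (-p.l) = Real.exp (-1) ^ p.l := by rw [← Real.exp_nat_mul]; ring_nf
    _ ≤ _ := pow_le_pow_left₀ (Real.exp_nonneg _) h1 _

/-- The probability that a given ball is not assigned. -/
theorem Large.prob_assigned_eq_none_le (h : p.Large) (hc : 0 < p.c) (b : p.Ball) :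
    p.prob {ω | p.assigned ρ ω b = none} ≤
      ENNReal.ofReal (2 * 0.4 ^ p.l + p.l / (p.numUsed : ℝ) ^ 2) := by
  have hI : (0 : ℝ) < p.numIntervals := by exact_mod_cast p.numIntervals_pos
  have mA : MeasurableSet {ω | p.assigned ρ ω b = none} :=
    measurableSet_of_dependsOn p ((finite_searchCoins _).union finite_targetCoins) fun ω ω' hh => by
      have := dependsOn_assigned (ρ := ρ) hh
      simp only at this
      simp only [Set.mem_ofPred_eq, this]
  have mU : Measurable fun ω : p.Outcome => (uncovered ω).card :=
    (DependsOn.measurable (β := ℕ) (fun ω ω' hh => by simp only [dependsOn_uncovered hh])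
      (finite_searchCoins Finset.univ))
  refine (measure_le_of_splice p.coinLaw (targetCoins p) mA
    fun ω => h.prob_assigned_splice_le ω b).trans ?_
  change ∫⁻ ω, _ ∂p.prob ≤ _
  have hB : ∀ ω : p.Outcome, (uncovered ω).card ≤ p.numIntervals := fun ω =>
    (Finset.card_le_univ _).trans (by simp)
  have hint : Integrable (fun ω : p.Outcome => ((uncovered ω).card : ℝ)) p.prob := by
    refine Integrable.of_bound (C := p.numIntervals)
      ((measurable_of_countable (Nat.cast : ℕ → ℝ)).comp mU).aestronglyMeasurable
      (Filter.Eventually.of_forall fun ω => ?_)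
    simpa using hB ω
  rw [← ofReal_integral_eq_lintegral_ofReal
    (f := fun ω : p.Outcome => ((uncovered ω).card : ℝ) / p.numIntervals + 0.4 ^ p.l)
    ((hint.div_const _).add (integrable_const _))
    (Filter.Eventually.of_forall fun ω => by positivity)]
  refine ENNReal.ofReal_le_ofReal ?_
  rw [integral_add (hint.div_const _) (integrable_const _), integral_div]
  simp only [integral_const, probReal_univ, one_smul]
  have h1 := integral_card_uncovered_le (p := p) hc
  have h2 : (∫ ω, ((uncovered ω).card : ℝ) ∂p.prob) / p.numIntervals ≤
      Real.exp (-p.l) + p.l / (p.numUsed : ℝ) ^ 2 := by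
    rw [div_le_iff₀ hI, mul_comm]
    exact h1
  linarith [exp_neg_l_le (p := p)]

/-- The number of balls that are not assigned is concentrated. -/
theorem Large.prob_card_remaining_assigned_ge (h : p.Large) (hc : 0 < p.c) :
    p.prob {ω | 2 * p.n * 0.4 ^ p.l + 4 * p.l * (p.n : ℝ) ^ (3 / 4 : ℝ) ≤
      (remaining (p.assigned ρ ω)).card} ≤
      ENNReal.ofReal (Real.exp (-(√p.n / (24 * p.l ^ 2)))) +
        ENNReal.ofReal (Real.exp (-(√p.n / 2))) := by
  have hn := h.thousand_le
  have hn' := h.n_le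
  have hm0 := h.numUsed_ge
  have hI : (0 : ℝ) < p.numIntervals := by exact_mod_cast p.numIntervals_pos
  have hl : (1 : ℝ) ≤ p.l := by exact_mod_cast p.one_le_l
  have hm : (p.numUsed : ℝ) = p.numIntervals * p.l := by rw [numUsed]; push_cast; rfl
  set U : Set p.Outcome := {ω | p.numIntervals * (Real.exp (-p.l) + p.l / (p.numUsed : ℝ) ^ 2) +
      (p.n : ℝ) ^ (3 / 4 : ℝ) ≤ (uncovered ω).card} with hU
  have mU : MeasurableSet U := measurableSet_of_dependsOn p (finite_searchCoins Finset.univ)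
    fun ω ω' hh => by simp only [hU, Set.mem_ofPred_eq, dependsOn_uncovered hh]
  have mA : MeasurableSet {ω | 2 * p.n * 0.4 ^ p.l + 4 * p.l * (p.n : ℝ) ^ (3 / 4 : ℝ) ≤
      (remaining (p.assigned ρ ω)).card} :=
    measurableSet_of_dependsOn p ((finite_searchCoins _).union finite_targetCoins) fun ω ω' hh => by
      have := dependsOn_assigned (ρ := ρ) hh
      simp only at this
      simp only [Set.mem_ofPred_eq, this]
  have hx : 1 ≤ (p.n : ℝ) ^ (3 / 4 : ℝ) := Real.one_le_rpow (by linarith) (by norm_num)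
  set x := (p.n : ℝ) ^ (3 / 4 : ℝ)
  -- Outside `U` the search left few intervals uncovered, and concentration in the targets applies.
  -- The deviation of the uncovered count costs `n * x / numIntervals ≤ 1.01 * l * x`, which fits
  -- into `4 * l * x`.
  refine (measure_le_of_splice p.coinLaw (targetCoins p) mA
    (g := fun ω => U.indicator 1 ω + ENNReal.ofReal (Real.exp (-(√p.n / 2)))) fun ω => ?_).trans ?_
  · by_cases hω : ω ∈ U
    · calc _ ≤ (1 : ℝ≥0∞) := prob_le_one
        _ ≤ _ := by simp [hω]
    · simp only [hω, not_false_eq_true, Set.indicator_of_notMem, zero_add]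
      refine (measure_mono fun ω' hω' => ?_).trans (h.prob_card_remaining_splice_ge (ρ := ρ) ω)
      refine le_trans ?_ (show 2 * p.n * 0.4 ^ p.l + 4 * p.l * x ≤
        ((remaining (p.assigned ρ (splice (targetCoins p) ω ω'))).card : ℝ) from hω')
      have h1 : ((uncovered ω).card : ℝ) ≤
          p.numIntervals * (Real.exp (-p.l) + p.l / (p.numUsed : ℝ) ^ 2) + x :=
        (not_le.1 hω).le
      have h2 : ((uncovered ω).card : ℝ) / p.numIntervals ≤
          Real.exp (-p.l) + p.l / (p.numUsed : ℝ) ^ 2 + x / p.numIntervals := by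
        rw [div_le_iff₀ hI]
        refine h1.trans (le_of_eq ?_)
        field_simp
      have h3 : (p.n : ℝ) * (x / p.numIntervals) ≤ 1.01 * p.l * x := by
        rw [← mul_div_assoc, div_le_iff₀ hI]
        have : (p.n : ℝ) ≤ 1.01 * (p.numIntervals * p.l) := by rw [← hm]; exact hn'
        nlinarith
      have h4 : (p.n : ℝ) * (p.l / (p.numUsed : ℝ) ^ 2) ≤ p.l := by
        rw [← mul_div_assoc, div_le_iff₀ (by positivity), mul_comm]
        refine mul_le_mul_of_nonneg_left ?_ (by linarith)
        nlinarith
      have h5 := exp_neg_l_le (p := p)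
      calc _ ≤ (p.n : ℝ) * ((0.4 ^ p.l + p.l / (p.numUsed : ℝ) ^ 2 + x / p.numIntervals) + 0.4 ^ p.l) + x := by
            have : ((uncovered ω).card : ℝ) / p.numIntervals ≤
              0.4 ^ p.l + p.l / (p.numUsed : ℝ) ^ 2 + x / p.numIntervals := by linarith
            gcongr
        _ ≤ _ := by nlinarith
  · change ∫⁻ ω, _ ∂p.prob ≤ _
    rw [lintegral_add_right _ measurable_const, lintegral_indicator_one mU]
    simp only [lintegral_const, measure_univ, mul_one]
    have : 0 < p.n := by
      have : (0 : ℝ) < p.n := by linarith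
      exact_mod_cast this
    exact add_le_add_left (prob_card_uncovered_ge hc this) _

end Assign

end Params

end BallsIntoBins

namespace BallsIntoBins

namespace Params

/-! ## Messages in the first seven rounds -/

section FirstRounds

variable {p : Params}

lemma measurable_part (b : p.Ball) : Measurable fun ω : p.Outcome => part ω b :=
  DependsOn.measurable (S := {Coin.participate b})
    (fun ω ω' h => by simp only [part, h _ rfl]) (Set.finite_singleton _)

lemma lintegral_part (b : p.Ball) :
    ∫⁻ ω, (part ω b : ℝ≥0∞) ∂p.prob = ENNReal.ofReal (1 / p.l) := by
  have mE : MeasurableSet {ω : p.Outcome | (ω (.participate b)).val = 0} :=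
    measurableSet_of_dependsOn p (Set.finite_singleton (Coin.participate b)) fun ω ω' h => by
      simp only [Set.mem_ofPred_eq, h _ rfl]
  rw [← prob_participate b, ← lintegral_indicator_one mE]
  refine lintegral_congr fun ω => ?_
  simp [part, Set.indicator_apply]

/-- Exponential moments of the number of balls that participate. -/
lemma lintegral_pow_sum_part_le {y : ℝ} (hy : 0 ≤ y) :
    ∫⁻ ω, ENNReal.ofReal (1 + y) ^ (∑ b : p.Ball, part ω b) ∂p.prob ≤
      ENNReal.ofReal (Real.exp (y * (1 / p.l * p.n))) := by
  have dE : ∀ b : p.Ball, DependsOn (fun ω : p.Outcome =>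
      ω ∈ {ω : p.Outcome | (ω (.participate b)).val = 0}) {Coin.participate b} :=
    fun b ω ω' h => by simp only [Set.mem_ofPred_eq, h _ rfl]
  have := lintegral_pow_card_le p.coinLaw (Finset.univ : Finset p.Ball)
    (fun b => {Coin.participate b})
    (fun b b' hb => Set.disjoint_singleton.2 fun h => hb (by simpa using h))
    (fun b => {ω | (ω (.participate b)).val = 0}) dE
    (fun b => measurableSet_of_dependsOn p (Set.finite_singleton _) (dE b)) (q := 1 / p.l)
    (by positivity) hy (fun b _ => (prob_participate b).le)
  rw [Finset.card_univ, Fintype.card_fin] at this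
  convert this using 4
  · rfl
  · simp only [part, Finset.card_filter, Set.mem_ofPred_eq]

/-- The intervals after interval `j` up to distance `s`. -/
noncomputable def after (j : Fin p.numIntervals) (s : ℕ) : Finset (Fin p.numIntervals) :=
  (Finset.Icc 1 s).image (p.shift j)

lemma card_after (j : Fin p.numIntervals) {s : ℕ} (hs : s < p.l) : (after j s).card = s := by
  rw [after, Finset.card_image_of_injOn, Nat.card_Icc, Nat.add_sub_cancel]
  intro t ht t' ht' h
  rw [Finset.mem_coe, Finset.mem_Icc] at ht ht'
  exact shift_right_injOn j (by omega) (by omega) h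

/-- Coordinating at distance `s` means that no other ball was acknowledged in the `s` intervals in
between. Leaving `b` out makes `Quiet` independent of the contact by `b`, so the two probabilities
multiply. -/
lemma quiet_of_coordinates {ω : p.Outcome} {b : p.Ball} {i : Fin p.numIntervals}
    (h : p.Coordinates ω b i) : ∃ j s, s < p.l ∧ i = p.shift j s ∧ p.Contacts ω b j ∧
      Quiet (Finset.univ.erase b) (after j s) ω := by
  obtain ⟨j, s, h1, h2, h3, h4⟩ := h
  refine ⟨j, s, h2, h3, h1.1, ?_⟩
  by_contra hq
  simp only [Quiet, not_or, not_forall, not_not] at hq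
  obtain ⟨⟨b', hb', j', hj', hc⟩, hcol⟩ := hq
  obtain ⟨t, ht, rfl⟩ := Finset.mem_image.1 hj'
  rw [Finset.mem_Icc] at ht
  have h5 : ∀ a, p.Contacts ω a (p.shift j t) → a ≠ b := by
    rintro a ha rfl
    have h6 := h1.1.eq_interval ha
    have h7 := shift_right_injOn j (s := 0) (t := t) p.one_le_l (by omega) (by
      rw [shift_zero]; exact h6)
    omega
  obtain ⟨a, ha⟩ := exists_acknowledged hj' (fun a ha => Finset.mem_erase.2 ⟨h5 a ha,
    Finset.mem_univ _⟩) ⟨b', hc⟩ hcol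
  exact h4 t ht.1 ht.2 a (h5 a ha.1) ha

lemma card_block_le (ω : p.Outcome) (b : p.Ball) :
    ((p.block ω b).card : ℝ≥0∞) ≤ ∑ j : Fin p.numIntervals, ∑ s ∈ Finset.range p.l,
      (p.l : ℝ≥0∞) * ({ω | p.Contacts ω b j} ∩
        {ω | Quiet (Finset.univ.erase b) (after j s) ω}).indicator 1 ω := by
  set T := (Finset.univ ×ˢ Finset.range p.l).filter fun z : Fin p.numIntervals × ℕ =>
    p.Contacts ω b z.1 ∧ Quiet (Finset.univ.erase b) (after z.1 z.2) ω
  have h1 : (p.block ω b).card ≤ T.card * p.l := by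
    calc _ ≤ (T.biUnion fun z => Finset.univ.filter fun v : p.Bin =>
          ∃ s, v = p.binAt (p.shift z.1 z.2) s).card := by
          refine Finset.card_le_card fun v hv => ?_
          obtain ⟨i, s₀, hv, hc⟩ := mem_block.1 hv
          obtain ⟨j, s, h1, rfl, h2, h3⟩ := quiet_of_coordinates hc
          simp only [Finset.mem_biUnion, T, Finset.mem_filter, Finset.mem_product,
            Finset.mem_univ, Finset.mem_range, true_and]
          exact ⟨(j, s), ⟨h1, h2, h3⟩, s₀, hv⟩
      _ ≤ ∑ z ∈ T, p.l := Finset.card_biUnion_le.trans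
          (Finset.sum_le_sum fun z _ => (card_interval _).le)
      _ = _ := by simp
  calc ((p.block ω b).card : ℝ≥0∞) ≤ ((T.card * p.l : ℕ) : ℝ≥0∞) := by exact_mod_cast h1
    _ = _ := by
      rw [← Finset.sum_product', ← Finset.mul_sum, mul_comm T.card, Nat.cast_mul, Finset.card_filter]
      push_cast
      congr 1
      refine Finset.sum_congr rfl fun z _ => ?_
      simp only [Set.indicator_apply, Set.mem_inter_iff, Set.mem_ofPred_eq, Pi.one_apply]

/-- Since `exp (1 / 2) ≥ 3 / 2`, a geometric series of ratio `2 / 3` dominates. -/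
lemma sum_exp_neg_le {l : ℕ} {x : ℝ} (hx : 1 / 2 ≤ x) :
    ∑ s ∈ Finset.range l, Real.exp (-(x * s)) ≤ 3 := by
  have h1 : Real.exp (-(1 / 2)) ≤ 2 / 3 := by
    rw [Real.exp_neg, inv_le_comm₀ (Real.exp_pos _) (by norm_num)]
    have := Real.add_one_le_exp (1 / 2)
    norm_num at this ⊢
    linarith
  have h2 : ∀ s ∈ Finset.range l, Real.exp (-(x * s)) ≤ (2 / 3) ^ s := by
    intro s _
    calc _ ≤ Real.exp (s * (-(1 / 2))) := by
          rw [Real.exp_le_exp]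
          have : (0 : ℝ) ≤ s := by positivity
          nlinarith
      _ = Real.exp (-(1 / 2)) ^ s := Real.exp_nat_mul _ _
      _ ≤ _ := pow_le_pow_left₀ (Real.exp_nonneg _) h1 _
  refine (Finset.sum_le_sum h2).trans ?_
  have h3 := (hasSum_geometric_of_lt_one (r := (2 / 3 : ℝ)) (by norm_num) (by norm_num))
  refine (sum_le_hasSum _ (fun _ _ => by positivity) h3).trans (by norm_num)

/-- A ball coordinates few bins in expectation. -/
theorem lintegral_card_block_le (hc : 0 < p.c) (hn : 2 ≤ p.n) (b : p.Ball) :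
    ∫⁻ ω, ((p.block ω b).card : ℝ≥0∞) ∂p.prob ≤ 4 := by
  have hI : (0 : ℝ) < p.numIntervals := by exact_mod_cast p.numIntervals_pos
  have hl : (1 : ℝ) ≤ p.l := by exact_mod_cast p.one_le_l
  have hm : (p.numUsed : ℝ) = p.numIntervals * p.l := by rw [numUsed]; push_cast; rfl
  have hm0 : (1 : ℝ) ≤ p.numUsed := by exact_mod_cast p.numUsed_pos
  have hn' : (2 : ℝ) ≤ p.n := by exact_mod_cast hn
  have hmn : (p.numUsed : ℝ) ≤ p.n := by exact_mod_cast p.numUsed_le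
  have mE : ∀ (j : Fin p.numIntervals) s, MeasurableSet ({ω | p.Contacts ω b j} ∩
        {ω | Quiet (Finset.univ.erase b) (after j s) ω}) := fun j s =>
    (measurableSet_contacts b j).inter (measurableSet_quiet _ _)
  -- The contact has probability `1 / m = 1 / (numIntervals * l)`. The size `l` of an interval
  -- cancels one factor here, and the sum over `j` cancels the other.
  have h1 : ∀ j : Fin p.numIntervals, ∀ s ∈ Finset.range p.l,
      ∫⁻ ω, (p.l : ℝ≥0∞) * ({ω | p.Contacts ω b j} ∩
        {ω | Quiet (Finset.univ.erase b) (after j s) ω}).indicator 1 ω ∂p.prob ≤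
      ENNReal.ofReal (1 / p.numIntervals *
        (Real.exp (-((p.n - 1) / p.numUsed * s)) + p.l / (p.numUsed : ℝ) ^ 2)) := by
    intro j s hs
    rw [Finset.mem_range] at hs
    rw [lintegral_const_mul _ (measurable_one.indicator (mE j s)), lintegral_indicator_one (mE j s)]
    have h2 : p.prob ({ω | p.Contacts ω b j} ∩
        {ω | Quiet (Finset.univ.erase b) (after j s) ω}) = p.prob {ω | p.Contacts ω b j} *
          p.prob {ω | Quiet (Finset.univ.erase b) (after j s) ω} := by
      refine measure_inter_of_dependsOn p.coinLaw ?_ (dependsOn_contacts b j)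
        (dependsOn_quiet _ _) (measurableSet_contacts b j) (measurableSet_quiet _ _)
      rw [Set.disjoint_left]
      rintro x (rfl | rfl) ⟨b', hb', h | h | h⟩ <;>
        simp only [reduceCtorEq, Coin.participate.injEq, Coin.interval.injEq] at h <;>
        exact Finset.ne_of_mem_erase hb' h.symm
    rw [h2, prob_contacts]
    calc _ ≤ (p.l : ℝ≥0∞) * (ENNReal.ofReal (1 / p.numUsed) * ENNReal.ofReal
        (Real.exp (-((p.n - 1) / p.numUsed * s)) + p.l / (p.numUsed : ℝ) ^ 2)) := by
          gcongr
          refine (prob_quiet_le hc _ _).trans (ENNReal.ofReal_le_ofReal ?_)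
          rw [card_after j hs, Finset.card_erase_of_mem (Finset.mem_univ _), Finset.card_univ,
            Fintype.card_fin, Nat.cast_sub (by omega)]
          push_cast
          refine add_le_add (le_of_eq ?_) ?_
          · congr 1; ring
          · gcongr
      _ = _ := by
          rw [← ENNReal.ofReal_natCast, ← ENNReal.ofReal_mul (by positivity),
            ← ENNReal.ofReal_mul (by positivity), hm]
          congr 1
          field_simp
  calc _ ≤ ∫⁻ ω, ∑ j : Fin p.numIntervals, ∑ s ∈ Finset.range p.l,
      (p.l : ℝ≥0∞) * ({ω | p.Contacts ω b j} ∩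
        {ω | Quiet (Finset.univ.erase b) (after j s) ω}).indicator 1 ω ∂p.prob :=
        lintegral_mono fun ω => card_block_le ω b
    _ = ∑ j : Fin p.numIntervals, ∑ s ∈ Finset.range p.l,
        ∫⁻ ω, (p.l : ℝ≥0∞) * ({ω | p.Contacts ω b j} ∩
        {ω | Quiet (Finset.univ.erase b) (after j s) ω}).indicator 1 ω ∂p.prob := by
        have hme : ∀ (j : Fin p.numIntervals) s, Measurable fun ω => (p.l : ℝ≥0∞) *
            ({ω | p.Contacts ω b j} ∩
              {ω | Quiet (Finset.univ.erase b) (after j s) ω}).indicator 1 ω := fun j s =>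
          (measurable_one.indicator (mE j s)).const_mul _
        rw [lintegral_finsetSum _ fun j _ => Finset.measurable_fun_sum _ fun s _ => hme j s]
        refine Finset.sum_congr rfl fun j _ => ?_
        rw [lintegral_finsetSum _ fun s _ => hme j s]
    _ ≤ ∑ j : Fin p.numIntervals, ∑ s ∈ Finset.range p.l, ENNReal.ofReal (1 / p.numIntervals *
        (Real.exp (-((p.n - 1) / p.numUsed * s)) + p.l / (p.numUsed : ℝ) ^ 2)) :=
        Finset.sum_le_sum fun j _ => Finset.sum_le_sum fun s hs => h1 j s hs
    _ = ENNReal.ofReal (∑ s ∈ Finset.range p.l,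
        (Real.exp (-((p.n - 1) / p.numUsed * s)) + p.l / (p.numUsed : ℝ) ^ 2)) := by
        rw [Finset.sum_const, Finset.card_univ, Fintype.card_fin,
          ← ENNReal.ofReal_sum_of_nonneg fun s _ => by positivity, nsmul_eq_mul,
          ← ENNReal.ofReal_natCast, ← ENNReal.ofReal_mul (by positivity), ← Finset.mul_sum]
        congr 1
        field_simp
    _ ≤ ENNReal.ofReal 4 := by
        refine ENNReal.ofReal_le_ofReal ?_
        rw [Finset.sum_add_distrib, Finset.sum_const, Finset.card_range, nsmul_eq_mul]
        have h3 : ∑ s ∈ Finset.range p.l, Real.exp (-((p.n - 1) / p.numUsed * s)) ≤ 3 := by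
          refine sum_exp_neg_le ?_
          rw [le_div_iff₀ (by linarith)]
          linarith
        have h4 : (p.l : ℝ) * (p.l / (p.numUsed : ℝ) ^ 2) ≤ 1 := by
          have h5 : (p.l : ℝ) ^ 2 ≤ p.numUsed := by exact_mod_cast p.sq_le_numUsed
          rw [← mul_div_assoc, div_le_one (by positivity)]
          nlinarith
        linarith
    _ = 4 := by simp

/-! ### Messages received by bins -/

/-- The set `J` consists of the interval of `v` and is empty if `v` is an ignored bin, so both cases
are treated alike. -/
lemma contactsAt_eq {v : p.Bin} : ∃ J : Finset (Fin p.numIntervals), J.card ≤ 1 ∧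
    ∀ ω, contactsAt ω v = Finset.univ.filter fun b => ∃ j ∈ J, p.Contacts ω b j := by
  refine ⟨Finset.univ.filter fun j => ∃ s, v = p.binAt j s, ?_, fun ω => ?_⟩
  · rw [Finset.card_le_one]
    intro j hj j' hj'
    obtain ⟨s, hs⟩ := (Finset.mem_filter.1 hj).2
    obtain ⟨s', hs'⟩ := (Finset.mem_filter.1 hj').2
    exact (binAt_inj.1 (hs.symm.trans hs')).1
  · ext b
    simp [contactsAt]

lemma prob_contacts_mem_le (b : p.Ball) {J : Finset (Fin p.numIntervals)} (hJ : J.card ≤ 1) :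
    p.prob {ω | ∃ j ∈ J, p.Contacts ω b j} ≤ ENNReal.ofReal (1 / p.numUsed) := by
  rw [prob_contacts_mem]
  refine ENNReal.ofReal_le_ofReal ?_
  gcongr
  exact_mod_cast hJ

lemma measurable_card_contactsAt (v : p.Bin) :
    Measurable fun ω : p.Outcome => (contactsAt ω v).card := by
  refine DependsOn.measurable (S := searchCoins Finset.univ) (fun ω ω' h => ?_)
    (finite_searchCoins _)
  have : ∀ b j, p.Contacts ω b j = p.Contacts ω' b j := fun b j =>
    (dependsOn_contacts b j).mono (contactCoins_subset (Finset.mem_univ b)) h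
  obtain ⟨J, -, hJ⟩ := contactsAt_eq (v := v)
  simp only [hJ, this]

lemma lintegral_card_filter_le {s : Finset p.Ball} {E : p.Ball → Set p.Outcome}
    (mE : ∀ b, MeasurableSet (E b)) {q : ℝ}
    (hE : ∀ b, p.prob (E b) ≤ ENNReal.ofReal q) :
    ∫⁻ ω, ((s.filter fun b => ω ∈ E b).card : ℝ≥0∞) ∂p.prob ≤ ENNReal.ofReal (s.card * q) := by
  have h : ∀ ω, ((s.filter fun b => ω ∈ E b).card : ℝ≥0∞) = ∑ b ∈ s, (E b).indicator 1 ω := by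
    intro ω
    simp [Set.indicator_apply]
  simp only [h]
  rw [lintegral_finsetSum _ fun b _ => measurable_one.indicator (mE b)]
  simp only [lintegral_indicator_one (mE _)]
  refine (Finset.sum_le_sum fun b _ => hE b).trans (le_of_eq ?_)
  rw [Finset.sum_const, nsmul_eq_mul, ← ENNReal.ofReal_natCast, ENNReal.ofReal_mul (by positivity)]

lemma lintegral_card_contactsAt_le (v : p.Bin) :
    ∫⁻ ω, ((contactsAt ω v).card : ℝ≥0∞) ∂p.prob ≤ ENNReal.ofReal (p.n * (1 / p.numUsed)) := by
  obtain ⟨J, hJ1, hJ⟩ := contactsAt_eq (v := v)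
  have := lintegral_card_filter_le (s := Finset.univ) (fun b => measurableSet_contacts_mem b J)
    (fun b => prob_contacts_mem_le b hJ1)
  rw [Finset.card_univ, Fintype.card_fin] at this
  refine le_trans (le_of_eq ?_) this
  refine lintegral_congr fun ω => ?_
  rw [hJ]
  congr

lemma lintegral_pow_card_contactsAt_le (v : p.Bin) {y : ℝ} (hy : 0 ≤ y) :
    ∫⁻ ω, ENNReal.ofReal (1 + y) ^ (contactsAt ω v).card ∂p.prob ≤
      ENNReal.ofReal (Real.exp (y * (1 / p.numUsed * p.n))) := by
  obtain ⟨J, hJ1, hJ⟩ := contactsAt_eq (v := v)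
  have := lintegral_pow_card_le p.coinLaw Finset.univ contactCoins
    (fun b b' hb => disjoint_contactCoins hb) (fun b => {ω | ∃ j ∈ J, p.Contacts ω b j})
    (fun b => dependsOn_contacts_mem b J) (fun b => measurableSet_contacts_mem b J)
    (q := 1 / p.numUsed) (by positivity) hy (fun b _ => prob_contacts_mem_le b hJ1)
  rw [Finset.card_univ, Fintype.card_fin] at this
  refine le_trans (le_of_eq ?_) this
  refine lintegral_congr fun ω => ?_
  rw [hJ]
  congr

lemma arrivals_eq (ω : p.Outcome) (v : p.Bin) :
    p.arrivals ω v = Finset.univ.filter fun b => p.target ω b ∈ ({v} : Finset p.Bin) := by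
  ext b
  simp [arrivals]

lemma measurable_card_arrivals (v : p.Bin) :
    Measurable fun ω : p.Outcome => (p.arrivals ω v).card := by
  simp only [arrivals_eq]
  exact measurable_card_target _ _

lemma lintegral_card_arrivals_le (v : p.Bin) :
    ∫⁻ ω, ((p.arrivals ω v).card : ℝ≥0∞) ∂p.prob ≤ ENNReal.ofReal (p.n * (1 / p.numUsed)) := by
  have := lintegral_card_filter_le (s := Finset.univ) (q := 1 / p.numUsed)
    (fun b => measurableSet_target_mem b {v})
    (fun b => by simpa using prob_target_mem_le b {v})
  rw [Finset.card_univ, Fintype.card_fin] at this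
  refine le_trans (le_of_eq ?_) this
  refine lintegral_congr fun ω => ?_
  rw [arrivals_eq]
  congr

lemma lintegral_pow_card_arrivals_le (v : p.Bin) {y : ℝ} (hy : 0 ≤ y) :
    ∫⁻ ω, ENNReal.ofReal (1 + y) ^ (p.arrivals ω v).card ∂p.prob ≤
      ENNReal.ofReal (Real.exp (y * (1 / p.numUsed * p.n))) := by
  have := lintegral_pow_card_target_le Finset.univ {v} hy
  rw [Finset.card_univ, Fintype.card_fin, Finset.card_singleton] at this
  simp only [arrivals_eq]
  simpa using this

/-- For every distance `s` exactly one interval lies `s` places before that of `v`. Contacting it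
and then choosing the position of `v` has probability `1 / m * (1 / l)`, and there are `l`
distances. -/
lemma prob_queries_le (b : p.Ball) (v : p.Bin) :
    p.prob {ω | ∃ j, ∃ s < p.l, p.Contacts ω b j ∧ v = p.binAt (p.shift j s) (ω (.query b s))} ≤
      ENNReal.ofReal (1 / p.numUsed) := by
  have hl : (0 : ℝ) < p.l := by exact_mod_cast p.one_le_l
  by_cases hv : ∃ i t, v = p.binAt i t
  · obtain ⟨i, t, rfl⟩ := hv
    choose g hg using fun s => shift_left_surjective (p := p) s i
    have h1 : ∀ s, p.prob ({ω | p.Contacts ω b (g s)} ∩ {ω | (ω (.query b s)).val = t.val}) ≤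
        ENNReal.ofReal (1 / p.numUsed * (1 / p.l)) := by
      intro s
      have d2 : DependsOn (fun ω : p.Outcome => ω ∈ {ω : p.Outcome |
          (ω (.query b s)).val = t.val}) {Coin.query b s} := fun ω ω' h => by
        simp only [Set.mem_ofPred_eq, h _ rfl]
      have h2 : p.prob ({ω | p.Contacts ω b (g s)} ∩ {ω | (ω (.query b s)).val = t.val}) =
          p.prob {ω | p.Contacts ω b (g s)} * p.prob {ω | (ω (.query b s)).val = t.val} :=
        measure_inter_of_dependsOn p.coinLaw (by simp [contactCoins]) (dependsOn_contacts b (g s)) d2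
          (measurableSet_contacts b (g s)) (measurableSet_of_dependsOn p (Set.finite_singleton _) d2)
      have h3 : p.prob {ω | (ω (.query b s)).val = t.val} = ENNReal.ofReal (1 / p.l) := by
        have h4 : p.prob {ω | ω (.query b s) = t} = ENNReal.ofReal (1 / p.l) :=
          p.prob_coin_eq (.query b s) t
        rw [← h4]
        congr 1
        ext ω
        exact ⟨fun h => Fin.ext h, fun h => congrArg Fin.val h⟩
      rw [h2, prob_contacts, h3, ← ENNReal.ofReal_mul (by positivity)]
    calc _ ≤ p.prob (⋃ s ∈ Finset.range p.l,
          ({ω | p.Contacts ω b (g s)} ∩ {ω | (ω (.query b s)).val = t.val})) := by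
          refine measure_mono ?_
          rintro ω ⟨j, s, hs, h2, h3⟩
          obtain ⟨h4, h5⟩ := binAt_inj.1 h3
          have h6 : j = g s := shift_left_injective s (h4.symm.trans (hg s).symm)
          refine Set.mem_biUnion (x := s) (by simpa using hs) ⟨h6 ▸ h2, ?_⟩
          exact (congrArg Fin.val h5).symm
      _ ≤ ∑ s ∈ Finset.range p.l, ENNReal.ofReal (1 / p.numUsed * (1 / p.l)) :=
          (measure_biUnion_finset_le _ _).trans (Finset.sum_le_sum fun s _ => h1 s)
      _ = _ := by
          rw [Finset.sum_const, Finset.card_range, nsmul_eq_mul, ← ENNReal.ofReal_natCast,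
            ← ENNReal.ofReal_mul (by positivity)]
          congr 1
          field_simp
  · rw [show {ω : p.Outcome | ∃ j, ∃ s < p.l, p.Contacts ω b j ∧
      v = p.binAt (p.shift j s) (ω (.query b s))} = ∅ from ?_]
    · simp
    · ext ω
      simp only [Set.mem_ofPred_eq, Set.mem_empty_iff_false, iff_false]
      rintro ⟨j, s, -, -, h⟩
      exact hv ⟨_, _, h⟩

lemma measurable_card_queriesAt (v : p.Bin) :
    Measurable fun ω : p.Outcome => ((queriesAt ω v).card : ℝ≥0∞) := by
  set S : Set (Coin p.n) := searchCoins Finset.univ ∪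
    (fun z : p.Ball × ℕ => Coin.query z.1 z.2) '' (Set.univ ×ˢ (Finset.range p.l : Set ℕ))
  refine DependsOn.measurable (S := S) (fun ω ω' h => ?_)
    ((finite_searchCoins _).union ((Set.finite_univ.prod (Finset.finite_toSet _)).image _))
  have h1 : ∀ b j, p.Acknowledged ω b j = p.Acknowledged ω' b j := fun b j =>
    (dependsOn_acknowledged b j).mono Set.subset_union_left h
  have h2 : ∀ b, p.Queries ω b v ↔ p.Queries ω' b v := by
    intro b
    simp only [Queries, h1]
    refine exists_congr fun j => exists_congr fun s => and_congr_right fun _ =>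
      and_congr_right fun _ => and_congr_right fun hs => ?_
    rw [h (.query b s) (Or.inr ⟨(b, s), by simpa using hs, rfl⟩)]
  simp only [queriesAt, h2]

lemma lintegral_card_queriesAt_le (v : p.Bin) :
    ∫⁻ ω, ((queriesAt ω v).card : ℝ≥0∞) ∂p.prob ≤ ENNReal.ofReal (p.n * (1 / p.numUsed)) := by
  have mE : ∀ b, MeasurableSet {ω | ∃ j, ∃ s < p.l, p.Contacts ω b j ∧
      v = p.binAt (p.shift j s) (ω (.query b s))} := fun b => by
    refine measurableSet_of_dependsOn p (S := contactCoins b ∪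
      Coin.query b '' (Finset.range p.l : Set ℕ))
      ((finite_contactCoins b).union ((Finset.finite_toSet _).image _)) fun ω ω' h => ?_
    have h1 : ∀ j, p.Contacts ω b j = p.Contacts ω' b j := fun j =>
      (dependsOn_contacts b j).mono Set.subset_union_left h
    simp only [Set.mem_ofPred_eq, h1, eq_iff_iff]
    refine exists_congr fun j => exists_congr fun s => and_congr_right fun hs => ?_
    rw [h (.query b s) (Or.inr ⟨s, by simpa using hs, rfl⟩)]
  have := lintegral_card_filter_le (s := Finset.univ) mE
    (fun b => prob_queries_le b v)
  rw [Finset.card_univ, Fintype.card_fin] at this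
  refine le_trans (lintegral_mono fun ω => ?_) this
  refine Nat.cast_le.2 (Finset.card_le_card fun b hb => ?_)
  obtain ⟨j, s, h1, -, h2, h3⟩ := (Finset.mem_filter.1 hb).2
  have h4 : ω ∈ {ω | ∃ j, ∃ s < p.l, p.Contacts ω b j ∧
      v = p.binAt (p.shift j s) (ω (.query b s))} := ⟨j, s, h2, h1.1, h3⟩
  simpa using h4

end FirstRounds

end Params

end BallsIntoBins

namespace BallsIntoBins

namespace Params

/-! ## The sequence of phases -/

section Gluing

variable {p : Params} {ρ : Rules p.n}

/-- The random choices that determine the placement before phase `i`. -/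
def pastCoins (p : Params) (i : ℕ) : Set (Coin p.n) :=
  (searchCoins Finset.univ ∪ targetCoins p) ∪ ⋃ j ∈ Finset.range i, (requestCoins (p := p) Finset.univ j : Set (Coin p.n))

/-- The random choices in phase `i`. -/
def phaseCoins (p : Params) (i : ℕ) : Set (Coin p.n) := {x | ∃ b s, x = .request b i s}

lemma finite_pastCoins (i : ℕ) : (pastCoins p i).Finite :=
  ((finite_searchCoins _).union finite_targetCoins).union
    (Set.Finite.biUnion (Finset.finite_toSet _) fun _ _ => Finset.finite_toSet _)

lemma pastCoins_mono {i j : ℕ} (h : i ≤ j) : pastCoins p i ⊆ pastCoins p j :=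
  Set.union_subset_union_right _ (Set.biUnion_subset_biUnion_left fun x hx => by
    simp only [Finset.mem_range, Finset.mem_coe] at hx ⊢
    omega)

lemma requestCoins_subset_pastCoins {i j : ℕ} (h : i < j) (B : Finset p.Ball) :
    (requestCoins B i : Set (Coin p.n)) ⊆ pastCoins p j := by
  intro x hx
  refine Or.inr (Set.mem_biUnion (x := i) (by simpa using h) ?_)
  obtain ⟨b, -, s, hs, rfl⟩ := mem_requestCoins.1 hx
  exact mem_requestCoins.2 ⟨b, Finset.mem_univ _, s, hs, rfl⟩

lemma requestCoins_subset_univ (B : Finset p.Ball) (i : ℕ) :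
    (requestCoins B i : Set (Coin p.n)) ⊆ (requestCoins (p := p) Finset.univ i) := by
  intro x hx
  obtain ⟨b, -, s, hs, rfl⟩ := mem_requestCoins.1 hx
  exact mem_requestCoins.2 ⟨b, Finset.mem_univ _, s, hs, rfl⟩

lemma requestCoins_subset_phaseCoins (B : Finset p.Ball) (i : ℕ) :
    (requestCoins B i : Set (Coin p.n)) ⊆ phaseCoins p i := by
  intro x hx
  obtain ⟨b, -, s, hs, rfl⟩ := mem_requestCoins.1 hx
  exact ⟨b, s, rfl⟩

lemma disjoint_pastCoins_phaseCoins (i : ℕ) : Disjoint (pastCoins p i) (phaseCoins p i) := by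
  rw [Set.disjoint_left]
  rintro x hx ⟨b, s, rfl⟩
  rcases hx with (⟨b', hb', h⟩ | ⟨b', h⟩) | h
  · rcases h with h | h | h <;> simp at h
  · simp at h
  · simp only [Set.mem_iUnion, Finset.mem_coe, mem_requestCoins, Finset.mem_range] at h
    obtain ⟨j, hj, b', -, s', -, h⟩ := h
    simp only [Coin.request.injEq] at h
    omega

lemma dependsOn_requests (pl : p.Ball → Option p.Bin) (i : ℕ) (b : p.Ball) (v : p.Bin) :
    DependsOn (fun ω => p.requests ω pl i b v) (requestCoins (p := p) Finset.univ i) := by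
  intro ω ω' h
  simp only [requests]
  congr 1
  refine congrArg Finset.card (Finset.filter_congr fun s hs => ?_)
  have h1 : ω (.request b i s) = ω' (.request b i s) :=
    h _ (mem_requestCoins.2 ⟨b, Finset.mem_univ _, s, Finset.mem_range.1 hs, rfl⟩)
  simp only [requestBin, h1]

lemma dependsOn_placement (i : ℕ) : DependsOn (fun ω => p.placement ρ ω i) (pastCoins p i) := by
  induction i with
  | zero => exact dependsOn_assigned.mono Set.subset_union_left
  | succ i ih =>
    intro ω ω' h
    have h1 : p.placement ρ ω i = p.placement ρ ω' i := ih.mono (pastCoins_mono (Nat.le_succ i)) h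
    have h2 : ∀ b v, p.requests ω (p.placement ρ ω' i) i b v =
        p.requests ω' (p.placement ρ ω' i) i b v := fun b v =>
      (dependsOn_requests _ i b v).mono (requestCoins_subset_pastCoins (Nat.lt_succ_self i) _) h
    have h3 : ∀ v, p.requesters ω (p.placement ρ ω' i) i v =
        p.requesters ω' (p.placement ρ ω' i) i v := fun v => by simp only [requesters, h2]
    have h4 : ∀ b, p.permissions ρ ω (p.placement ρ ω' i) i b =
        p.permissions ρ ω' (p.placement ρ ω' i) i b := fun b => by simp only [permissions, h3]
    funext b
    simp only [placement, h1, h4]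

lemma dependsOn_placement_comp {β : Type*} (i : ℕ) (f : (p.Ball → Option p.Bin) → β) :
    DependsOn (fun ω => f (p.placement ρ ω i)) (pastCoins p i) := fun ω ω' h => by
  have := dependsOn_placement (ρ := ρ) i h
  simp only at this ⊢
  rw [this]

lemma measurable_placement_comp {β : Type*} [MeasurableSpace β] (i : ℕ)
    (f : (p.Ball → Option p.Bin) → β) : Measurable fun ω => f (p.placement ρ ω i) :=
  DependsOn.measurable (dependsOn_placement_comp i f) (finite_pastCoins i)

lemma measurableSet_placement (i : ℕ) (P : (p.Ball → Option p.Bin) → Prop) :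
    MeasurableSet {ω | P (p.placement ρ ω i)} :=
  measurableSet_of_dependsOn p (finite_pastCoins i) (dependsOn_placement_comp i P)

lemma dependsOn_phase {β : Type*} {i : ℕ} {h : (p.Ball → Option p.Bin) → p.Outcome → β}
    (hh : ∀ pl, DependsOn (h pl) (requestCoins (p := p) Finset.univ i)) :
    DependsOn (fun ω => h (p.placement ρ ω i) ω) (pastCoins p (i + 1)) := by
  intro ω ω' hω
  have h1 : p.placement ρ ω i = p.placement ρ ω' i :=
    (dependsOn_placement i).mono (pastCoins_mono (Nat.le_succ i)) hω
  simp only [h1]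
  exact (hh _).mono (requestCoins_subset_pastCoins (Nat.lt_succ_self i) _) hω

/-- The random choices of a phase are independent of the past. -/
theorem lintegral_phase {i : ℕ} {F : p.Outcome → ℝ≥0∞} (hF : DependsOn F (pastCoins p i))
    {h : (p.Ball → Option p.Bin) → p.Outcome → ℝ≥0∞}
    (hh : ∀ pl, DependsOn (h pl) (requestCoins (p := p) Finset.univ i)) :
    ∫⁻ ω, F ω * h (p.placement ρ ω i) ω ∂p.prob =
      ∫⁻ ω, F ω * ∫⁻ ω', h (p.placement ρ ω i) ω' ∂p.prob ∂p.prob := by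
  have m1 : Measurable F := DependsOn.measurable hF (finite_pastCoins i)
  have m2 : Measurable fun ω => h (p.placement ρ ω i) ω :=
    DependsOn.measurable (dependsOn_phase hh) (finite_pastCoins (i + 1))
  have m3 : ∀ pl, Measurable (h pl) := fun pl =>
    DependsOn.measurable (hh pl) (Finset.finite_toSet _)
  -- Resampling the requests of phase `i` changes neither the placement before the phase nor `F`,
  -- while `h` sees only fresh coins.
  have h1 := lintegral_splice p.coinLaw (phaseCoins p i)
    (f := fun ω => F ω * h (p.placement ρ ω i) ω) (m1.mul m2)
  refine h1.trans (lintegral_congr fun ω => ?_)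
  have h2 : ∀ ω', p.placement ρ (splice (phaseCoins p i) ω ω') i = p.placement ρ ω i := fun ω' =>
    DependsOn.splice_eq_left (dependsOn_placement i) (disjoint_pastCoins_phaseCoins i) ω ω'
  have h3 : ∀ pl ω', h pl (splice (phaseCoins p i) ω ω') = h pl ω' := fun pl ω' =>
    DependsOn.splice_eq (hh pl) (requestCoins_subset_phaseCoins _ i) ω ω'
  have h4 : ∀ ω', F (splice (phaseCoins p i) ω ω') = F ω := fun ω' =>
    DependsOn.splice_eq_left hF (disjoint_pastCoins_phaseCoins i) ω ω'
  simp only [h2, h3, h4]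
  exact lintegral_const_mul _ (m3 _)

/-- An event in phase `i` that has small conditional probability, given that the placement before
the phase has property `H`. -/
lemma prob_phase_le {i : ℕ} {H : (p.Ball → Option p.Bin) → Prop}
    {E : (p.Ball → Option p.Bin) → p.Outcome → Prop}
    (hE : ∀ pl, DependsOn (E pl) (requestCoins (p := p) Finset.univ i)) {q : ℝ≥0∞}
    (hq : ∀ pl, H pl → p.prob {ω | E pl ω} ≤ q) :
    p.prob {ω | H (p.placement ρ ω i) ∧ E (p.placement ρ ω i) ω} ≤
      q * p.prob {ω | H (p.placement ρ ω i)} := by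
  have mH := measurableSet_placement (ρ := ρ) i H
  have mE : ∀ pl, MeasurableSet {ω | E pl ω} := fun pl =>
    measurableSet_of_dependsOn p (Finset.finite_toSet _) (hE pl)
  have mHE : MeasurableSet {ω | H (p.placement ρ ω i) ∧ E (p.placement ρ ω i) ω} :=
    mH.inter (measurableSet_of_dependsOn p (finite_pastCoins (i + 1)) (dependsOn_phase hE))
  have h1 := lintegral_phase (ρ := ρ) (i := i)
    (F := {ω | H (p.placement ρ ω i)}.indicator 1) (h := fun pl => {ω | E pl ω}.indicator 1)
    (fun ω ω' h => by
      have := dependsOn_placement_comp (ρ := ρ) i H h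
      simp only [eq_iff_iff] at this
      simp [Set.indicator, this])
    (fun pl ω ω' h => by
      have := hE pl h
      simp only [eq_iff_iff] at this
      simp [Set.indicator, this])
  rw [← lintegral_indicator_one mHE, ← lintegral_indicator_one mH]
  calc _ = _ := lintegral_congr fun ω => by
          simp only [Set.indicator_apply, Set.mem_ofPred_eq]
          split_ifs <;> simp_all
    _ = _ := h1
    _ ≤ ∫⁻ ω, q * {ω | H (p.placement ρ ω i)}.indicator 1 ω ∂p.prob := by
      refine lintegral_mono fun ω => ?_
      rw [mul_comm]
      by_cases hω : H (p.placement ρ ω i)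
      · simp only [Set.indicator_apply, Set.mem_ofPred_eq, hω, if_true, Pi.one_apply, mul_one]
        refine le_trans (le_of_eq ?_) (hq _ hω)
        rw [← lintegral_indicator_one (mE _)]
        rfl
      · simp [hω]
    _ = _ := lintegral_const_mul _ (measurable_one.indicator mH)

end Gluing

/-! ### The number of requests per ball -/

section Requests

variable {p : Params}

lemma k_le_logb (i : ℕ) : p.k i ≤ Real.logb 2 p.n := by
  cases i <;> exact min_le_right _ _

lemma one_le_k (hα : 0 ≤ p.α) (hn : 2 ≤ p.n) (i : ℕ) : 1 ≤ p.k i := by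
  have hL : 1 ≤ Real.logb 2 p.n := by
    rw [Real.le_logb_iff_rpow_le one_lt_two (by positivity), Real.rpow_one]
    exact_mod_cast hn
  induction i with
  | zero => exact le_min (Real.one_le_rpow one_le_two (by positivity)) hL
  | succ i ih =>
    refine le_min ?_ hL
    have : 1 ≤ Real.exp (⌊p.k i⌋₊ / 10) := Real.one_le_exp (by positivity)
    nlinarith

lemma one_le_floor_k (hα : 0 ≤ p.α) (hn : 2 ≤ p.n) (i : ℕ) : 1 ≤ ⌊p.k i⌋₊ :=
  (Nat.one_le_floor_iff _).2 (one_le_k hα hn i)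

lemma floor_k_le_logb (hn : 2 ≤ p.n) (hα : 0 ≤ p.α) (i : ℕ) : (⌊p.k i⌋₊ : ℝ) ≤ Real.logb 2 p.n :=
  (Nat.floor_le (by linarith [one_le_k hα hn i])).trans (k_le_logb i)

lemma k_le_k_succ (hn : 2 ≤ p.n) (hα : 0 ≤ p.α) (i : ℕ) : p.k i ≤ p.k (i + 1) := by
  refine le_min ?_ (k_le_logb i)
  have h1 : 1 ≤ Real.exp (⌊p.k i⌋₊ / 10) := Real.one_le_exp (by positivity)
  nlinarith [one_le_k hα hn i]

end Requests

/-! ### Termination -/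

section Termination

variable {p : Params} {ρ : Rules p.n}

/-- Strictness matters: there is always a bin in use with at most one ball, for all parameters and
not only for large `n`. -/
lemma n_lt_two_mul_numUsed : p.n < 2 * p.numUsed := by
  have := p.n_lt_numUsed_add
  have := p.sq_le_numUsed
  omega

/-- The number of remaining balls decreases in expectation. -/
lemma lintegral_card_remaining_succ_le (hα : 0 ≤ p.α) (hn : 2 ≤ p.n) (i : ℕ) :
    ENNReal.ofReal (1 - p.n / (2 * p.numUsed)) *
      p.prob {ω | (remaining (p.placement ρ ω i)).Nonempty} +
      ∫⁻ ω, ((remaining (p.placement ρ ω (i + 1))).card : ℝ≥0∞) ∂p.prob ≤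
      ∫⁻ ω, ((remaining (p.placement ρ ω i)).card : ℝ≥0∞) ∂p.prob := by
  set E : (p.Ball → Option p.Bin) → p.Outcome → Prop := fun pl ω =>
    ∃ b ∈ remaining pl, ∃ s < ⌊p.k i⌋₊, ω (.request b i s) ∈ nonfull pl with hE
  have dE : ∀ pl, DependsOn (E pl) (requestCoins (p := p) Finset.univ i) := by
    intro pl ω ω' h
    simp only [hE, eq_iff_iff]
    refine exists_congr fun b => and_congr_right fun hb => exists_congr fun s =>
      and_congr_right fun hs => ?_
    rw [h _ (mem_requestCoins.2 ⟨b, Finset.mem_univ _, s, hs, rfl⟩)]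
  have mE : ∀ pl, MeasurableSet {ω | E pl ω} := fun pl =>
    measurableSet_of_dependsOn p (Finset.finite_toSet _) (dE pl)
  have mN := measurableSet_placement (ρ := ρ) i fun pl => (remaining pl).Nonempty
  have h1 := lintegral_phase (ρ := ρ) (i := i) (F := fun _ => 1)
    (h := fun pl => {ω | E pl ω}.indicator 1) (fun _ _ _ => rfl)
    (fun pl ω ω' h => by
      have := dE pl h
      simp only [eq_iff_iff] at this
      simp [Set.indicator, this])
  simp only [one_mul, lintegral_indicator_one (mE _)] at h1
  -- One request of one remaining ball suffices for this bound.
  have h2 : ∀ pl : p.Ball → Option p.Bin, (remaining pl).Nonempty →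
      ENNReal.ofReal (1 - p.n / (2 * p.numUsed)) ≤ p.prob {ω | E pl ω} := by
    rintro pl ⟨b, hb⟩
    have h3 := prob_compl_eq_one_sub (μ := p.prob) (mE pl).compl
    rw [compl_compl] at h3
    rw [h3, ENNReal.ofReal_sub _ (by positivity), ENNReal.ofReal_one]
    refine tsub_le_tsub_left ((measure_mono fun ω hω s hs h => ?_).trans
      (prob_forall_request_full_le (pl := pl) (one_le_floor_k hα hn i) b)) _
    exact hω ⟨b, hb, s, hs, h⟩
  have m1 : Measurable fun ω =>
      ({ω | E (p.placement ρ ω i) ω}.indicator 1 ω : ℝ≥0∞) :=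
    measurable_one.indicator
      (measurableSet_of_dependsOn p (finite_pastCoins (i + 1)) (dependsOn_phase dE))
  calc _ ≤ ∫⁻ ω, {ω | E (p.placement ρ ω i) ω}.indicator 1 ω ∂p.prob +
        ∫⁻ ω, ((remaining (p.placement ρ ω (i + 1))).card : ℝ≥0∞) ∂p.prob := by
        gcongr
        rw [← lintegral_indicator_one mN, ← lintegral_const_mul _ (measurable_one.indicator mN)]
        refine le_trans (lintegral_mono fun ω => ?_) h1.ge
        by_cases hω : (remaining (p.placement ρ ω i)).Nonempty
        · simpa [hω] using h2 _ hω
        · simp [hω]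
    _ = ∫⁻ ω, ({ω | E (p.placement ρ ω i) ω}.indicator 1 ω +
        ((remaining (p.placement ρ ω (i + 1))).card : ℝ≥0∞)) ∂p.prob := by
        rw [lintegral_add_left m1]
    _ ≤ _ := by
        refine lintegral_mono fun ω => ?_
        by_cases hω : E (p.placement ρ ω i) ω
        · simp only [Set.indicator_apply, Set.mem_ofPred_eq, hω, if_true, Pi.one_apply]
          obtain ⟨b, hb, s, hs, h⟩ := hω
          have := card_remaining_succ_lt (mem_remaining.1 hb) hs h
          rw [add_comm]
          exact_mod_cast this
        · simp only [Set.indicator_apply, Set.mem_ofPred_eq, hω, if_false, zero_add]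
          refine Nat.cast_le.2 (Finset.card_le_card fun b hb => ?_)
          exact mem_remaining.2 (placement_eq_none_of_le (Nat.le_succ i) (mem_remaining.1 hb))

/-- The expected number of phases after phase `t`. -/
theorem tsum_prob_remaining_le (hα : 0 ≤ p.α) (hn : 2 ≤ p.n) (t : ℕ) :
    ENNReal.ofReal (1 - p.n / (2 * p.numUsed)) *
      ∑' i, p.prob {ω | (remaining (p.placement ρ ω (t + i))).Nonempty} ≤
      ∫⁻ ω, ((remaining (p.placement ρ ω t)).card : ℝ≥0∞) ∂p.prob := by
  rw [← ENNReal.tsum_mul_left]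
  refine ENNReal.tsum_le_of_sum_range_le fun N => ?_
  -- The one-phase inequality telescopes. Keeping the final expectation in the sum avoids
  -- subtraction in `ℝ≥0∞`.
  have h : ∀ N, ∑ i ∈ Finset.range N, ENNReal.ofReal (1 - p.n / (2 * p.numUsed)) *
      p.prob {ω | (remaining (p.placement ρ ω (t + i))).Nonempty} +
      ∫⁻ ω, ((remaining (p.placement ρ ω (t + N))).card : ℝ≥0∞) ∂p.prob ≤
      ∫⁻ ω, ((remaining (p.placement ρ ω t)).card : ℝ≥0∞) ∂p.prob := by
    intro N
    induction N with
    | zero => simp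
    | succ N ih =>
      rw [Finset.sum_range_succ, add_assoc]
      exact (add_le_add_right (lintegral_card_remaining_succ_le hα hn (t + N)) _).trans ih
  exact le_self_add.trans (h N)

lemma lintegral_card_remaining_le (t : ℕ) :
    ∫⁻ ω, ((remaining (p.placement ρ ω t)).card : ℝ≥0∞) ∂p.prob ≤ p.n := by
  calc _ ≤ ∫⁻ _, (p.n : ℝ≥0∞) ∂p.prob :=
        lintegral_mono fun ω => Nat.cast_le.2 (card_remaining_le _)
    _ = _ := by simp

lemma one_sub_div_pos : 0 < 1 - (p.n : ℝ) / (2 * p.numUsed) := by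
  have h : (p.n : ℝ) < 2 * p.numUsed := by exact_mod_cast n_lt_two_mul_numUsed
  have hm : (0 : ℝ) < p.numUsed := by exact_mod_cast p.numUsed_pos
  rw [sub_pos, div_lt_one (by linarith)]
  exact h

/-- For `n = 1` the cap `log n` is zero and no requests are ever sent, so termination has to come
from the coordinators: the single ball certainly coordinates the single bin. -/
lemma placement_ne_none_of_n_eq_one (hn : p.n = 1) (ω : p.Outcome) (b : p.Ball) :
    p.placement ρ ω 0 b ≠ none := by
  have hl : p.l = 1 := by
    have := p.one_le_l
    have := p.sq_le_n
    nlinarith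
  have hm : p.numUsed = 1 := by
    have := p.numUsed_pos
    have := p.numUsed_le
    omega
  have hI : p.numIntervals = 1 := by
    have := hm
    rw [numUsed, hl, mul_one] at this
    exact this
  have hb : ∀ b' : p.Ball, b' = b := fun b' => Fin.ext (by
    have := b.isLt
    have := b'.isLt
    omega)
  have hj : ∀ j j' : Fin p.numIntervals, j = j' := fun j j' => Fin.ext (by
    have := j.isLt
    have := j'.isLt
    omega)
  obtain ⟨j, s, hv⟩ := exists_binAt (target_lt (ω := ω) b)
  have hp : (ω (.participate b)).val = 0 := by
    have h1 : (ω (.participate b)).val < p.l := (ω (.participate b)).isLt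
    omega
  have hc : Covered ω j := by
    refine ⟨j, 0, p.one_le_l, (shift_zero j).symm, b, ⟨hp, hj _ _⟩, fun b₁ b₂ _ _ _ => ?_,
      fun b' _ => ?_⟩
    · rw [hb b₁, hb b₂]
    · rw [hb b']
  obtain ⟨a, ha⟩ := exists_mem_block_of_covered hc s
  rw [← hv] at ha
  intro h
  rcases assigned_eq_none h with h1 | ⟨a', h1, h2⟩
  · exact h1 a ha
  · have h3 : 0 < (p.block ω a').card := Finset.card_pos.2 ⟨_, h1⟩
    have h4 := Finset.card_le_univ (Finset.univ.filter fun b' => p.target ω b' ∈ p.block ω a')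
    rw [Fintype.card_fin] at h4
    omega

/-- The algorithm terminates almost surely. -/
theorem ae_exists_terminatedBy (hα : 0 ≤ p.α) : ∀ᵐ ω ∂p.prob, ∃ t, p.TerminatedBy ρ ω t := by
  by_cases hn : p.n = 1
  · exact Filter.Eventually.of_forall fun ω =>
      ⟨0 + 8, terminatedBy_of_placement (placement_ne_none_of_n_eq_one hn ω)⟩
  have hn : 2 ≤ p.n := by
    have := p.sq_le_n
    have := Nat.pow_pos (n := 2) p.one_le_l
    omega
  -- The terms of a convergent series tend to zero, and each of them bounds the probability of never
  -- terminating.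
  have h1 : ∑' i, p.prob {ω | (remaining (p.placement ρ ω i)).Nonempty} ≠ ⊤ := by
    have h2 := (tsum_prob_remaining_le (ρ := ρ) hα hn 0).trans (lintegral_card_remaining_le 0)
    simp only [zero_add] at h2
    intro h3
    rw [h3, ENNReal.mul_top (by simpa using one_sub_div_pos)] at h2
    simp at h2
  rw [ae_iff]
  refine le_antisymm (ge_of_tendsto (ENNReal.tendsto_atTop_zero_of_tsum_ne_top h1)
    (Filter.Eventually.of_forall fun i => measure_mono fun ω hω => ?_)) zero_le
  by_contra h
  refine hω ⟨i + 8, terminatedBy_of_placement fun b hb => h ⟨b, mem_remaining.2 hb⟩⟩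

end Termination

end Params

end BallsIntoBins

namespace BallsIntoBins

namespace Params

/-! ### The decay of the number of requests -/

lemma exp_tenth_le : Real.exp 0.1 ≤ 1.1058 := by
  have h1 : Real.exp (-0.1) ≥ 0.9045 := by
    have h2 : Real.exp (-0.1) = Real.exp (-0.01) ^ 10 := by
      rw [← Real.exp_nat_mul]; norm_num
    rw [h2]
    have h5 : Real.exp (-0.0025) ≥ 0.9975 := by
      have := Real.add_one_le_exp (-0.0025); linarith
    have h3 : Real.exp (-0.01) = Real.exp (-0.0025) ^ 4 := by
      rw [← Real.exp_nat_mul]; norm_num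
    rw [h3, ← pow_mul]
    calc (0.9045 : ℝ) ≤ 0.9975 ^ (4 * 10) := by norm_num
      _ ≤ _ := by gcongr
  have h2 : Real.exp 0.1 * Real.exp (-0.1) = 1 := by rw [← Real.exp_add]; norm_num
  nlinarith [Real.exp_pos 0.1]

/-- The contraction behind all phases: `0.85 * exp 0.1 ≤ 0.94`, so the growth of `k` loses against
the survival rate, already for a single request. -/
lemma pow_mul_exp_le {K : ℕ} (hK : 1 ≤ K) :
    (0.85 : ℝ) ^ K * Real.exp ((K : ℝ) / 10) ≤ 0.94 := by
  have h1 : Real.exp ((K : ℝ) / 10) = Real.exp 0.1 ^ K := by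
    rw [← Real.exp_nat_mul]; congr 1; ring
  rw [h1, ← mul_pow]
  have h2 : 0.85 * Real.exp 0.1 ≤ 0.94 := by linarith [exp_tenth_le]
  have h3 : 0 ≤ 0.85 * Real.exp 0.1 := by positivity
  calc _ ≤ (0.94 : ℝ) ^ K := pow_le_pow_left₀ h3 h2 K
    _ ≤ 0.94 ^ 1 := pow_le_pow_of_le_one (by norm_num) (by norm_num) hK
    _ = _ := pow_one _

/-- The hypotheses under which the first `T` phases run as expected, up to a probability `ε`. -/
structure Regime (p : Params) (T : ℕ) (ε : ℝ) : Prop extends p.Large where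
  α_eq : p.α = 1 / 10
  c_pos : 0 < p.c
  initial_le : 4 * p.l * (p.n : ℝ) ^ (3 / 4 : ℝ) * Real.logb 2 p.n ≤ 0.1 * p.n
  step_le : (p.n : ℝ) ^ (3 / 4 : ℝ) * Real.logb 2 p.n ≤ 0.01 * p.n * 0.95 ^ T
  fail_le : Real.exp (-(√p.n / (24 * p.l ^ 2))) + Real.exp (-(√p.n / 2)) +
    T * Real.exp (-(√p.n / 8)) ≤ ε

section Decay

variable {p : Params} {ρ : Rules p.n} {T : ℕ} {ε : ℝ}

lemma Regime.two_le (h : Regime p T ε) : 2 ≤ p.n := by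
  have := h.thousand_le
  have h1 : (2 : ℝ) ≤ p.n := by linarith
  exact_mod_cast h1

lemma Regime.α_nonneg (h : Regime p T ε) : 0 ≤ p.α := by
  rw [h.α_eq]; norm_num

lemma Regime.ε_nonneg (h : Regime p T ε) : 0 ≤ ε :=
  le_trans (by positivity) h.fail_le

lemma Regime.one_le_logb (h : Regime p T ε) : 1 ≤ Real.logb 2 p.n :=
  (one_le_k h.α_nonneg h.two_le 0).trans (k_le_logb 0)

/-- The remaining balls send at most `n * 0.95 ^ i` requests in phase `i`. -/
def Good (i : ℕ) (pl : p.Ball → Option p.Bin) : Prop :=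
  (remaining pl).card * p.k i ≤ p.n * 0.95 ^ i

lemma Regime.good_mul_floor_le (h : Regime p T ε) {i : ℕ} {pl : p.Ball → Option p.Bin}
    (hg : Good i pl) : ((remaining pl).card * ⌊p.k i⌋₊ : ℝ) ≤ p.n * 0.95 ^ i := by
  refine le_trans ?_ hg
  gcongr
  exact Nat.floor_le (by linarith [one_le_k h.α_nonneg h.two_le i])

lemma Regime.good_mul_floor_le_n (h : Regime p T ε) {i : ℕ} {pl : p.Ball → Option p.Bin}
    (hg : Good i pl) : (remaining pl).card * ⌊p.k i⌋₊ ≤ p.n := by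
  have h1 := h.good_mul_floor_le hg
  have h2 : (p.n : ℝ) * 0.95 ^ i ≤ p.n * 1 := by
    gcongr
    exact pow_le_one₀ (by norm_num) (by norm_num)
  rw [mul_one] at h2
  exact_mod_cast h1.trans h2

lemma two_rpow_tenth_le : (2 : ℝ) ^ (1 / 10 : ℝ) ≤ 1.072 := by
  have h1 : (2 : ℝ) ≤ 1.072 ^ (10 : ℕ) := by norm_num
  calc (2 : ℝ) ^ (1 / 10 : ℝ) ≤ ((1.072 : ℝ) ^ (10 : ℕ)) ^ (1 / 10 : ℝ) := by gcongr
    _ = 1.072 := by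
      rw [← Real.rpow_natCast, ← Real.rpow_mul (by norm_num)]
      norm_num

/-- The choice of `α` enters here. Because `2 ^ (1 / 10) ≤ 1.072`, the worst case is `l = 1` with
value `2 * 0.4 * 1.072`. The slack up to one absorbs the deviation term `Regime.initial_le`. -/
lemma two_mul_pow_mul_k_zero_le (hα : p.α = 1 / 10) : 2 * 0.4 ^ p.l * p.k 0 ≤ 0.87 := by
  have h1 : p.k 0 ≤ 1.072 ^ p.l := by
    refine (min_le_left _ _).trans ?_
    rw [hα, Real.rpow_mul two_pos.le, Real.rpow_natCast]
    gcongr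
    exact two_rpow_tenth_le
  calc 2 * 0.4 ^ p.l * p.k 0 ≤ 2 * 0.4 ^ p.l * 1.072 ^ p.l := by gcongr
    _ = 2 * (0.4 * 1.072) ^ p.l := by rw [mul_pow]; ring
    _ ≤ 2 * (0.4 * 1.072) ^ 1 := by
      gcongr 2 * ?_
      exact pow_le_pow_of_le_one (by norm_num) (by norm_num) p.one_le_l
    _ ≤ _ := by norm_num

lemma Regime.prob_not_good_zero_le (h : Regime p T ε) :
    p.prob {ω | ¬ Good 0 (p.placement ρ ω 0)} ≤
      ENNReal.ofReal (Real.exp (-(√p.n / (24 * p.l ^ 2))) + Real.exp (-(√p.n / 2))) := by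
  rw [ENNReal.ofReal_add (Real.exp_nonneg _) (Real.exp_nonneg _)]
  refine le_trans (measure_mono fun ω hω => ?_)
    (h.toLarge.prob_card_remaining_assigned_ge (ρ := ρ) h.c_pos)
  have hω' : ¬ ((remaining (p.assigned ρ ω)).card * p.k 0 ≤ p.n * 0.95 ^ 0) := hω
  simp only [Set.mem_ofPred_eq]
  by_contra hlt
  rw [not_le] at hlt
  refine hω' ?_
  have hk := one_le_k h.α_nonneg h.two_le 0
  have h1 := two_mul_pow_mul_k_zero_le h.α_eq
  have h2 := h.initial_le
  have h3 : 4 * p.l * (p.n : ℝ) ^ (3 / 4 : ℝ) * p.k 0 ≤ 0.1 * p.n :=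
    le_trans (mul_le_mul_of_nonneg_left (k_le_logb 0) (by positivity)) h2
  have h4 := mul_le_mul_of_nonneg_right hlt.le (by linarith : 0 ≤ p.k 0)
  have h5 := mul_le_mul_of_nonneg_left h1 (by positivity : (0 : ℝ) ≤ p.n)
  rw [pow_zero, mul_one]
  nlinarith

lemma k_succ_le (i : ℕ) : p.k (i + 1) ≤ p.k i * Real.exp (⌊p.k i⌋₊ / 10) := min_le_left _ _

/-- The expected number of requests contracts by `0.94`. The deviation `n ^ (3 / 4) * log n`
contributes at most `0.01 * n * 0.95 ^ i`, whence the rate `0.95`. -/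
lemma Regime.prob_good_not_good_succ_le (h : Regime p T ε) {i : ℕ} (hi : i ≤ T) :
    p.prob {ω | Good i (p.placement ρ ω i) ∧ ¬ Good (i + 1) (p.placement ρ ω (i + 1))} ≤
      ENNReal.ofReal (Real.exp (-(√p.n / 8))) := by
  have hk1 := one_le_floor_k h.α_nonneg h.two_le i
  have hkn := floor_k_le_logb h.two_le h.α_nonneg i
  have h1 := prob_phase_le (ρ := ρ) (i := i) (H := Good i)
    (E := fun pl ω => (0.85 : ℝ) ^ ⌊p.k i⌋₊ * (remaining pl).card + (p.n : ℝ) ^ (3 / 4 : ℝ) ≤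
      (Finset.univ.filter fun b => Fails pl i ω b).card)
    (fun pl ω ω' hh => by
      have : ∀ b, Fails pl i ω b ↔ Fails pl i ω' b := fun b => by
        have h2 := (dependsOn_fails pl i b).mono
          (requestCoins_subset_univ (remaining pl) i) hh
        simpa using h2
      simp only [this])
    (fun pl hpl => h.toLarge.prob_card_fails_ge hk1 hkn (h.good_mul_floor_le_n hpl))
  refine le_trans (measure_mono fun ω hω => ?_)
    (h1.trans (mul_le_of_le_one_right' prob_le_one))
  refine ⟨hω.1, ?_⟩
  by_contra hlt
  simp only [not_le] at hlt
  refine hω.2 ?_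
  set R := (remaining (p.placement ρ ω i)).card
  have h2 : ((remaining (p.placement ρ ω (i + 1))).card : ℝ) ≤
      (Finset.univ.filter fun b => Fails (p.placement ρ ω i) i ω b).card := by
    refine Nat.cast_le.2 (Finset.card_le_card fun b hb => ?_)
    simpa using fails_of_placement_succ (mem_remaining.1 hb)
  have h3 : (R : ℝ) * p.k i ≤ p.n * 0.95 ^ i := hω.1
  have h4 := k_succ_le (p := p) i
  have h5 := one_le_k h.α_nonneg h.two_le i
  have h6 := one_le_k h.α_nonneg h.two_le (i + 1)
  have h7 : (0.95 : ℝ) ^ T ≤ 0.95 ^ i := pow_le_pow_of_le_one (by norm_num) (by norm_num) hi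
  calc ((remaining (p.placement ρ ω (i + 1))).card : ℝ) * p.k (i + 1)
      ≤ ((0.85 : ℝ) ^ ⌊p.k i⌋₊ * R + (p.n : ℝ) ^ (3 / 4 : ℝ)) * p.k (i + 1) := by
        gcongr
        exact h2.trans hlt.le
    _ = (0.85 : ℝ) ^ ⌊p.k i⌋₊ * R * p.k (i + 1) + (p.n : ℝ) ^ (3 / 4 : ℝ) * p.k (i + 1) := by ring
    _ ≤ (0.85 : ℝ) ^ ⌊p.k i⌋₊ * R * (p.k i * Real.exp (⌊p.k i⌋₊ / 10)) +
        (p.n : ℝ) ^ (3 / 4 : ℝ) * Real.logb 2 p.n := by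
        gcongr
        exact k_le_logb _
    _ = ((0.85 : ℝ) ^ ⌊p.k i⌋₊ * Real.exp (⌊p.k i⌋₊ / 10)) * (R * p.k i) +
        (p.n : ℝ) ^ (3 / 4 : ℝ) * Real.logb 2 p.n := by ring
    _ ≤ 0.94 * (p.n * 0.95 ^ i) + 0.01 * p.n * 0.95 ^ i := by
        refine add_le_add (mul_le_mul (pow_mul_exp_le hk1) h3 (by positivity) (by norm_num)) ?_
        refine h.step_le.trans ?_
        gcongr
    _ = p.n * 0.95 ^ (i + 1) := by rw [pow_succ]; ring

/-- All phases up to phase `i` run as expected. -/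
def AllGood (ρ : Rules p.n) (i : ℕ) (ω : p.Outcome) : Prop := ∀ j ≤ i, Good j (p.placement ρ ω j)

theorem Regime.prob_not_allGood_le (h : Regime p T ε) :
    p.prob {ω | ¬ AllGood ρ T ω} ≤ ENNReal.ofReal ε := by
  have h1 : ∀ i, i ≤ T → p.prob {ω | ¬ AllGood ρ i ω} ≤ ENNReal.ofReal
      (Real.exp (-(√p.n / (24 * p.l ^ 2))) + Real.exp (-(√p.n / 2)) +
        i * Real.exp (-(√p.n / 8))) := by
    intro i
    induction i with
    | zero =>
      intro _
      refine le_trans (measure_mono fun ω hω => ?_)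
        ((h.prob_not_good_zero_le (ρ := ρ)).trans (by simp))
      intro hg
      refine hω fun j hj => ?_
      obtain rfl : j = 0 := by omega
      exact hg
    | succ i ih =>
      intro hi
      calc _ ≤ p.prob ({ω | ¬ AllGood ρ i ω} ∪
            {ω | Good i (p.placement ρ ω i) ∧ ¬ Good (i + 1) (p.placement ρ ω (i + 1))}) := by
            refine measure_mono fun ω hω => ?_
            by_cases hg : AllGood ρ i ω
            · refine Or.inr ⟨hg i le_rfl, fun hg' => hω fun j hj => ?_⟩
              rcases Nat.lt_or_eq_of_le hj with hj | rfl
              · exact hg j (by omega)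
              · exact hg'
            · exact Or.inl hg
        _ ≤ _ := measure_union_le _ _
        _ ≤ _ := add_le_add (ih (by omega)) (h.prob_good_not_good_succ_le (by omega))
        _ = _ := by
          rw [← ENNReal.ofReal_add (by positivity) (by positivity)]
          congr 1
          push_cast
          ring
  exact (h1 T le_rfl).trans (ENNReal.ofReal_le_ofReal h.fail_le)

lemma Regime.prob_not_good_le (h : Regime p T ε) {i : ℕ} (hi : i ≤ T) :
    p.prob {ω | ¬ Good i (p.placement ρ ω i)} ≤ ENNReal.ofReal ε :=
  (measure_mono fun ω hω (hg : AllGood ρ T ω) =>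
    (show ¬ Good i (p.placement ρ ω i) from hω) (hg i hi)).trans (h.prob_not_allGood_le (ρ := ρ))

/-! ### The probability that a ball remains -/

lemma measurableSet_placement_eq_none (i : ℕ) (b : p.Ball) :
    MeasurableSet {ω | p.placement ρ ω i b = none} :=
  measurableSet_placement i fun pl => pl b = none

/-- The bound for `Fails` holds for every `Good` placement, so it multiplies the probability that
`b` remains; `ε` pays for placements that are not good. -/
lemma Regime.prob_placement_succ_le (h : Regime p T ε) {i : ℕ} (hi : i ≤ T) (b : p.Ball) :
    p.prob.real {ω | p.placement ρ ω (i + 1) b = none} ≤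
      0.85 ^ ⌊p.k i⌋₊ * p.prob.real {ω | p.placement ρ ω i b = none} + ε := by
  have hk1 := one_le_floor_k h.α_nonneg h.two_le i
  have hkn := floor_k_le_logb h.two_le h.α_nonneg i
  have h1 := prob_phase_le (ρ := ρ) (i := i) (H := fun pl => Good i pl ∧ pl b = none)
    (E := fun pl ω => Fails pl i ω b)
    (fun pl => (dependsOn_fails pl i b).mono (requestCoins_subset_univ (remaining pl) i))
    (fun pl hpl => h.toLarge.prob_fails_le hk1 hkn (h.good_mul_floor_le_n hpl.1) b)
  have h2 : p.prob {ω | p.placement ρ ω (i + 1) b = none} ≤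
      ENNReal.ofReal (0.85 ^ ⌊p.k i⌋₊) * p.prob {ω | p.placement ρ ω i b = none} +
        ENNReal.ofReal ε := by
    calc _ ≤ p.prob ({ω | (Good i (p.placement ρ ω i) ∧ p.placement ρ ω i b = none) ∧
            Fails (p.placement ρ ω i) i ω b} ∪ {ω | ¬ Good i (p.placement ρ ω i)}) := by
          refine measure_mono fun ω hω => ?_
          by_cases hg : Good i (p.placement ρ ω i)
          · have h3 := fails_of_placement_succ (show p.placement ρ ω (i + 1) b = none from hω)
            exact Or.inl ⟨⟨hg, h3.1⟩, h3⟩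
          · exact Or.inr hg
      _ ≤ _ := measure_union_le _ _
      _ ≤ _ := by
        refine add_le_add (h1.trans ?_) (h.prob_not_good_le hi)
        gcongr
        exact fun hx => hx.2
  have h3 := ENNReal.toReal_mono (by finiteness) h2
  rw [ENNReal.toReal_add (by finiteness) (by finiteness), ENNReal.toReal_mul,
    ENNReal.toReal_ofReal (by positivity), ENNReal.toReal_ofReal h.ε_nonneg] at h3
  exact h3

lemma logb_two_le_self (n : ℕ) : Real.logb 2 n ≤ n := by
  rcases Nat.eq_zero_or_pos n with rfl | hn
  · simp
  rw [Real.logb_le_iff_le_rpow one_lt_two (by exact_mod_cast hn), Real.rpow_natCast]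
  exact_mod_cast Nat.lt_two_pow_self.le

lemma Regime.k_zero_mul_prob_le (h : Regime p T ε) (b : p.Ball) :
    p.k 0 * p.prob.real {ω | p.placement ρ ω 0 b = none} ≤ 2 := by
  have hm := h.toLarge.numUsed_ge
  have h1 : p.prob.real {ω | p.placement ρ ω 0 b = none} ≤
      2 * 0.4 ^ p.l + p.l / (p.numUsed : ℝ) ^ 2 :=
    ENNReal.toReal_le_of_le_ofReal (by positivity) (h.toLarge.prob_assigned_eq_none_le h.c_pos b)
  have hk := one_le_k h.α_nonneg h.two_le 0
  have h2 := two_mul_pow_mul_k_zero_le h.α_eq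
  have h3 : p.k 0 * (p.l / (p.numUsed : ℝ) ^ 2) ≤ 1 := by
    have h4 : p.k 0 ≤ 1.01 * p.numUsed :=
      ((k_le_logb 0).trans (logb_two_le_self _)).trans h.n_le
    have h5 : (p.l : ℝ) ^ 2 ≤ p.numUsed := by exact_mod_cast p.sq_le_numUsed
    have hl : (1 : ℝ) ≤ p.l := by exact_mod_cast p.one_le_l
    have h6 : 1.01 * (p.l : ℝ) ≤ p.numUsed := by
      by_contra h7
      rw [not_le] at h7
      nlinarith
    rw [← mul_div_assoc, div_le_one (by positivity)]
    nlinarith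
  calc _ ≤ p.k 0 * (2 * 0.4 ^ p.l + p.l / (p.numUsed : ℝ) ^ 2) := by gcongr
    _ ≤ _ := by nlinarith

lemma Regime.sum_k_mul_prob_le (h : Regime p T ε) (hε : T * Real.logb 2 p.n * ε ≤ 1) (b : p.Ball) :
    ∑ i ∈ Finset.range T, p.k i * p.prob.real {ω | p.placement ρ ω i b = none} ≤ 50 := by
  set u : ℕ → ℝ := fun i => p.k i * p.prob.real {ω | p.placement ρ ω i b = none} with hu
  have hL := h.one_le_logb
  have hu0 : ∀ i, 0 ≤ u i := fun i =>
    mul_nonneg (by linarith [one_le_k h.α_nonneg h.two_le i]) measureReal_nonneg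
  have h1 : ∀ i, i ≤ T → u (i + 1) ≤ 0.94 * u i + Real.logb 2 p.n * ε := by
    intro i hi
    have h2 := h.prob_placement_succ_le (ρ := ρ) hi b
    have h3 := pow_mul_exp_le (one_le_floor_k h.α_nonneg h.two_le i)
    have h5 := one_le_k h.α_nonneg h.two_le i
    have h6 := one_le_k h.α_nonneg h.two_le (i + 1)
    have h7 : (0 : ℝ) ≤ p.prob.real {ω | p.placement ρ ω i b = none} := measureReal_nonneg
    calc u (i + 1) ≤ p.k (i + 1) *
          (0.85 ^ ⌊p.k i⌋₊ * p.prob.real {ω | p.placement ρ ω i b = none} + ε) := by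
          simp only [hu]
          gcongr
      _ = p.k (i + 1) * (0.85 ^ ⌊p.k i⌋₊ * p.prob.real {ω | p.placement ρ ω i b = none}) +
          p.k (i + 1) * ε := mul_add _ _ _
      _ ≤ p.k i * Real.exp (⌊p.k i⌋₊ / 10) *
          (0.85 ^ ⌊p.k i⌋₊ * p.prob.real {ω | p.placement ρ ω i b = none}) +
          Real.logb 2 p.n * ε := by
          refine add_le_add (mul_le_mul_of_nonneg_right (k_succ_le i) (by positivity))
            (mul_le_mul_of_nonneg_right (k_le_logb _) h.ε_nonneg)
      _ = (0.85 ^ ⌊p.k i⌋₊ * Real.exp (⌊p.k i⌋₊ / 10)) * u i + Real.logb 2 p.n * ε := by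
          simp only [hu]; ring
      _ ≤ _ := by
          have := mul_le_mul_of_nonneg_right h3 (hu0 i)
          linarith
  -- Summing the contraction leaves `0.06` of every term on the left. With `u 0 ≤ 2` and a total
  -- error of at most one, the sum is at most `3 / 0.06 = 50`.
  have h2 : ∀ N, N ≤ T → 0.06 * ∑ i ∈ Finset.range N, u i + u N ≤
      u 0 + N * (Real.logb 2 p.n * ε) := by
    intro N
    induction N with
    | zero => intro _; simp
    | succ N ih =>
      intro hN
      have h3 := ih (by omega)
      have h4 := h1 N (by omega)
      rw [Finset.sum_range_succ]
      push_cast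
      linarith
  have h3 := h2 T le_rfl
  have h4 := h.k_zero_mul_prob_le (ρ := ρ) b
  have h5 := hu0 T
  have h6 : u 0 ≤ 2 := h4
  have h7 : (T : ℝ) * (Real.logb 2 p.n * ε) ≤ 1 := by linarith
  linarith

/-- Once the cap on the number of requests is reached, all balls are placed quickly. -/
lemma Regime.prob_placement_add_le (h : Regime p T ε) {i₀ : ℕ} (hi₀ : p.k i₀ = Real.logb 2 p.n)
    (q : ℕ) (hq : i₀ + q ≤ T + 1) (b : p.Ball) :
    p.prob.real {ω | p.placement ρ ω (i₀ + q) b = none} ≤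
      (0.85 ^ ⌊Real.logb 2 p.n⌋₊) ^ q + q * ε := by
  have hk : ∀ q, p.k (i₀ + q) = Real.logb 2 p.n := by
    intro q
    induction q with
    | zero => exact hi₀
    | succ q ih => exact le_antisymm (k_le_logb _) (ih ▸ k_le_k_succ h.two_le h.α_nonneg _)
  induction q with
  | zero => simp
  | succ q ih =>
    have h1 := h.prob_placement_succ_le (ρ := ρ) (i := i₀ + q) (by omega) b
    rw [hk q] at h1
    have h2 := ih (by omega)
    have h3 : (0.85 : ℝ) ^ ⌊Real.logb 2 p.n⌋₊ ≤ 1 := pow_le_one₀ (by norm_num) (by norm_num)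
    have h4 : (0 : ℝ) ≤ 0.85 ^ ⌊Real.logb 2 p.n⌋₊ := by positivity
    have h5 := mul_le_mul_of_nonneg_left h2 h4
    have h6 : (0.85 : ℝ) ^ ⌊Real.logb 2 p.n⌋₊ * (q * ε) ≤ 1 * (q * ε) :=
      mul_le_mul_of_nonneg_right h3 (mul_nonneg (by positivity) h.ε_nonneg)
    rw [pow_succ]
    push_cast
    calc _ ≤ _ := h1
      _ ≤ (0.85 : ℝ) ^ ⌊Real.logb 2 p.n⌋₊ * ((0.85 ^ ⌊Real.logb 2 p.n⌋₊) ^ q + q * ε) + ε := by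
        linarith
      _ ≤ _ := by linarith

/-! ### Requests in expectation -/

lemma card_remaining_eq_sum (i : ℕ) : ∫⁻ ω, ((remaining (p.placement ρ ω i)).card : ℝ≥0∞) ∂p.prob =
    ∑ b, p.prob {ω | p.placement ρ ω i b = none} := by
  have h : ∀ ω, ((remaining (p.placement ρ ω i)).card : ℝ≥0∞) =
      ∑ b, {ω | p.placement ρ ω i b = none}.indicator 1 ω := by
    intro ω
    simp [remaining, Set.indicator_apply]
  simp only [h]
  rw [lintegral_finsetSum _ fun b _ => measurable_one.indicator (measurableSet_placement_eq_none i b)]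
  simp only [lintegral_indicator_one (measurableSet_placement_eq_none i _)]

lemma lintegral_numRequests (i : ℕ) (b : p.Ball) :
    ∫⁻ ω, (numRequests ρ ω i b : ℝ≥0∞) ∂p.prob =
      ⌊p.k i⌋₊ * p.prob {ω | p.placement ρ ω i b = none} := by
  rw [← lintegral_indicator_one (measurableSet_placement_eq_none i b),
    ← lintegral_const_mul _ (measurable_one.indicator (measurableSet_placement_eq_none i b))]
  refine lintegral_congr fun ω => ?_
  simp [numRequests, Set.indicator_apply]

lemma measurable_numRequests (i : ℕ) (b : p.Ball) :
    Measurable fun ω => (numRequests ρ ω i b : ℝ≥0∞) :=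
  measurable_placement_comp (ρ := ρ) i fun pl =>
    ((if pl b = none then ⌊p.k i⌋₊ else 0 : ℕ) : ℝ≥0∞)

/-- The expected number of requests of a ball. -/
theorem Regime.lintegral_tsum_numRequests_le (h : Regime p T ε)
    (hε : T * Real.logb 2 p.n * ε ≤ 1)
    (hT : ∀ b, p.n * Real.logb 2 p.n * p.prob.real {ω | p.placement ρ ω T b = none} ≤ 1)
    (b : p.Ball) : ∫⁻ ω, ∑' i, (numRequests ρ ω i b : ℝ≥0∞) ∂p.prob ≤ 53 := by
  have hL := h.one_le_logb
  have hn0 : (0 : ℝ) < p.n := by linarith [h.thousand_le]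
  rw [lintegral_tsum fun i => (measurable_numRequests i b).aemeasurable]
  simp only [lintegral_numRequests]
  rw [← ENNReal.summable.sum_add_tsum_nat_add' (k := T)]
  have h1 : ∑ i ∈ Finset.range T, (⌊p.k i⌋₊ : ℝ≥0∞) * p.prob {ω | p.placement ρ ω i b = none} ≤
      50 := by
    have h2 := h.sum_k_mul_prob_le (ρ := ρ) hε b
    calc _ ≤ ∑ i ∈ Finset.range T, ENNReal.ofReal
          (p.k i * p.prob.real {ω | p.placement ρ ω i b = none}) := by
          refine Finset.sum_le_sum fun i _ => ?_
          have h3 := one_le_k h.α_nonneg h.two_le i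
          rw [ENNReal.ofReal_mul (by linarith), ofReal_measureReal, ← ENNReal.ofReal_natCast]
          gcongr
          exact Nat.floor_le (by linarith)
      _ = ENNReal.ofReal (∑ i ∈ Finset.range T,
          p.k i * p.prob.real {ω | p.placement ρ ω i b = none}) := by
          rw [ENNReal.ofReal_sum_of_nonneg]
          intro i _
          exact mul_nonneg (by linarith [one_le_k h.α_nonneg h.two_le i]) measureReal_nonneg
      _ ≤ ENNReal.ofReal 50 := ENNReal.ofReal_le_ofReal h2
      _ = 50 := by simp
  have h2 : ∑' i, (⌊p.k (i + T)⌋₊ : ℝ≥0∞) * p.prob {ω | p.placement ρ ω (i + T) b = none} ≤ 3 := by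
    -- After phase `T` the contraction is no longer available. Each such phase costs at most `log n`
    -- requests, while `S`, the expected number of these phases with balls left, is at most `1 /
    -- (0.495 * log n)`.
    set S := ∑' i, p.prob {ω | (remaining (p.placement ρ ω (T + i))).Nonempty} with hS
    have h3 : ENNReal.ofReal 0.495 * S ≤ ENNReal.ofReal (1 / Real.logb 2 p.n) := by
      calc _ ≤ ENNReal.ofReal (1 - p.n / (2 * p.numUsed)) * S := by
            gcongr
            have h4 := h.n_le
            have h5 := h.toLarge.numUsed_ge
            have : (p.n : ℝ) / (2 * p.numUsed) ≤ 0.505 := by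
              rw [div_le_iff₀ (by linarith)]; linarith
            linarith
        _ ≤ _ := tsum_prob_remaining_le h.α_nonneg h.two_le T
        _ = ∑ b, p.prob {ω | p.placement ρ ω T b = none} := card_remaining_eq_sum T
        _ ≤ ∑ b : p.Ball, ENNReal.ofReal (1 / (p.n * Real.logb 2 p.n)) := by
            refine Finset.sum_le_sum fun b _ => ?_
            rw [← ofReal_measureReal]
            refine ENNReal.ofReal_le_ofReal ?_
            rw [le_div_iff₀ (by positivity)]
            have := hT b
            linarith
        _ = _ := by
            rw [Finset.sum_const, Finset.card_univ, Fintype.card_fin, nsmul_eq_mul,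
              ← ENNReal.ofReal_natCast, ← ENNReal.ofReal_mul (by positivity)]
            congr 1
            field_simp
    have h4 : ENNReal.ofReal (Real.logb 2 p.n) * S ≤ 3 := by
      have h5 : ENNReal.ofReal (Real.logb 2 p.n) * (ENNReal.ofReal 0.495 * S) ≤ 1 := by
        calc _ ≤ ENNReal.ofReal (Real.logb 2 p.n) * ENNReal.ofReal (1 / Real.logb 2 p.n) := by
              gcongr
          _ = 1 := by
              rw [← ENNReal.ofReal_mul (by linarith)]
              rw [mul_one_div_cancel (by linarith), ENNReal.ofReal_one]
      calc _ ≤ ENNReal.ofReal 3 * ENNReal.ofReal 0.495 * (ENNReal.ofReal (Real.logb 2 p.n) * S) := by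
            refine le_mul_of_one_le_left zero_le ?_
            rw [← ENNReal.ofReal_mul (by norm_num)]
            simp only [ENNReal.one_le_ofReal]
            norm_num
        _ = ENNReal.ofReal 3 * (ENNReal.ofReal (Real.logb 2 p.n) * (ENNReal.ofReal 0.495 * S)) := by
            ring
        _ ≤ ENNReal.ofReal 3 * 1 := by gcongr
        _ = 3 := by simp
    refine le_trans ?_ h4
    rw [hS, ← ENNReal.tsum_mul_left]
    refine ENNReal.tsum_le_tsum fun i => ?_
    rw [← ENNReal.ofReal_natCast, add_comm i T]
    refine mul_le_mul' (ENNReal.ofReal_le_ofReal (floor_k_le_logb h.two_le h.α_nonneg _))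
      (measure_mono fun ω hω => ⟨b, mem_remaining.2 hω⟩)
  calc _ ≤ (50 : ℝ≥0∞) + 3 := add_le_add h1 h2
    _ = 53 := by norm_num

/-- Given the past, each request of phase `i` hits `v` with probability at most `1 / m`. -/
lemma lintegral_requestsAt_le (i : ℕ) (v : p.Bin) :
    ∫⁻ ω, (requestsAt ρ ω i v : ℝ≥0∞) ∂p.prob ≤
      ENNReal.ofReal (1 / p.numUsed) * ∑ b, ∫⁻ ω, (numRequests ρ ω i b : ℝ≥0∞) ∂p.prob := by
  have h1 := lintegral_phase (ρ := ρ) (i := i) (F := fun _ => 1)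
    (h := fun pl ω => ((∑ b, p.requests ω pl i b v : ℕ) : ℝ≥0∞)) (fun _ _ _ => rfl)
    (fun pl ω ω' h => by
      have h2 : ∀ b, p.requests ω pl i b v = p.requests ω' pl i b v := fun b =>
        dependsOn_requests pl i b v h
      simp only [h2])
  simp only [one_mul] at h1
  rw [← lintegral_finsetSum _ fun b _ => measurable_numRequests i b,
    ← lintegral_const_mul _ (Finset.measurable_fun_sum _ fun b _ => measurable_numRequests i b)]
  refine h1.le.trans (lintegral_mono fun ω => (lintegral_sum_requests_le _ i v).trans ?_)
  gcongr
  simp only [numRequests, remaining]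
  rw [Finset.card_filter, Finset.sum_mul]
  push_cast
  exact Finset.sum_le_sum fun b _ => by split_ifs <;> simp

lemma dependsOn_requestsAt (i : ℕ) (v : p.Bin) :
    DependsOn (fun ω => requestsAt ρ ω i v) (pastCoins p (i + 1)) := by
  refine dependsOn_phase (ρ := ρ) (h := fun pl ω => ∑ b, p.requests ω pl i b v) fun pl ω ω' h => ?_
  have h2 : ∀ b, p.requests ω pl i b v = p.requests ω' pl i b v := fun b =>
    dependsOn_requests pl i b v h
  simp only [h2]

lemma measurable_requestsAt (i : ℕ) (v : p.Bin) : Measurable fun ω => requestsAt ρ ω i v :=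
  DependsOn.measurable (dependsOn_requestsAt i v) (finite_pastCoins _)

/-- The expected number of requests received by a bin. -/
theorem Regime.lintegral_tsum_requestsAt_le (h : Regime p T ε)
    (hε : T * Real.logb 2 p.n * ε ≤ 1)
    (hT : ∀ b, p.n * Real.logb 2 p.n * p.prob.real {ω | p.placement ρ ω T b = none} ≤ 1)
    (v : p.Bin) : ∫⁻ ω, ∑' i, (requestsAt ρ ω i v : ℝ≥0∞) ∂p.prob ≤ 54 := by
  have hm := h.toLarge.numUsed_ge
  have mY : ∀ i, Measurable fun ω => (requestsAt ρ ω i v : ℝ≥0∞) := fun i =>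
    (measurable_of_countable fun k : ℕ => (k : ℝ≥0∞)).comp (measurable_requestsAt i v)
  rw [lintegral_tsum fun i => (mY i).aemeasurable]
  calc _ ≤ ∑' i, ENNReal.ofReal (1 / p.numUsed) *
        ∑ b, ∫⁻ ω, (numRequests ρ ω i b : ℝ≥0∞) ∂p.prob :=
        ENNReal.tsum_le_tsum fun i => lintegral_requestsAt_le i v
    _ = ENNReal.ofReal (1 / p.numUsed) * ∑ b, ∫⁻ ω, ∑' i, (numRequests ρ ω i b : ℝ≥0∞) ∂p.prob := by
        rw [ENNReal.tsum_mul_left, Summable.tsum_finsetSum fun _ _ => ENNReal.summable]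
        congr 1
        refine Finset.sum_congr rfl fun b _ => ?_
        rw [lintegral_tsum fun i => (measurable_numRequests i b).aemeasurable]
    _ ≤ ENNReal.ofReal (1 / p.numUsed) * ∑ b : p.Ball, ENNReal.ofReal 53 := by
        gcongr with b
        exact (h.lintegral_tsum_numRequests_le hε hT b).trans (by simp)
    _ ≤ ENNReal.ofReal 54 := by
        rw [Finset.sum_const, Finset.card_univ, Fintype.card_fin, nsmul_eq_mul,
          ← ENNReal.ofReal_natCast, ← ENNReal.ofReal_mul (by positivity),
          ← ENNReal.ofReal_mul (by positivity)]
        refine ENNReal.ofReal_le_ofReal ?_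
        have := h.n_le
        rw [one_div_mul_eq_div, div_le_iff₀ (by linarith)]
        linarith
    _ = 54 := by simp

end Decay

end Params

end BallsIntoBins

namespace BallsIntoBins

namespace Params

/-! ### Messages with high probability -/

section HighProbability

variable {p : Params} {ρ : Rules p.n} {T : ℕ} {ε : ℝ}

lemma tsum_numRequests_eq {ω : p.Outcome} (h : ∀ b, p.placement ρ ω T b ≠ none) (b : p.Ball) :
    ∑' i, (numRequests ρ ω i b : ℝ≥0∞) = ((∑ i ∈ Finset.range T, numRequests ρ ω i b : ℕ) : ℝ≥0∞) := by
  rw [tsum_eq_sum (s := Finset.range T)]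
  · push_cast; rfl
  · intro i hi
    rw [Finset.mem_range, not_lt] at hi
    rw [numRequests, if_neg fun h' => h b (placement_eq_none_of_le hi h'), Nat.cast_zero]

lemma tsum_requestsAt_eq {ω : p.Outcome} (h : ∀ b, p.placement ρ ω T b ≠ none) (v : p.Bin) :
    ∑' i, (requestsAt ρ ω i v : ℝ≥0∞) = ((∑ i ∈ Finset.range T, requestsAt ρ ω i v : ℕ) : ℝ≥0∞) := by
  rw [tsum_eq_sum (s := Finset.range T)]
  · push_cast; rfl
  · intro i hi
    rw [Finset.mem_range, not_lt] at hi
    rw [requestsAt, Finset.sum_eq_zero, Nat.cast_zero]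
    exact fun b _ => if_neg fun h' => h b (placement_eq_none_of_le hi h')

lemma card_block_le_sq (ω : p.Outcome) (b : p.Ball) : (p.block ω b).card ≤ p.l ^ 2 := by
  calc _ ≤ ((Finset.range p.l).biUnion fun s => Finset.univ.filter fun v : p.Bin =>
        ∃ t, v = p.binAt (p.shift (ω (.interval b)) s) t).card := by
        refine Finset.card_le_card fun v hv => ?_
        obtain ⟨i, t, h1, j, s, h2, h3, rfl, -⟩ := mem_block.1 hv
        obtain rfl := h2.1.2
        simp only [Finset.mem_biUnion, Finset.mem_range, Finset.mem_filter, Finset.mem_univ, true_and]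
        exact ⟨s, h3, t, h1⟩
    _ ≤ ∑ s ∈ Finset.range p.l, p.l :=
        Finset.card_biUnion_le.trans (Finset.sum_le_sum fun s _ => (card_interval _).le)
    _ = _ := by simp [sq]

lemma part_le_one (ω : p.Outcome) (b : p.Ball) : part ω b ≤ 1 := by
  unfold part; split_ifs <;> simp

/-- The number of messages of a ball, if all balls are placed before phase `T`. -/
theorem Regime.ball_messages_le (h : Regime p T ε) {ω : p.Outcome}
    (hω : ∀ b, p.placement ρ ω T b ≠ none) (b : p.Ball) :
    ((2 * p.l * part ω b + 2 * (p.block ω b).card + 5 : ℕ) : ℝ≥0∞) +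
      2 * ∑' i, (numRequests ρ ω i b : ℝ≥0∞) ≤
      ENNReal.ofReal (2 * p.l + 2 * p.l ^ 2 + 5 + 2 * ∑ i ∈ Finset.range T, p.k i) := by
  have h1 := card_block_le_sq ω b
  have h2 := part_le_one ω b
  have h3 : 2 * p.l * part ω b + 2 * (p.block ω b).card + 5 +
      2 * ∑ i ∈ Finset.range T, numRequests ρ ω i b ≤
      2 * p.l + 2 * p.l ^ 2 + 5 + 2 * ∑ i ∈ Finset.range T, ⌊p.k i⌋₊ := by
    have h4 : 2 * p.l * part ω b ≤ 2 * p.l * 1 := Nat.mul_le_mul_left _ h2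
    have h5 : ∑ i ∈ Finset.range T, numRequests ρ ω i b ≤ ∑ i ∈ Finset.range T, ⌊p.k i⌋₊ :=
      Finset.sum_le_sum fun i _ => by unfold numRequests; split_ifs <;> simp
    omega
  rw [tsum_numRequests_eq hω]
  calc _ = ((2 * p.l * part ω b + 2 * (p.block ω b).card + 5 +
      2 * ∑ i ∈ Finset.range T, numRequests ρ ω i b : ℕ) : ℝ≥0∞) := by push_cast; rfl
    _ ≤ ((2 * p.l + 2 * p.l ^ 2 + 5 + 2 * ∑ i ∈ Finset.range T, ⌊p.k i⌋₊ : ℕ) : ℝ≥0∞) :=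
      Nat.cast_le.2 h3
    _ ≤ _ := by
      rw [← ENNReal.ofReal_natCast]
      refine ENNReal.ofReal_le_ofReal ?_
      push_cast
      gcongr with i
      exact Nat.floor_le (by linarith [one_le_k h.α_nonneg h.two_le i])

/-- All phases before phase `N` run as expected. -/
def GoodBefore (ρ : Rules p.n) (N : ℕ) (ω : p.Outcome) : Prop :=
  ∀ j < N, Good j (p.placement ρ ω j)

/-- Exponential moments of the number of requests received by a bin. -/
lemma Regime.lintegral_pow_sum_requestsAt_le (h : Regime p T ε) (v : p.Bin) {y : ℝ} (hy : 0 ≤ y)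
    (N : ℕ) :
    ∫⁻ ω, (if GoodBefore ρ N ω then 1 else 0) *
      ENNReal.ofReal (1 + y) ^ (∑ j ∈ Finset.range N, requestsAt ρ ω j v) ∂p.prob ≤
      ENNReal.ofReal (Real.exp (y * (1 / p.numUsed * p.n) *
        ∑ j ∈ Finset.range N, (0.95 : ℝ) ^ j)) := by
  induction N with
  | zero =>
    have h0 : ∀ ω, GoodBefore ρ 0 ω := fun ω j hj => absurd hj (Nat.not_lt_zero j)
    simp [h0]
  | succ N ih =>
    have dG : ∀ j < N + 1, DependsOn (fun ω => Good j (p.placement ρ ω j)) (pastCoins p N) :=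
      fun j hj => (dependsOn_placement_comp j (Good j)).mono (pastCoins_mono (by omega))
    have dY : ∀ j < N, DependsOn (fun ω => requestsAt ρ ω j v) (pastCoins p N) := fun j hj =>
      DependsOn.mono (pastCoins_mono (by omega)) (dependsOn_requestsAt j v)
    have h1 := lintegral_phase (ρ := ρ) (i := N)
      (F := fun ω => (if GoodBefore ρ (N + 1) ω then 1 else 0) *
        ENNReal.ofReal (1 + y) ^ (∑ j ∈ Finset.range N, requestsAt ρ ω j v))
      (h := fun pl ω => ENNReal.ofReal (1 + y) ^ (∑ b, p.requests ω pl N b v))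
      (fun ω ω' hω => by
        have h2 : GoodBefore ρ (N + 1) ω ↔ GoodBefore ρ (N + 1) ω' :=
          forall_congr' fun j => forall_congr' fun hj => by
            have := dG j hj hω
            simpa using this
        have h3 : ∑ j ∈ Finset.range N, requestsAt ρ ω j v =
            ∑ j ∈ Finset.range N, requestsAt ρ ω' j v :=
          Finset.sum_congr rfl fun j hj => dY j (Finset.mem_range.1 hj) hω
        simp only [h2, h3])
      (fun pl ω ω' hω => by
        have h2 : ∀ b, p.requests ω pl N b v = p.requests ω' pl N b v := fun b =>
          dependsOn_requests pl N b v hω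
        simp only [h2])
    calc _ = _ := by
          refine (lintegral_congr fun ω => ?_).trans h1
          rw [Finset.sum_range_succ, pow_add, ← mul_assoc]
          rfl
      -- Given the past, phase `N` has at most `n * 0.95 ^ N` requests wherever the indicator is
      -- nonzero. Its moment is thus bounded by a constant that can be pulled out, leaving the
      -- induction hypothesis.
      _ ≤ ∫⁻ ω, (if GoodBefore ρ N ω then 1 else 0) *
          ENNReal.ofReal (1 + y) ^ (∑ j ∈ Finset.range N, requestsAt ρ ω j v) *
          ENNReal.ofReal (Real.exp (y * (1 / p.numUsed * (p.n * 0.95 ^ N)))) ∂p.prob := by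
          refine lintegral_mono fun ω => ?_
          by_cases hω : GoodBefore ρ (N + 1) ω
          · have h2 : GoodBefore ρ N ω := fun j hj => hω j (by omega)
            simp only [hω, h2, if_true]
            gcongr
            refine (lintegral_pow_sum_requests_le _ N v hy).trans (ENNReal.ofReal_le_ofReal ?_)
            refine Real.exp_le_exp.2 (mul_le_mul_of_nonneg_left (mul_le_mul_of_nonneg_left ?_
              (by positivity)) hy)
            exact h.good_mul_floor_le (hω N (by omega))
          · simp [hω]
      _ ≤ _ := by
          rw [lintegral_mul_const' _ _ ENNReal.ofReal_ne_top]
          refine (mul_le_mul_left ih _).trans (le_of_eq ?_)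
          rw [← ENNReal.ofReal_mul (Real.exp_nonneg _), ← Real.exp_add, Finset.sum_range_succ]
          congr 2
          ring

lemma sum_pow_le (N : ℕ) : ∑ j ∈ Finset.range N, (0.95 : ℝ) ^ j ≤ 20 := by
  have h3 := hasSum_geometric_of_lt_one (r := (0.95 : ℝ)) (by norm_num) (by norm_num)
  exact (sum_le_hasSum _ (fun _ _ => by positivity) h3).trans (by norm_num)

lemma measurableSet_allGood : MeasurableSet {ω | AllGood ρ T ω} := by
  have : {ω | AllGood ρ T ω} = ⋂ j ∈ Finset.range (T + 1), {ω | Good j (p.placement ρ ω j)} := by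
    ext ω
    simp [AllGood]
  rw [this]
  exact Finset.measurableSet_biInter _ fun j _ => measurableSet_placement j (Good j)

/-- Markov's inequality for the measure restricted to `AllGood`. The constant comes from `n / m ≤
1.01` and the geometric sum `20`. -/
lemma Regime.prob_sum_requestsAt_ge (h : Regime p T ε) (v : p.Bin) {y : ℝ} (hy : 0 ≤ y) (t : ℝ) :
    p.prob {ω | AllGood ρ T ω ∧ t ≤ (∑ j ∈ Finset.range T, requestsAt ρ ω j v : ℕ)} ≤
      ENNReal.ofReal ((1 + y) ^ (-t) * Real.exp (21 * y)) := by
  have mY : Measurable fun ω => ∑ j ∈ Finset.range T, requestsAt ρ ω j v :=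
    Finset.measurable_fun_sum _ fun j _ => measurable_requestsAt j v
  have h1 := measure_card_ge_le_of_lintegral_pow (p.prob.restrict {ω | AllGood ρ T ω})
    (fun ω => ∑ j ∈ Finset.range T, requestsAt ρ ω j v) mY (z := 1 + y) (t := t)
    (B := Real.exp (21 * y)) (by linarith) (by
      rw [← lintegral_indicator measurableSet_allGood]
      refine le_trans (lintegral_mono fun ω => ?_)
        ((h.lintegral_pow_sum_requestsAt_le (ρ := ρ) v hy T).trans (ENNReal.ofReal_le_ofReal ?_))
      · by_cases hω : AllGood ρ T ω
        · have h2 : GoodBefore ρ T ω := fun j hj => hω j hj.le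
          simp [hω, h2]
        · simp [hω]
      · rw [Real.exp_le_exp]
        have h3 := sum_pow_le T
        have hm := h.toLarge.numUsed_ge
        have h4 : 1 / p.numUsed * (p.n : ℝ) ≤ 1.01 := by
          rw [one_div_mul_eq_div, div_le_iff₀ (by linarith)]
          exact h.n_le
        calc _ ≤ y * 1.01 * 20 := by gcongr
          _ ≤ _ := by linarith)
  have mS : MeasurableSet {ω | t ≤ (∑ j ∈ Finset.range T, requestsAt ρ ω j v : ℕ)} :=
    measurableSet_le measurable_const ((measurable_of_countable fun k : ℕ => (k : ℝ)).comp mY)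
  rw [Measure.restrict_apply mS] at h1
  refine le_trans (measure_mono fun ω hω => ?_) h1
  exact ⟨hω.2, hω.1⟩

lemma Regime.prob_card_ge (h : Regime p T ε) {N : p.Outcome → ℕ} (mN : Measurable N) {y : ℝ}
    (hy : 0 ≤ y) (t : ℝ) (hN : ∫⁻ ω, ENNReal.ofReal (1 + y) ^ N ω ∂p.prob ≤
      ENNReal.ofReal (Real.exp (y * (1 / p.numUsed * p.n)))) :
    p.prob {ω | t ≤ N ω} ≤ ENNReal.ofReal ((1 + y) ^ (-t) * Real.exp (21 * y)) := by
  refine (measure_card_ge_le_of_lintegral_pow p.prob N mN (by linarith) hN).trans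
    (ENNReal.ofReal_le_ofReal ?_)
  have hm := h.toLarge.numUsed_ge
  have h4 : 1 / p.numUsed * (p.n : ℝ) ≤ 1.01 := by
    rw [one_div_mul_eq_div, div_le_iff₀ (by linarith)]
    exact h.n_le
  refine mul_le_mul_of_nonneg_left (Real.exp_le_exp.2 ?_) (by positivity)
  calc _ ≤ y * 1.01 := by gcongr
    _ ≤ _ := by linarith

lemma prob_exists_fin_le {n : ℕ} {E : Fin n → p.Outcome → Prop} {q : ℝ≥0∞}
    (h : ∀ v, p.prob {ω | E v ω} ≤ q) : p.prob {ω | ∃ v, E v ω} ≤ n * q := by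
  calc _ ≤ p.prob (⋃ v ∈ (Finset.univ : Finset (Fin n)), {ω | E v ω}) := by
        refine measure_mono fun ω hω => ?_
        obtain ⟨v, hv⟩ : ∃ v, E v ω := hω
        exact Set.mem_biUnion (x := v) (by simp) hv
    _ ≤ ∑ v : Fin n, q := (measure_biUnion_finset_le _ _).trans (Finset.sum_le_sum fun v _ => h v)
    _ = _ := by simp

/-- With high probability, no bin sends or receives many messages. -/
theorem Regime.prob_bin_messages_gt_le (h : Regime p T ε) {y t : ℝ} (hy : 0 ≤ y) :
    p.prob {ω | ¬ ∀ v, p.sentByBin ρ ω v ≤ ENNReal.ofReal (5 * t + p.l + 5) ∧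
      p.receivedByBin ρ ω v ≤ ENNReal.ofReal (5 * t + p.l + 5)} ≤
      ENNReal.ofReal (3 * p.n * ((1 + y) ^ (-t) * Real.exp (21 * y)) + ε) +
        p.prob {ω | ∃ b, p.placement ρ ω T b = none} := by
  set q : ℝ := (1 + y) ^ (-t) * Real.exp (21 * y) with hq
  have hq0 : 0 ≤ q := by positivity
  have h1 := prob_exists_fin_le (p := p) fun v : p.Bin =>
    h.prob_card_ge (measurable_card_contactsAt v) hy t (lintegral_pow_card_contactsAt_le v hy)
  have h2 := prob_exists_fin_le (p := p) fun v : p.Bin =>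
    h.prob_card_ge (measurable_card_arrivals v) hy t (lintegral_pow_card_arrivals_le v hy)
  have h3 := prob_exists_fin_le (p := p) fun v : p.Bin =>
    h.prob_sum_requestsAt_ge (ρ := ρ) v hy t
  have h4 := h.prob_not_allGood_le (ρ := ρ)
  set E1 := {ω : p.Outcome | ∃ v, t ≤ (contactsAt ω v).card}
  set E2 := {ω : p.Outcome | ∃ v, t ≤ (p.arrivals ω v).card}
  set E3 := {ω : p.Outcome | ∃ v, AllGood ρ T ω ∧
    t ≤ (∑ j ∈ Finset.range T, requestsAt ρ ω j v : ℕ)}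
  set E4 := {ω : p.Outcome | ¬ AllGood ρ T ω}
  set E5 := {ω : p.Outcome | ∃ b, p.placement ρ ω T b = none}
  -- Contacts count once, arrivals and requests twice each, which gives `5 * t`. Queries never
  -- exceed `l`.
  have hsub : {ω | ¬ ∀ v, p.sentByBin ρ ω v ≤ ENNReal.ofReal (5 * t + p.l + 5) ∧
      p.receivedByBin ρ ω v ≤ ENNReal.ofReal (5 * t + p.l + 5)} ⊆
      E1 ∪ E2 ∪ E3 ∪ E4 ∪ E5 := by
    intro ω hω
    by_contra hn
    simp only [Set.mem_union, not_or] at hn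
    obtain ⟨⟨⟨⟨n1, n2⟩, n3⟩, n4⟩, n5⟩ := hn
    simp only [E1, E2, E3, E4, E5, Set.mem_ofPred_eq, not_exists, not_and, not_not, not_le]
      at n1 n2 n3 n4 n5
    refine hω fun v => ?_
    have hb : (((contactsAt ω v).card + (queriesAt ω v).card +
        2 * (p.arrivals ω v).card + 5 : ℕ) : ℝ≥0∞) + 2 * ∑' i, (requestsAt ρ ω i v : ℝ≥0∞) ≤
        ENNReal.ofReal (5 * t + p.l + 5) := by
      rw [tsum_requestsAt_eq n5]
      have e : (((contactsAt ω v).card + (queriesAt ω v).card +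
          2 * (p.arrivals ω v).card + 5 : ℕ) : ℝ≥0∞) +
          2 * ((∑ i ∈ Finset.range T, requestsAt ρ ω i v : ℕ) : ℝ≥0∞) =
          (((contactsAt ω v).card + (queriesAt ω v).card +
          2 * (p.arrivals ω v).card + 5 + 2 * ∑ i ∈ Finset.range T, requestsAt ρ ω i v : ℕ) :
            ℝ≥0∞) := by push_cast; rfl
      rw [e, ← ENNReal.ofReal_natCast]
      refine ENNReal.ofReal_le_ofReal ?_
      have a1 := n1 v
      have a2 := n2 v
      have a3 := n3 v n4
      have a4 : ((queriesAt ω v).card : ℝ) ≤ p.l := by exact_mod_cast card_queriesAt_le v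
      push_cast at a3 ⊢
      linarith
    exact ⟨(sentByBin_le v).trans hb, (receivedByBin_le v).trans hb⟩
  calc _ ≤ p.prob (E1 ∪ E2 ∪ E3 ∪ E4 ∪ E5) := measure_mono hsub
    _ ≤ p.prob E1 + p.prob E2 + p.prob E3 + p.prob E4 + p.prob E5 := by
      refine (measure_union_le _ _).trans (add_le_add_left ?_ _)
      refine (measure_union_le _ _).trans (add_le_add_left ?_ _)
      refine (measure_union_le _ _).trans (add_le_add_left ?_ _)
      exact measure_union_le _ _
    _ ≤ p.n * ENNReal.ofReal q + p.n * ENNReal.ofReal q + p.n * ENNReal.ofReal q +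
        ENNReal.ofReal ε + p.prob E5 := by gcongr
    _ = _ := by
      rw [← ENNReal.ofReal_natCast, ← ENNReal.ofReal_mul (by positivity),
        ← ENNReal.ofReal_add (by positivity) (by positivity),
        ← ENNReal.ofReal_add (by positivity) (by positivity),
        ← ENNReal.ofReal_add (by positivity) h.ε_nonneg]
      congr 2
      ring

/-- Chernoff with base two at three times the mean `x = n / l`: since `exp (2 / 3) ≤ 2`, the bound
`2 ^ (-3 * x) * exp x` is at most `exp (-x)`. -/
lemma prob_sum_part_ge :
    p.prob {ω | 3 * (p.n / p.l : ℝ) ≤ (∑ b : p.Ball, part ω b : ℕ)} ≤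
      ENNReal.ofReal (Real.exp (-(p.n / p.l))) := by
  have h1 := measure_card_ge_le_of_lintegral_pow p.prob (fun ω => ∑ b : p.Ball, part ω b)
    (Finset.measurable_fun_sum _ fun b _ => measurable_part b) (z := 1 + 1)
    (t := 3 * (p.n / p.l : ℝ)) (by norm_num) (lintegral_pow_sum_part_le zero_le_one)
  refine h1.trans (ENNReal.ofReal_le_ofReal ?_)
  have h2 : Real.exp (2 / 3) ≤ 2 := by
    have h3 : Real.exp (2 / 3) ^ 3 ≤ 2 ^ 3 := by
      rw [← Real.exp_nat_mul]
      have h4 : Real.exp 1 ^ 2 = Real.exp 2 := by rw [← Real.exp_nat_mul]; norm_num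
      have h5 := Real.exp_one_lt_d9
      have h6 : ((3 : ℕ) : ℝ) * (2 / 3) = 2 := by norm_num
      rw [h6, ← h4]
      nlinarith [Real.exp_pos 1]
    exact le_of_pow_le_pow_left₀ (by norm_num) (by norm_num) h3
  have h3 : (0 : ℝ) ≤ p.n / p.l := by positivity
  calc ((1 : ℝ) + 1) ^ (-(3 * (p.n / p.l : ℝ))) * Real.exp (1 * (1 / p.l * p.n))
      ≤ Real.exp (2 / 3) ^ (-(3 * (p.n / p.l : ℝ))) * Real.exp (1 * (1 / p.l * p.n)) := by
        refine mul_le_mul_of_nonneg_right ?_ (Real.exp_nonneg _)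
        refine Real.rpow_le_rpow_of_nonpos (Real.exp_pos _) (by linarith) (by linarith)
    _ = _ := by
        rw [← Real.exp_mul, ← Real.exp_add]
        congr 1
        ring

/-- With high probability, the total number of messages is linear. -/
theorem Regime.prob_totalMessages_gt_le (h : Regime p T ε) :
    p.prob {ω | ¬ p.totalMessages ρ ω ≤ 106 * (p.n : ℝ≥0∞)} ≤
      ENNReal.ofReal (Real.exp (-(p.n / p.l)) + ε) +
        p.prob {ω | ∃ b, p.placement ρ ω T b = none} := by
  have h4 := h.prob_not_allGood_le (ρ := ρ)
  have hl : (0 : ℝ) < p.l := by exact_mod_cast p.one_le_l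
  have hsub : {ω | ¬ p.totalMessages ρ ω ≤ 106 * (p.n : ℝ≥0∞)} ⊆
      {ω | 3 * (p.n / p.l : ℝ) ≤ (∑ b : p.Ball, part ω b : ℕ)} ∪ {ω : p.Outcome | ¬ AllGood ρ T ω} ∪
        {ω : p.Outcome | ∃ b, p.placement ρ ω T b = none} := by
    intro ω hω
    by_contra hn
    simp only [Set.mem_union, not_or] at hn
    obtain ⟨⟨n1, n2⟩, n3⟩ := hn
    simp only [Set.mem_ofPred_eq, not_exists, not_not, not_le] at n1 n2 n3
    refine hω (totalMessages_le.trans ?_)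
    have e : 2 * ∑ b, (((2 * p.l * part ω b + 2 * (p.block ω b).card + 5 : ℕ) : ℝ≥0∞) +
      2 * ∑' i, (numRequests ρ ω i b : ℝ≥0∞)) =
      ((2 * ∑ b, (2 * p.l * part ω b + 2 * (p.block ω b).card + 5 +
        2 * ∑ i ∈ Finset.range T, numRequests ρ ω i b) : ℕ) : ℝ≥0∞) := by
      simp only [tsum_numRequests_eq n3]
      push_cast
      rfl
    have e2 : (106 * (p.n : ℝ≥0∞)) = ((106 * p.n : ℕ) : ℝ≥0∞) := by push_cast; rfl
    rw [e, e2]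
    refine Nat.cast_le.2 ?_
    -- With the bounds `3 * n`, `n` and `20 * n` below, this is at most `(6 + 2 + 5 + 40) * n`.
    -- Doubling for both directions gives `106 * n`.
    have e3 : ∑ b, (2 * p.l * part ω b + 2 * (p.block ω b).card + 5 +
        2 * ∑ i ∈ Finset.range T, numRequests ρ ω i b) =
        2 * (p.l * ∑ b, part ω b) + 2 * ∑ b, (p.block ω b).card + 5 * p.n +
        2 * ∑ i ∈ Finset.range T, ∑ b, numRequests ρ ω i b := by
      simp only [Finset.sum_add_distrib, ← Finset.mul_sum, mul_assoc]
      rw [Finset.sum_comm (s := Finset.univ)]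
      simp [mul_comm]
    have b1 : p.l * ∑ b, part ω b ≤ 3 * p.n := by
      have : (p.l : ℝ) * (∑ b : p.Ball, part ω b : ℕ) ≤ p.l * (3 * (p.n / p.l : ℝ)) := by
        gcongr
      have e4 : (p.l : ℝ) * (3 * (p.n / p.l : ℝ)) = 3 * p.n := by field_simp
      rw [e4] at this
      exact_mod_cast this
    have b2 := (sum_card_block_le (ω := ω)).trans p.numUsed_le
    have b3 : ∑ i ∈ Finset.range T, ∑ b, numRequests ρ ω i b ≤ 20 * p.n := by
      have b4 : ∀ i ∈ Finset.range T, ((∑ b, numRequests ρ ω i b : ℕ) : ℝ) ≤ p.n * 0.95 ^ i := by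
        intro i hi
        refine le_trans (le_of_eq ?_) (h.good_mul_floor_le (n2 i (Finset.mem_range.1 hi).le))
        simp only [numRequests, remaining]
        rw [Finset.card_filter]
        push_cast
        rw [Finset.sum_mul]
        exact Finset.sum_congr rfl fun b _ => by split_ifs <;> simp
      have b5 := Finset.sum_le_sum b4
      rw [← Finset.mul_sum] at b5
      have b6 : (p.n : ℝ) * ∑ i ∈ Finset.range T, (0.95 : ℝ) ^ i ≤ p.n * 20 := by
        gcongr
        exact sum_pow_le T
      have b7 := b5.trans b6
      rw [mul_comm]
      exact_mod_cast b7
    rw [e3]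
    omega
  calc _ ≤ _ := measure_mono hsub
    _ ≤ p.prob {ω | 3 * (p.n / p.l : ℝ) ≤ (∑ b : p.Ball, part ω b : ℕ)} +
        p.prob {ω : p.Outcome | ¬ AllGood ρ T ω} + _ :=
      (measure_union_le _ _).trans (add_le_add_left (measure_union_le _ _) _)
    _ ≤ _ := by
      rw [ENNReal.ofReal_add (Real.exp_nonneg _) h.ε_nonneg]
      gcongr
      exact prob_sum_part_ge

/-! ### Messages in expectation -/

theorem Regime.lintegral_ball_messages_le (h : Regime p T ε) (hε : T * Real.logb 2 p.n * ε ≤ 1)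
    (hT : ∀ b, p.n * Real.logb 2 p.n * p.prob.real {ω | p.placement ρ ω T b = none} ≤ 1)
    (b : p.Ball) :
    ∫⁻ ω, (((2 * p.l * part ω b + 2 * (p.block ω b).card + 5 : ℕ) : ℝ≥0∞) +
      2 * ∑' i, (numRequests ρ ω i b : ℝ≥0∞)) ∂p.prob ≤ 130 := by
  have hl : (0 : ℝ) < p.l := by exact_mod_cast p.one_le_l
  have m1 : Measurable fun ω : p.Outcome => (part ω b : ℝ≥0∞) :=
    (measurable_of_countable fun k : ℕ => (k : ℝ≥0∞)).comp (measurable_part b)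
  have m2 : Measurable fun ω : p.Outcome => ((p.block ω b).card : ℝ≥0∞) :=
    DependsOn.measurable (S := searchCoins Finset.univ) (fun ω ω' hω => by
      have := dependsOn_block b hω
      simp only at this ⊢
      rw [this]) (finite_searchCoins _)
  have m3 : Measurable fun ω => ∑' i, (numRequests ρ ω i b : ℝ≥0∞) :=
    Measurable.tsum fun i => measurable_numRequests i b
  push_cast
  rw [lintegral_add_left (by fun_prop), lintegral_add_left (by fun_prop),
    lintegral_add_left (by fun_prop), lintegral_const_mul _ m1, lintegral_const_mul _ m2,
    lintegral_const_mul _ m3, lintegral_part]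
  have h1 : 2 * (p.l : ℝ≥0∞) * ENNReal.ofReal (1 / p.l) = 2 := by
    rw [mul_assoc, ← ENNReal.ofReal_natCast, ← ENNReal.ofReal_mul hl.le,
      mul_one_div_cancel hl.ne', ENNReal.ofReal_one, mul_one]
  have h2 := lintegral_card_block_le h.c_pos h.two_le b
  have h3 := h.lintegral_tsum_numRequests_le hε hT b
  rw [h1]
  simp only [lintegral_const, measure_univ, mul_one]
  calc _ ≤ (2 : ℝ≥0∞) + 2 * 4 + 5 + 2 * 53 := by gcongr
    _ ≤ 130 := by norm_num

theorem Regime.lintegral_bin_messages_le (h : Regime p T ε) (hε : T * Real.logb 2 p.n * ε ≤ 1)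
    (hT : ∀ b, p.n * Real.logb 2 p.n * p.prob.real {ω | p.placement ρ ω T b = none} ≤ 1)
    (v : p.Bin) :
    ∫⁻ ω, ((((contactsAt ω v).card + (queriesAt ω v).card +
      2 * (p.arrivals ω v).card + 5 : ℕ) : ℝ≥0∞) +
      2 * ∑' i, (requestsAt ρ ω i v : ℝ≥0∞)) ∂p.prob ≤ 130 := by
  have hm := h.toLarge.numUsed_ge
  have hq : ENNReal.ofReal (p.n * (1 / p.numUsed)) ≤ 2 := by
    calc _ ≤ ENNReal.ofReal 2 := by
          refine ENNReal.ofReal_le_ofReal ?_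
          rw [mul_one_div, div_le_iff₀ (by linarith)]
          linarith [h.n_le]
      _ = 2 := by simp
  have m1 : Measurable fun ω : p.Outcome => ((contactsAt ω v).card : ℝ≥0∞) :=
    (measurable_of_countable fun k : ℕ => (k : ℝ≥0∞)).comp (measurable_card_contactsAt v)
  have m2 : Measurable fun ω : p.Outcome => ((p.arrivals ω v).card : ℝ≥0∞) :=
    (measurable_of_countable fun k : ℕ => (k : ℝ≥0∞)).comp (measurable_card_arrivals v)
  have m3 : Measurable fun ω => ∑' i, (requestsAt ρ ω i v : ℝ≥0∞) :=
    Measurable.tsum fun i =>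
      (measurable_of_countable fun k : ℕ => (k : ℝ≥0∞)).comp (measurable_requestsAt i v)
  have m4 : Measurable fun ω : p.Outcome => ((queriesAt ω v).card : ℝ≥0∞) :=
    measurable_card_queriesAt v
  push_cast
  rw [lintegral_add_left (by fun_prop), lintegral_add_left (by fun_prop),
    lintegral_add_left (by fun_prop), lintegral_add_left (by fun_prop),
    lintegral_const_mul _ m2, lintegral_const_mul _ m3]
  have h1 := (lintegral_card_contactsAt_le v).trans hq
  have h2 := (lintegral_card_queriesAt_le v).trans hq
  have h3 := (lintegral_card_arrivals_le v).trans hq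
  have h4 := h.lintegral_tsum_requestsAt_le hε hT v
  simp only [lintegral_const, measure_univ, mul_one]
  calc _ ≤ (2 : ℝ≥0∞) + 2 + 2 * 2 + 5 + 2 * 54 := by gcongr
    _ ≤ 130 := by norm_num

end HighProbability

end Params

end BallsIntoBins

namespace BallsIntoBins

/-! ## Iterated logarithms -/

lemma iterLog_zero (x : ℝ) : iterLog 0 x = x := rfl

lemma iterLog_succ (r : ℕ) (x : ℝ) : iterLog (r + 1) x = iterLog r (Real.logb 2 x) :=
  Function.iterate_succ_apply _ _ _

/-- If `1 < x ≤ m + 2`, then `log x ≤ m + 1`, so an integer upper bound decreases. Existence matters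
because `sInf` of the empty set would be zero. -/
lemma exists_iterLog_le_one (x : ℝ) : ∃ k, iterLog k x ≤ 1 := by
  have h : ∀ m : ℕ, ∀ x : ℝ, x ≤ m + 1 → ∃ k, iterLog k x ≤ 1 := by
    intro m
    induction m with
    | zero => exact fun x hx => ⟨0, by rw [iterLog_zero]; simpa using hx⟩
    | succ m ih =>
      intro x hx
      by_cases h1 : x ≤ 1
      · exact ⟨0, h1⟩
      rw [not_le] at h1
      obtain ⟨k, hk⟩ := ih (Real.logb 2 x) (by
        rw [Real.logb_le_iff_le_rpow one_lt_two (by linarith)]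
        refine hx.trans ?_
        have : m + 2 ≤ 2 ^ (m + 1) := Nat.lt_two_pow_self
        have h2 : ((m + 2 : ℕ) : ℝ) ≤ (2 ^ (m + 1) : ℕ) := by exact_mod_cast this
        push_cast at h2 ⊢
        have h3 : (2 : ℝ) ^ ((m : ℝ) + 1) = 2 ^ (m + 1) := by
          rw [← Real.rpow_natCast]; push_cast; rfl
        linarith)
      exact ⟨k + 1, by rwa [iterLog_succ]⟩
  obtain ⟨m, hm⟩ := exists_nat_ge x
  exact h m x (by linarith)

lemma iterLog_logStar_le (x : ℝ) : iterLog (logStar x) x ≤ 1 :=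
  Nat.sInf_mem (s := {k : ℕ | iterLog k x ≤ 1}) (exists_iterLog_le_one x)

lemma logStar_le {k : ℕ} {x : ℝ} (h : iterLog k x ≤ 1) : logStar x ≤ k := Nat.sInf_le h

lemma logStar_of_le_one {x : ℝ} (h : x ≤ 1) : logStar x = 0 :=
  Nat.le_zero.1 (logStar_le h)

lemma logStar_of_one_lt {x : ℝ} (h : 1 < x) : logStar x = logStar (Real.logb 2 x) + 1 := by
  refine le_antisymm (logStar_le ?_) ?_
  · rw [iterLog_succ]; exact iterLog_logStar_le _
  · have h1 := iterLog_logStar_le x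
    rcases hk : logStar x with _ | k
    · rw [hk, iterLog_zero] at h1
      exact absurd h1 (not_le.2 h)
    · rw [hk, iterLog_succ] at h1
      exact Nat.succ_le_succ (logStar_le h1)

lemma logStar_mono {x y : ℝ} (h : x ≤ y) : logStar x ≤ logStar y := by
  have key : ∀ k : ℕ, ∀ x y : ℝ, x ≤ y → iterLog k y ≤ 1 → logStar x ≤ k := by
    intro k
    induction k with
    | zero => exact fun x y hxy hy => logStar_le (hxy.trans hy)
    | succ k ih =>
      intro x y hxy hy
      by_cases hx : x ≤ 1
      · rw [logStar_of_le_one hx]; exact Nat.zero_le _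
      rw [not_le] at hx
      rw [logStar_of_one_lt hx]
      rw [iterLog_succ] at hy
      exact Nat.succ_le_succ
        (ih _ _ (Real.logb_le_logb_of_le one_lt_two (by linarith) hxy) hy)
  exact key _ x y h (iterLog_logStar_le y)

lemma logStar_two_rpow {x : ℝ} (hx : 0 < x) : logStar ((2 : ℝ) ^ x) = logStar x + 1 := by
  rw [logStar_of_one_lt (Real.one_lt_rpow one_lt_two hx),
    Real.logb_rpow two_pos (by norm_num)]

lemma logStar_eq_add {r : ℕ} {x : ℝ} (h : r ≤ logStar x) :
    logStar x = r + logStar (iterLog r x) := by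
  induction r generalizing x with
  | zero => simp [iterLog_zero]
  | succ r ih =>
    have h1 : 1 < x := by
      by_contra h2
      rw [logStar_of_le_one (not_lt.1 h2)] at h
      omega
    rw [logStar_of_one_lt h1] at h ⊢
    rw [iterLog_succ, ih (x := Real.logb 2 x) (by omega)]
    omega

lemma one_lt_iterLog {r : ℕ} {x : ℝ} (h : r < logStar x) : 1 < iterLog r x := by
  by_contra h1
  exact absurd (logStar_le (not_lt.1 h1)) (not_le.2 h)

lemma add_one_le_two_rpow {l : ℕ} : (l : ℝ) + 1 ≤ (2 : ℝ) ^ (l : ℝ) := by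
  rw [Real.rpow_natCast]
  exact_mod_cast (Nat.lt_two_pow_self : l < 2 ^ l)

lemma logStar_le_of_le_add_one {l : ℕ} (hl : 1 ≤ l) {x : ℝ} (hx : x ≤ l + 1) :
    logStar x ≤ logStar l + 1 := by
  rw [← logStar_two_rpow (by exact_mod_cast hl)]
  exact logStar_mono (hx.trans add_one_le_two_rpow)

/-- The chain `(l + 1) ^ 2 ≤ 2 ^ (2 * l) ≤ 2 ^ (2 ^ l)` costs two iterations. It is needed when
`√(log n)` determines `l`. -/
lemma logStar_le_of_le_sq {l : ℕ} (hl : 1 ≤ l) {x : ℝ} (hx : x ≤ (l + 1) ^ 2) :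
    logStar x ≤ logStar l + 2 := by
  have hl' : (0 : ℝ) < l := by exact_mod_cast hl
  have h1 : (2 * l : ℝ) ≤ (2 : ℝ) ^ (l : ℝ) := by
    rw [Real.rpow_natCast]
    have : ∀ l : ℕ, 1 ≤ l → 2 * l ≤ 2 ^ l := by
      intro l hl
      induction l, hl using Nat.le_induction with
      | base => norm_num
      | succ l hl ih => rw [pow_succ]; omega
    exact_mod_cast this l hl
  have h2 : logStar ((2 : ℝ) ^ ((2 : ℝ) ^ (l : ℝ))) = logStar l + 2 := by
    rw [logStar_two_rpow (Real.rpow_pos_of_pos two_pos _), logStar_two_rpow hl']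
  rw [← h2]
  refine logStar_mono (hx.trans ?_)
  calc ((l : ℝ) + 1) ^ 2 ≤ ((2 : ℝ) ^ (l : ℝ)) ^ 2 := by
        gcongr
        exact add_one_le_two_rpow
    _ = (2 : ℝ) ^ (2 * l : ℝ) := by
        rw [← Real.rpow_natCast, ← Real.rpow_mul two_pos.le, mul_comm]; norm_num
    _ ≤ _ := Real.rpow_le_rpow_of_exponent_le one_le_two h1

namespace Params

/-! ### The growth of the number of requests -/

section Growth

variable {p : Params}

lemma min_le_k_succ (hα : 0 ≤ p.α) (hn : 2 ≤ p.n) (i : ℕ) :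
    min (1.1 * p.k i) (Real.logb 2 p.n) ≤ p.k (i + 1) := by
  refine min_le_min_right _ ?_
  have h1 : (1 : ℝ) ≤ ⌊p.k i⌋₊ := by exact_mod_cast one_le_floor_k hα hn i
  have h2 := Real.add_one_le_exp ((⌊p.k i⌋₊ : ℝ) / 10)
  have h3 := one_le_k hα hn i
  nlinarith

lemma k_mono (hα : 0 ≤ p.α) (hn : 2 ≤ p.n) : Monotone p.k :=
  monotone_nat_of_le_succ (k_le_k_succ hn hα)

lemma pow_le_k (hα : 0 ≤ p.α) (hn : 2 ≤ p.n) {i : ℕ} (hi : p.k i < Real.logb 2 p.n) :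
    (1.1 : ℝ) ^ i ≤ p.k i := by
  induction i with
  | zero => simpa using one_le_k hα hn 0
  | succ i ih =>
    have h1 := ih ((k_le_k_succ hn hα i).trans_lt hi)
    rcases min_le_iff.1 (min_le_k_succ hα hn i) with h2 | h2
    · rw [pow_succ]; linarith
    · linarith

/-- Growth by a factor of at least `1.1` before the cap: `10 * k i + k i ≤ 10 * k (i + 1)`. -/
lemma sum_k_le_of_lt (hα : 0 ≤ p.α) (hn : 2 ≤ p.n) {i : ℕ} (hi : p.k i < Real.logb 2 p.n) :
    ∑ j ∈ Finset.range i, p.k j ≤ 10 * p.k i := by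
  induction i with
  | zero => simpa using by linarith [one_le_k hα hn 0]
  | succ i ih =>
    have h1 := ih ((k_le_k_succ hn hα i).trans_lt hi)
    rw [Finset.sum_range_succ]
    rcases min_le_iff.1 (min_le_k_succ hα hn i) with h2 | h2
    · linarith
    · linarith

/-- Before the cap, `k / 10` exponentiates in every phase, so each phase raises its `logStar` by at
least one. The floor is harmless: `log 2 * k ≤ k - 1` for `k ≥ 10`. -/
lemma two_rpow_le_k_succ {i : ℕ} (hi : 10 ≤ p.k i) (hi' : p.k (i + 1) < Real.logb 2 p.n) :
    (2 : ℝ) ^ (p.k i / 10) ≤ p.k (i + 1) / 10 := by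
  have h1 : p.k (i + 1) = p.k i * Real.exp (⌊p.k i⌋₊ / 10) := by
    rcases min_choice (p.k i * Real.exp (⌊p.k i⌋₊ / 10)) (Real.logb 2 p.n) with h | h
    · exact h
    · exact absurd (show p.k (i + 1) = _ from h) hi'.ne
  have h2 := Nat.lt_floor_add_one (p.k i)
  have h3 := Real.log_two_lt_d9
  calc (2 : ℝ) ^ (p.k i / 10) = Real.exp (Real.log 2 * (p.k i / 10)) := by
        rw [Real.rpow_def_of_pos two_pos]
    _ ≤ Real.exp (⌊p.k i⌋₊ / 10) := by
        rw [Real.exp_le_exp]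
        nlinarith
    _ ≤ _ := by
        rw [h1]
        nlinarith [Real.exp_pos ((⌊p.k i⌋₊ : ℝ) / 10)]

lemma add_logStar_le (hα : 0 ≤ p.α) (hn : 2 ≤ p.n) {i : ℕ} (hi : 10 ≤ p.k i) (j : ℕ)
    (hj : p.k (i + j) < Real.logb 2 p.n) :
    j + logStar (p.k i / 10) ≤ logStar (p.k (i + j) / 10) := by
  induction j with
  | zero => simp
  | succ j ih =>
    have h1 := ih ((k_le_k_succ hn hα _).trans_lt hj)
    have h2 : 10 ≤ p.k (i + j) := hi.trans (k_mono hα hn (Nat.le_add_right i j))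
    have h3 := logStar_mono (two_rpow_le_k_succ h2 hj)
    rw [logStar_two_rpow (by linarith)] at h3
    rw [← add_assoc i j 1]
    omega

lemma ten_mul_le_two_rpow {l : ℕ} (hl : 200 ≤ l) : 10 * (l : ℝ) ≤ (2 : ℝ) ^ (1 / 10 * (l : ℝ)) := by
  have hl' : (200 : ℝ) ≤ l := by exact_mod_cast hl
  have h1 : (2 : ℝ) ^ (1 / 10 * (l : ℝ)) = 2 ^ (20 : ℕ) * (2 : ℝ) ^ (1 / 10 * (l : ℝ) - 20) := by
    rw [← Real.rpow_natCast, ← Real.rpow_add two_pos]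
    congr 1
    push_cast
    ring
  have h2 : 1 + 0.5 * (1 / 10 * (l : ℝ) - 20) ≤ (2 : ℝ) ^ (1 / 10 * (l : ℝ) - 20) := by
    rw [Real.rpow_def_of_pos two_pos]
    have h3 := Real.add_one_le_exp (Real.log 2 * (1 / 10 * (l : ℝ) - 20))
    have h4 := Real.log_two_gt_d9
    nlinarith
  rw [h1]
  norm_num at h2 ⊢
  linarith

lemma logStar_le_four {x : ℝ} (hx : x ≤ 200) : logStar x ≤ 4 := by
  have h1 : logStar ((2 : ℝ) ^ ((2 : ℝ) ^ ((2 : ℝ) ^ ((2 : ℝ) ^ (1 : ℝ))))) = 4 := by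
    rw [logStar_two_rpow (by positivity), logStar_two_rpow (by positivity),
      logStar_two_rpow (by positivity), logStar_two_rpow one_pos, logStar_of_le_one le_rfl]
  rw [← h1]
  refine logStar_mono (hx.trans ?_)
  norm_num

/-- Suppose the cap were not reached. After 25 phases `k` would be at least `1.1 ^ 25 ≥ 10`, and
from then on every phase would raise `logStar (k / 10)`. This starts no lower than `logStar l - 4`,
because `k 0 / 10 ≥ l` for `l ≥ 200`, and it can never exceed `logStar n`. -/
lemma exists_k_eq_logb (hα : p.α = 1 / 10) (hn : 2 ≤ p.n) :
    ∃ i, p.k i = Real.logb 2 p.n ∧ i + logStar p.l ≤ logStar p.n + 30 := by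
  have hα0 : 0 ≤ p.α := by rw [hα]; norm_num
  have hln : logStar p.l ≤ logStar p.n := by
    refine logStar_mono ?_
    have := p.sq_le_n
    have h1 : p.l ≤ p.n := by nlinarith [p.one_le_l]
    exact_mod_cast h1
  refine ⟨25 + (logStar p.n - logStar p.l + 5), ?_, by omega⟩
  by_contra hne
  have hlt := lt_of_le_of_ne (k_le_logb (p := p) _) hne
  have h25 := (k_mono hα0 hn (Nat.le_add_right 25 (logStar p.n - logStar p.l + 5))).trans_lt hlt
  have h10 : 10 ≤ p.k 25 := le_trans (by norm_num) (pow_le_k hα0 hn h25)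
  have h1 := add_logStar_le hα0 hn h10 _ hlt
  have h2 : logStar (p.k (25 + (logStar p.n - logStar p.l + 5)) / 10) ≤ logStar p.n := by
    refine logStar_mono ?_
    have h3 := one_le_k hα0 hn (25 + (logStar p.n - logStar p.l + 5))
    have h4 := logb_two_le_self p.n
    linarith
  have h3 : logStar p.l ≤ logStar (p.k 25 / 10) + 4 := by
    rcases le_total p.l 200 with h4 | h4
    · exact (logStar_le_four (by exact_mod_cast h4)).trans (Nat.le_add_left _ _)
    · refine (logStar_mono ?_).trans (Nat.le_add_right _ _)
      have h5 := k_mono hα0 hn (Nat.zero_le 25)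
      have h6 : p.k 0 = (2 : ℝ) ^ (1 / 10 * (p.l : ℝ)) := by
        rcases min_choice ((2 : ℝ) ^ (p.α * p.l)) (Real.logb 2 p.n) with h | h
        · rw [← hα]; exact h
        · have h7 : p.k 0 = Real.logb 2 p.n := h
          linarith
      have h8 := ten_mul_le_two_rpow h4
      linarith
  omega

/-- The first phase in which the number of requests reaches its cap. -/
theorem exists_cap (hα : p.α = 1 / 10) (hn : 2 ≤ p.n) :
    ∃ i, p.k i = Real.logb 2 p.n ∧ i + logStar p.l ≤ logStar p.n + 30 ∧
      (1.1 : ℝ) ^ i ≤ 1.1 * Real.logb 2 p.n ∧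
      ∑ j ∈ Finset.range i, p.k j ≤ 11 * Real.logb 2 p.n := by
  have hα0 : 0 ≤ p.α := by rw [hα]; norm_num
  obtain ⟨i', hi', hle⟩ := exists_k_eq_logb hα hn
  have hex : ∃ i, p.k i = Real.logb 2 p.n := ⟨i', hi'⟩
  have hL : 1 ≤ Real.logb 2 p.n := (one_le_k hα0 hn 0).trans (k_le_logb 0)
  refine ⟨Nat.find hex, Nat.find_spec hex, ?_, ?_⟩
  · have := Nat.find_min' hex hi'
    omega
  · rcases hi : Nat.find hex with _ | i
    · constructor
      · norm_num; linarith
      · simp; linarith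
    · have h1 : p.k i < Real.logb 2 p.n :=
        lt_of_le_of_ne (k_le_logb i) (Nat.find_min hex (by omega))
      constructor
      · have := pow_le_k hα0 hn h1
        rw [pow_succ]
        linarith
      · rw [Finset.sum_range_succ]
        have := sum_k_le_of_lt hα0 hn h1
        linarith

end Growth

end Params

end BallsIntoBins

namespace BallsIntoBins

/-! ## Large numbers of balls -/

/-- The number of phases after the number of requests has reached its cap. -/
noncomputable def lastPhases (c : ℝ) : ℕ := ⌈10 * (c + 5)⌉₊

/-- A lower bound for `n ^ (1 / 4) / (log n) ^ 2`. -/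
noncomputable def threshold (c C : ℝ) : ℝ :=
  1000 + lastPhases c + 40 * C + 120 / 0.95 ^ lastPhases c + 200 * C ^ 2 + 24 * C ^ 2 * (c + 5) +
    8 * (c + 6) + C * (c + 4)

lemma eventually_threshold (D : ℝ) : ∀ᶠ n : ℕ in Filter.atTop,
    1000 ≤ Real.logb 2 n ∧ D * Real.logb 2 n ^ 2 ≤ (n : ℝ) ^ (1 / 4 : ℝ) := by
  have h1 : ∀ᶠ x : ℝ in Filter.atTop, 1000 ≤ Real.logb 2 x :=
    (Real.tendsto_logb_atTop one_lt_two).eventually_ge_atTop 1000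
  have h2 := (isLittleO_log_rpow_rpow_atTop (s := 1 / 4) 2 (by norm_num)).def
    (c := Real.log 2 ^ 2 / (|D| + 1)) (by positivity)
  have h3 : ∀ᶠ x : ℝ in Filter.atTop,
      1000 ≤ Real.logb 2 x ∧ D * Real.logb 2 x ^ 2 ≤ x ^ (1 / 4 : ℝ) := by
    filter_upwards [h1, h2, Filter.eventually_ge_atTop 1] with x h1 h2 hx
    refine ⟨h1, ?_⟩
    have hl : 0 < Real.log 2 := Real.log_pos one_lt_two
    have hlx : 0 ≤ Real.log x := Real.log_nonneg hx
    rw [Real.norm_of_nonneg (by positivity), Real.norm_of_nonneg (by positivity),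
      div_mul_eq_mul_div, le_div_iff₀ (by positivity)] at h2
    have h4 : Real.log x ^ (2 : ℝ) = Real.log x ^ 2 := by
      rw [← Real.rpow_natCast]; norm_num
    rw [h4] at h2
    rw [Real.logb, div_pow, ← mul_div_assoc, div_le_iff₀ (by positivity)]
    have h5 : D * Real.log x ^ 2 ≤ (|D| + 1) * Real.log x ^ 2 := by
      gcongr
      linarith [le_abs_self D]
    linarith
  exact tendsto_natCast_atTop_atTop.eventually h3

namespace Params

/-- The assumptions on the parameters for a large number of balls. -/
structure Ample (p : Params) (C : ℝ) : Prop where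
  α_eq : p.α = 1 / 10
  c_pos : 0 < p.c
  C_pos : 0 < C
  l_le : (p.l : ℝ) ≤ C * √(Real.logb 2 p.n)
  thousand_le : 1000 ≤ Real.logb 2 p.n
  threshold_le : threshold p.c C * Real.logb 2 p.n ^ 2 ≤ (p.n : ℝ) ^ (1 / 4 : ℝ)

section Ample

variable {p : Params} {C : ℝ}

/-- The bounds that make up the threshold. -/
lemma Ample.mul_sq_le (h : Ample p C) {x : ℝ} (hx : x ≤ threshold p.c C) :
    x * Real.logb 2 p.n ^ 2 ≤ (p.n : ℝ) ^ (1 / 4 : ℝ) :=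
  (mul_le_mul_of_nonneg_right hx (sq_nonneg _)).trans h.threshold_le

/-- The summands serve, in order: the number of phases being at most `n`, the initial deviation, the
deviation in a phase, the ignored bins, the concentration of uncovered intervals, the other two
concentration bounds, and the number of participating balls. -/
lemma Ample.le_threshold (h : Ample p C) :
    1000 + (lastPhases p.c : ℝ) ≤ threshold p.c C ∧ 40 * C ≤ threshold p.c C ∧
    120 / 0.95 ^ lastPhases p.c ≤ threshold p.c C ∧ 200 * C ^ 2 ≤ threshold p.c C ∧
    24 * C ^ 2 * (p.c + 5) ≤ threshold p.c C ∧ 8 * (p.c + 6) ≤ threshold p.c C ∧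
    C * (p.c + 4) ≤ threshold p.c C := by
  have hc := h.c_pos
  have hC := h.C_pos
  have h1 : (0 : ℝ) ≤ lastPhases p.c := by positivity
  have h2 : (0 : ℝ) ≤ 120 / 0.95 ^ lastPhases p.c := by positivity
  have h3 : 0 ≤ 24 * C ^ 2 * (p.c + 5) := by positivity
  have h4 : 0 ≤ C * (p.c + 4) := by positivity
  have h5 : 0 ≤ 200 * C ^ 2 := by positivity
  unfold threshold
  refine ⟨?_, ?_, ?_, ?_, ?_, ?_, ?_⟩ <;> linarith

lemma Ample.n_pos (h : Ample p C) : (0 : ℝ) < p.n := by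
  have h1 : 0 < p.n := by
    rcases Nat.eq_zero_or_pos p.n with h0 | h0
    · have := h.thousand_le
      rw [h0] at this
      norm_num at this
    · exact h0
  exact_mod_cast h1

/-- The fourth root of `n`. -/
lemma Ample.root (h : Ample p C) : ∃ w : ℝ, (p.n : ℝ) ^ (1 / 4 : ℝ) = w ∧ (p.n : ℝ) = w ^ 4 ∧
    √p.n = w ^ 2 ∧ (p.n : ℝ) ^ (3 / 4 : ℝ) = w ^ 3 ∧ 1000 * Real.logb 2 p.n ^ 2 ≤ w := by
  have hn := h.n_pos
  refine ⟨_, rfl, ?_, ?_, ?_, h.mul_sq_le (le_trans ?_ h.le_threshold.1)⟩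
  · rw [← Real.rpow_natCast, ← Real.rpow_mul hn.le]; norm_num
  · rw [Real.sqrt_eq_rpow, ← Real.rpow_natCast, ← Real.rpow_mul hn.le]; norm_num
  · rw [← Real.rpow_natCast, ← Real.rpow_mul hn.le]; norm_num
  · have : (0 : ℝ) ≤ lastPhases p.c := by positivity
    linarith

lemma Ample.exp_neg_le (h : Ample p C) {x a : ℝ} (ha : 0 ≤ a) (hx : a * Real.logb 2 p.n ≤ x) :
    Real.exp (-x) ≤ (p.n : ℝ) ^ (-a) := by
  have hL := h.thousand_le
  rw [Real.rpow_def_of_pos h.n_pos, Real.exp_le_exp]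
  have h1 : Real.log p.n ≤ Real.logb 2 p.n := by
    have h2 := Real.log_two_lt_d9
    have h3 := Real.log_pos one_lt_two
    have h4 : Real.log p.n = Real.logb 2 p.n * Real.log 2 := by
      rw [Real.logb, div_mul_cancel₀ _ h3.ne']
    rw [h4]
    nlinarith
  nlinarith

lemma Ample.two_rpow_logb (h : Ample p C) : (2 : ℝ) ^ Real.logb 2 p.n = p.n :=
  Real.rpow_logb two_pos (by norm_num) h.n_pos

lemma Ample.half_rpow (h : Ample p C) (a : ℝ) :
    (1 / 2 : ℝ) ^ (Real.logb 2 p.n * a) = (p.n : ℝ) ^ (-a) := by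
  rw [one_div, Real.inv_rpow two_pos.le, Real.rpow_mul two_pos.le, h.two_rpow_logb,
    Real.rpow_neg h.n_pos.le]

lemma Ample.l_sq_le (h : Ample p C) : (p.l : ℝ) ^ 2 ≤ C ^ 2 * Real.logb 2 p.n := by
  have hL := h.thousand_le
  calc (p.l : ℝ) ^ 2 ≤ (C * √(Real.logb 2 p.n)) ^ 2 := by gcongr; exact h.l_le
    _ = _ := by rw [mul_pow, Real.sq_sqrt (by linarith)]

lemma Ample.l_le_mul (h : Ample p C) : (p.l : ℝ) ≤ C * Real.logb 2 p.n := by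
  have hL := h.thousand_le
  refine h.l_le.trans (mul_le_mul_of_nonneg_left ?_ h.C_pos.le)
  rw [Real.sqrt_le_left (by linarith)]
  nlinarith

lemma Ample.rpow_succ (h : Ample p C) (a : ℝ) :
    (p.n : ℝ) ^ (-(a + 1)) * p.n = (p.n : ℝ) ^ (-a) := by
  rw [← Real.rpow_add_one h.n_pos.ne']
  congr 1
  ring

theorem Ample.large (h : Ample p C) : p.Large := by
  obtain ⟨w, hw, hn4, -, -, hLw⟩ := h.root
  have hL := h.thousand_le
  have hw1 : (10 : ℝ) ^ 9 ≤ w := by nlinarith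
  have hwn : w * 10 ^ 9 ≤ p.n := by
    rw [hn4]
    nlinarith [pow_le_pow_left₀ (by norm_num) hw1 2, pow_le_pow_left₀ (by norm_num) hw1 3]
  have hn1 : (1000 : ℝ) ≤ p.n := by nlinarith
  refine ⟨hn1, ?_, ?_⟩
  · have h1 : (p.n : ℝ) < p.numUsed + p.l ^ 2 := by exact_mod_cast p.n_lt_numUsed_add
    have h2 := h.l_sq_le
    have h3 := h.mul_sq_le h.le_threshold.2.2.2.1
    have h4 : C ^ 2 * Real.logb 2 p.n ≤ C ^ 2 * Real.logb 2 p.n ^ 2 := by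
      gcongr
      nlinarith
    rw [hw] at h3
    nlinarith
  · have h1 : Real.exp (-(p.n / 10000 : ℝ)) ≤ (p.n : ℝ) ^ (-2 : ℝ) := by
      refine h.exp_neg_le two_pos.le ?_
      rw [le_div_iff₀ (by norm_num)]
      nlinarith
    have h2 : (p.n : ℝ) ^ (-1 : ℝ) ≤ 0.84 ^ Real.logb 2 p.n := by
      rw [← h.half_rpow, mul_one]
      exact Real.rpow_le_rpow (by norm_num) (by norm_num) (by linarith)
    have h3 := h.rpow_succ 1
    rw [show (-(1 + 1) : ℝ) = -2 by norm_num] at h3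
    have h4 : (p.n : ℝ) ^ (-2 : ℝ) ≤ 0.01 * (p.n : ℝ) ^ (-1 : ℝ) := by
      rw [← h3]
      have : (0 : ℝ) < (p.n : ℝ) ^ (-2 : ℝ) := Real.rpow_pos_of_pos h.n_pos _
      nlinarith
    linarith

lemma Ample.two_le (h : Ample p C) : 2 ≤ p.n := by
  have h1 : (2 : ℝ) ≤ p.n := by linarith [h.large.thousand_le]
  exact_mod_cast h1

/-- The number of phases within which all balls are placed, with high probability. -/
theorem Ample.exists_regime (h : Ample p C) : ∃ i, p.k i = Real.logb 2 p.n ∧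
    i + logStar p.l ≤ logStar p.n + 30 ∧
    ∑ j ∈ Finset.range i, p.k j ≤ 11 * Real.logb 2 p.n ∧
    ((i + lastPhases p.c : ℕ) : ℝ) ≤ p.n ∧
    Regime p (i + lastPhases p.c) ((p.n : ℝ) ^ (-(p.c + 4))) := by
  obtain ⟨i, h1, h2, h3, h4⟩ := exists_cap h.α_eq h.two_le
  obtain ⟨w, hw, hn4, hn2, hn3, hLw⟩ := h.root
  obtain ⟨d1, d2, d3, -, d5, d6, -⟩ := h.le_threshold
  have hL := h.thousand_le
  have hc := h.c_pos
  have hl : (1 : ℝ) ≤ p.l := by exact_mod_cast p.one_le_l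
  have hn1 := h.large.thousand_le
  set L := Real.logb 2 p.n with hLdef
  set q := lastPhases p.c with hq
  have hw1 : (10 : ℝ) ^ 9 ≤ w := by nlinarith
  have hwn : w ≤ p.n := by
    rw [hn4]
    nlinarith [pow_le_pow_left₀ (by norm_num) hw1 2, pow_le_pow_left₀ (by norm_num) hw1 3]
  have hww : w ≤ w ^ 2 := by nlinarith
  have hLL : L ≤ L ^ 2 := by nlinarith
  have hT : ((i + q : ℕ) : ℝ) ≤ p.n := by
    have h5 := one_add_mul_le_pow (a := (0.1 : ℝ)) (by norm_num) i
    have h6 : (1 : ℝ) + 0.1 = 1.1 := by norm_num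
    rw [h6] at h5
    have h7 := h.mul_sq_le d1
    rw [hw] at h7
    have h8 : (q : ℝ) ≤ q * L ^ 2 := by
      refine le_mul_of_one_le_right (by positivity) ?_
      nlinarith
    push_cast
    nlinarith
  refine ⟨i, h1, h2, h4, hT, ⟨h.large, h.α_eq, hc, ?_, ?_, ?_⟩⟩
  · have h5 := h.mul_sq_le d2
    have h6 := h.l_le_mul
    rw [hw, ← hLdef] at h5
    rw [← hLdef] at h6
    rw [hn3]
    have hw3 : 0 < w ^ 3 := by positivity
    calc 4 * (p.l : ℝ) * w ^ 3 * L ≤ 4 * (C * L) * w ^ 3 * L := by gcongr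
      _ = 0.1 * w ^ 3 * (40 * C * L ^ 2) := by ring
      _ ≤ 0.1 * w ^ 3 * w := by gcongr
      _ = 0.1 * p.n := by rw [hn4]; ring
  · have h5 := h.mul_sq_le d3
    rw [hw, ← hLdef] at h5
    rw [hn3, pow_add]
    have hq0 : (0 : ℝ) < 0.95 ^ q := by positivity
    rw [div_mul_eq_mul_div, div_le_iff₀ hq0] at h5
    -- Because `0.95 * 1.1 > 1` and `1.1 ^ i ≤ 1.1 * L`, the decay `0.95 ^ i` until the cap loses
    -- only a factor of order `log n`.
    have h6 : (1 : ℝ) ≤ 0.95 ^ i * (1.1 * L) := by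
      calc (1 : ℝ) ≤ (0.95 * 1.1) ^ i := one_le_pow₀ (by norm_num)
        _ = 0.95 ^ i * 1.1 ^ i := mul_pow _ _ _
        _ ≤ _ := by gcongr
    have hi0 : (0 : ℝ) < 0.95 ^ i := by positivity
    calc w ^ 3 * L ≤ w ^ 3 * (0.01 * (0.95 ^ i * (120 * L ^ 2))) := by
          refine mul_le_mul_of_nonneg_left ?_ (by positivity)
          nlinarith
      _ ≤ w ^ 3 * (0.01 * (0.95 ^ i * (w * 0.95 ^ q))) := by gcongr
      _ = 0.01 * p.n * (0.95 ^ i * 0.95 ^ q) := by rw [hn4]; ring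
  · have e1 : Real.exp (-(√p.n / (24 * p.l ^ 2))) ≤ (p.n : ℝ) ^ (-(p.c + 4 + 1)) := by
      refine h.exp_neg_le (by linarith) ?_
      rw [le_div_iff₀ (by positivity), hn2, ← hLdef]
      have h5 := h.mul_sq_le d5
      have h6 := h.l_sq_le
      rw [hw, ← hLdef] at h5
      rw [← hLdef] at h6
      calc (p.c + 4 + 1) * L * (24 * (p.l : ℝ) ^ 2) ≤ (p.c + 4 + 1) * L * (24 * (C ^ 2 * L)) := by
            gcongr
        _ = 24 * C ^ 2 * (p.c + 5) * L ^ 2 := by ring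
        _ ≤ _ := h5.trans hww
    have h5 := h.mul_sq_le d6
    rw [hw, ← hLdef] at h5
    have hcL : 0 ≤ p.c * L := by positivity
    have h6 : 8 * (p.c + 6) * L ≤ w ^ 2 :=
      (mul_le_mul_of_nonneg_left hLL (by positivity)).trans (h5.trans hww)
    have e2 : Real.exp (-(√p.n / 2)) ≤ (p.n : ℝ) ^ (-(p.c + 4 + 1)) := by
      refine h.exp_neg_le (by linarith) ?_
      rw [le_div_iff₀ (by positivity), hn2, ← hLdef]
      linarith
    have e3 : Real.exp (-(√p.n / 8)) ≤ (p.n : ℝ) ^ (-(p.c + 4 + 1 + 1)) := by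
      refine h.exp_neg_le (by linarith) ?_
      rw [le_div_iff₀ (by positivity), hn2, ← hLdef]
      linarith
    have e4 : ((i + q : ℕ) : ℝ) * Real.exp (-(√p.n / 8)) ≤ (p.n : ℝ) ^ (-(p.c + 4 + 1)) := by
      calc _ ≤ (p.n : ℝ) * (p.n : ℝ) ^ (-(p.c + 4 + 1 + 1)) := by gcongr
        _ = _ := by rw [mul_comm, h.rpow_succ]
    have e5 := h.rpow_succ (p.c + 4)
    have e6 : (0 : ℝ) < (p.n : ℝ) ^ (-(p.c + 4 + 1)) := Real.rpow_pos_of_pos h.n_pos _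
    rw [← e5]
    have e7 := mul_le_mul_of_nonneg_left hn1 e6.le
    linarith

/-- Since `0.85 ^ 5 ≤ 1 / 2` and the floor is at least `log n / 2`, every capped phase gains a
factor `n ^ (-1 / 10)`; there are at least `10 * (c + 5)` of them. -/
lemma Ample.pow_lastPhases_le (h : Ample p C) :
    ((0.85 : ℝ) ^ ⌊Real.logb 2 p.n⌋₊) ^ lastPhases p.c ≤ (p.n : ℝ) ^ (-(p.c + 4 + 1)) := by
  have hL := h.thousand_le
  have h1 : (0.85 : ℝ) ^ ⌊Real.logb 2 p.n⌋₊ ≤ (p.n : ℝ) ^ (-(1 / 10) : ℝ) := by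
    rw [← h.half_rpow, ← Real.rpow_natCast]
    calc (0.85 : ℝ) ^ (⌊Real.logb 2 p.n⌋₊ : ℝ) ≤ 0.85 ^ (5 * (Real.logb 2 p.n * (1 / 10))) := by
          refine Real.rpow_le_rpow_of_exponent_ge (by norm_num) (by norm_num) ?_
          have := Nat.lt_floor_add_one (Real.logb 2 p.n)
          linarith
      _ = ((0.85 : ℝ) ^ (5 : ℝ)) ^ (Real.logb 2 p.n * (1 / 10)) := Real.rpow_mul (by norm_num) _ _
      _ ≤ _ := by
          refine Real.rpow_le_rpow (by positivity) ?_ (by linarith)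
          have : (0.85 : ℝ) ^ (5 : ℝ) = 0.85 ^ (5 : ℕ) := by rw [← Real.rpow_natCast]; norm_num
          rw [this]
          norm_num
  have h2 : 10 * (p.c + 5) ≤ lastPhases p.c := Nat.le_ceil _
  calc _ ≤ ((p.n : ℝ) ^ (-(1 / 10) : ℝ)) ^ lastPhases p.c := by gcongr
    _ = (p.n : ℝ) ^ (-(1 / 10) * (lastPhases p.c : ℝ)) := by
      rw [← Real.rpow_natCast, ← Real.rpow_mul h.n_pos.le]
    _ ≤ _ := by
      refine Real.rpow_le_rpow_of_exponent_le ?_ (by linarith)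
      linarith [h.large.thousand_le]

/-- The probability that a ball is not placed after the last phases. -/
lemma Ample.prob_placement_eq_none_le (h : Ample p C) {ρ : Rules p.n} {i : ℕ}
    (hi : p.k i = Real.logb 2 p.n)
    (hR : Regime p (i + lastPhases p.c) ((p.n : ℝ) ^ (-(p.c + 4)))) (b : p.Ball) :
    p.prob.real {ω | p.placement ρ ω (i + lastPhases p.c) b = none} ≤
      (1 + lastPhases p.c) * (p.n : ℝ) ^ (-(p.c + 4)) := by
  have h1 := hR.prob_placement_add_le (ρ := ρ) hi (lastPhases p.c) (by omega) b
  have h2 := h.pow_lastPhases_le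
  have h3 : (p.n : ℝ) ^ (-(p.c + 4 + 1)) ≤ (p.n : ℝ) ^ (-(p.c + 4)) := by
    refine Real.rpow_le_rpow_of_exponent_le ?_ (by linarith)
    linarith [h.large.thousand_le]
  linarith

lemma Ample.lastPhases_le (h : Ample p C) : 1000 + (lastPhases p.c : ℝ) ≤ p.n := by
  obtain ⟨w, hw, hn4, -, -, hLw⟩ := h.root
  have hL := h.thousand_le
  have hw1 : (10 : ℝ) ^ 9 ≤ w := by nlinarith
  have hwn : w ≤ p.n := by
    rw [hn4]
    nlinarith [pow_le_pow_left₀ (by norm_num) hw1 2, pow_le_pow_left₀ (by norm_num) hw1 3]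
  have h1 := h.mul_sq_le h.le_threshold.1
  rw [hw] at h1
  have h2 : 1000 + (lastPhases p.c : ℝ) ≤ (1000 + (lastPhases p.c : ℝ)) * Real.logb 2 p.n ^ 2 :=
    le_mul_of_one_le_right (by positivity) (by nlinarith)
  linarith

lemma Ample.prob_exists_placement_eq_none_le (h : Ample p C) {ρ : Rules p.n} {i : ℕ}
    (hi : p.k i = Real.logb 2 p.n)
    (hR : Regime p (i + lastPhases p.c) ((p.n : ℝ) ^ (-(p.c + 4)))) :
    p.prob {ω | ∃ b, p.placement ρ ω (i + lastPhases p.c) b = none} ≤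
      ENNReal.ofReal ((1 + lastPhases p.c) * (p.n : ℝ) ^ (-(p.c + 3))) := by
  have h1 := prob_exists_fin_le (p := p)
    (E := fun b ω => p.placement ρ ω (i + lastPhases p.c) b = none) (q := ENNReal.ofReal
      ((1 + lastPhases p.c) * (p.n : ℝ) ^ (-(p.c + 4)))) fun b : p.Ball => by
    rw [← ofReal_measureReal]
    exact ENNReal.ofReal_le_ofReal (h.prob_placement_eq_none_le (ρ := ρ) hi hR b)
  refine h1.trans (le_of_eq ?_)
  rw [← ENNReal.ofReal_natCast, ← ENNReal.ofReal_mul h.n_pos.le, ← h.rpow_succ (p.c + 3)]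
  congr 1
  have : p.c + 3 + 1 = p.c + 4 := by ring
  rw [this]
  ring

/-- The failure probabilities that occur are small. -/
lemma Ample.whp_bound (h : Ample p C) :
    (5 + lastPhases p.c) * (p.n : ℝ) ^ (-(p.c + 3)) ≤ 1 / (p.n : ℝ) ^ p.c := by
  have h1 := h.lastPhases_le
  have h2 : (p.n : ℝ) ^ (-(p.c + 1)) ≤ (p.n : ℝ) ^ (-p.c) := by
    refine Real.rpow_le_rpow_of_exponent_le ?_ (by linarith)
    linarith [h.large.thousand_le]
  have h3 : (p.n : ℝ) ^ (-(p.c + 3)) ≤ (p.n : ℝ) ^ (-(p.c + 1 + 1)) := by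
    refine Real.rpow_le_rpow_of_exponent_le ?_ (by linarith)
    linarith [h.large.thousand_le]
  have h4 := h.rpow_succ (p.c + 1)
  have h5 : (0 : ℝ) < (p.n : ℝ) ^ (-(p.c + 1 + 1)) := Real.rpow_pos_of_pos h.n_pos _
  rw [one_div, ← Real.rpow_neg h.n_pos.le]
  calc _ ≤ (p.n : ℝ) * (p.n : ℝ) ^ (-(p.c + 1 + 1)) := by
        gcongr
        linarith
    _ = (p.n : ℝ) ^ (-(p.c + 1)) := by rw [mul_comm, h4]
    _ ≤ _ := h2

/-- With `log n = z ^ 4` and `z ≥ 5`, one has `4 * log z ≤ 4 * z ≤ z ^ 2`. -/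
lemma Ample.logb_logb (h : Ample p C) : 0 < Real.logb 2 (Real.logb 2 p.n) ∧
    Real.logb 2 (Real.logb 2 p.n) ≤ √(Real.logb 2 p.n) := by
  have hL := h.thousand_le
  refine ⟨Real.logb_pos one_lt_two (by linarith), ?_⟩
  set L := Real.logb 2 p.n
  obtain ⟨z, hz⟩ : ∃ z, z = √(√L) := ⟨_, rfl⟩
  have hz0 : 0 ≤ z := hz ▸ Real.sqrt_nonneg _
  have hz2 : z ^ 2 = √L := by rw [hz, Real.sq_sqrt (Real.sqrt_nonneg _)]
  have hz4 : L = z ^ 4 := by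
    calc L = (√L) ^ 2 := (Real.sq_sqrt (by linarith)).symm
      _ = _ := by rw [← hz2]; ring
  have hz5 : 5 ≤ z := by
    by_contra hlt
    have : z ^ 4 ≤ 5 ^ 4 := pow_le_pow_left₀ hz0 (by linarith) 4
    norm_num at this
    linarith
  have h1 : Real.logb 2 z ≤ z - 0 := by
    rw [sub_zero, Real.logb_le_iff_le_rpow one_lt_two (by linarith)]
    have h2 := one_add_mul_self_le_rpow_one_add (s := 1) (p := z) (by norm_num) (by linarith)
    norm_num at h2
    linarith
  have h2 : Real.logb 2 L = 4 * Real.logb 2 z := by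
    rw [hz4, Real.logb_pow]
    norm_num
  rw [h2, ← hz2]
  nlinarith

end Ample

end Params

end BallsIntoBins

namespace BallsIntoBins

/-- The constant hidden in the bounds on the running time and the number of messages. -/
noncomputable def hiddenConstant (c C : ℝ) : ℕ :=
  200 + 2 * lastPhases c + ⌈2 * C + 2 * C ^ 2 + 27 + (10 * (c + 5) + C + 5)⌉₊

namespace Params

lemma WHP.mono {p : Params} {E F : p.Outcome → Prop} (hE : p.WHP E) (h : ∀ ω, E ω → F ω) :
    p.WHP F := by
  refine le_trans (measure_mono ?_) hE
  exact fun ω hω hEω => hω (h ω hEω)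

/-! ### The claims for large `n`, each with its failure probability -/

section Main

variable {p : Params} {C : ℝ} {ρ : Rules p.n} {i : ℕ}

/-- A common budget: four units of `n ^ (-(c + 3))` for `E` itself and `1 + lastPhases c` units for
balls left unplaced. -/
lemma Ample.whp_of_prob_le (h : Ample p C) {E : p.Outcome → Prop} {x : ℝ}
    (hi : p.k i = Real.logb 2 p.n)
    (hR : Regime p (i + lastPhases p.c) ((p.n : ℝ) ^ (-(p.c + 4))))
    (hx : 0 ≤ x) (hx' : x ≤ 4 * (p.n : ℝ) ^ (-(p.c + 3)))
    (hE : p.prob {ω | ¬ E ω} ≤ ENNReal.ofReal x +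
      p.prob {ω | ∃ b, p.placement ρ ω (i + lastPhases p.c) b = none}) : p.WHP E := by
  have h0 : (0 : ℝ) ≤ (p.n : ℝ) ^ (-(p.c + 3)) := (Real.rpow_pos_of_pos h.n_pos _).le
  refine (hE.trans (add_le_add_right (h.prob_exists_placement_eq_none_le hi hR) _)).trans ?_
  rw [← ENNReal.ofReal_add hx (by positivity)]
  refine ENNReal.ofReal_le_ofReal (le_trans ?_ h.whp_bound)
  linarith

lemma Ample.whp_of_placed (h : Ample p C) {E : p.Outcome → Prop}
    (hi : p.k i = Real.logb 2 p.n)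
    (hR : Regime p (i + lastPhases p.c) ((p.n : ℝ) ^ (-(p.c + 4))))
    (hE : ∀ ω, (∀ b, p.placement ρ ω (i + lastPhases p.c) b ≠ none) → E ω) : p.WHP E := by
  refine h.whp_of_prob_le (ρ := ρ) (x := 0) hi hR le_rfl
    (mul_nonneg (by norm_num) (Real.rpow_pos_of_pos h.n_pos _).le) ?_
  rw [ENNReal.ofReal_zero, zero_add]
  refine measure_mono fun ω hω => ?_
  by_contra hn
  have hn' : ∀ b, p.placement ρ ω (i + lastPhases p.c) b ≠ none := fun b hb => hn ⟨b, hb⟩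
  exact hω (hE ω hn')

lemma Ample.rpow_neg_add_four_le (h : Ample p C) :
    (p.n : ℝ) ^ (-(p.c + 4)) ≤ (p.n : ℝ) ^ (-(p.c + 3)) :=
  Real.rpow_le_rpow_of_exponent_le (by linarith [h.large.thousand_le]) (by linarith)

lemma Ample.cube_mul_rpow_le (h : Ample p C) :
    (p.n : ℝ) * p.n * (p.n * (p.n : ℝ) ^ (-(p.c + 4))) ≤ 1 := by
  have h1 := h.rpow_succ (p.c + 3)
  have h2 := h.rpow_succ (p.c + 2)
  have h3 := h.rpow_succ (p.c + 1)
  rw [show p.c + 3 + 1 = p.c + 4 by ring] at h1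
  rw [show p.c + 2 + 1 = p.c + 3 by ring] at h2
  rw [show p.c + 1 + 1 = p.c + 2 by ring] at h3
  calc (p.n : ℝ) * p.n * (p.n * (p.n : ℝ) ^ (-(p.c + 4)))
      = (p.n : ℝ) ^ (-(p.c + 4)) * p.n * p.n * p.n := by ring
    _ = (p.n : ℝ) ^ (-(p.c + 1)) := by rw [h1, h2, h3]
    _ ≤ 1 := Real.rpow_le_one_of_one_le_of_nonpos (by linarith [h.large.thousand_le])
        (by linarith [h.c_pos])

lemma Ample.mul_rpow_le_one (h : Ample p C) {T : ℕ} (hT : (T : ℝ) ≤ p.n) :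
    T * Real.logb 2 p.n * (p.n : ℝ) ^ (-(p.c + 4)) ≤ 1 := by
  have h0 : (0 : ℝ) ≤ (p.n : ℝ) ^ (-(p.c + 4)) := (Real.rpow_pos_of_pos h.n_pos _).le
  have hL := h.thousand_le
  have hn := h.large.thousand_le
  refine le_trans ?_ h.cube_mul_rpow_le
  calc _ ≤ (p.n : ℝ) * p.n * (1 * (p.n : ℝ) ^ (-(p.c + 4))) := by
        rw [one_mul]
        gcongr
        exact logb_two_le_self _
    _ ≤ _ := by
        gcongr
        linarith

lemma Ample.mul_prob_placement_le_one (h : Ample p C) (hi : p.k i = Real.logb 2 p.n)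
    (hR : Regime p (i + lastPhases p.c) ((p.n : ℝ) ^ (-(p.c + 4)))) (b : p.Ball) :
    p.n * Real.logb 2 p.n *
      p.prob.real {ω | p.placement ρ ω (i + lastPhases p.c) b = none} ≤ 1 := by
  have h0 : (0 : ℝ) ≤ (p.n : ℝ) ^ (-(p.c + 4)) := (Real.rpow_pos_of_pos h.n_pos _).le
  have hL := h.thousand_le
  have h1 := h.prob_placement_eq_none_le (ρ := ρ) hi hR b
  have h2 := h.lastPhases_le
  refine le_trans ?_ h.cube_mul_rpow_le
  refine mul_le_mul ?_ (h1.trans ?_) measureReal_nonneg (by positivity)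
  · gcongr
    exact logb_two_le_self _
  · gcongr
    linarith

lemma hiddenConstant_ge {c : ℝ} (C : ℝ) : 2 * C + 2 * C ^ 2 + 27 + (10 * (c + 5) + C + 5) + 200 +
    2 * lastPhases c ≤ hiddenConstant c C := by
  have := Nat.le_ceil (2 * C + 2 * C ^ 2 + 27 + (10 * (c + 5) + C + 5))
  unfold hiddenConstant
  push_cast
  linarith

lemma natCast_le_hiddenConstant {k : ℕ} (hk : k ≤ 200) (c C : ℝ) :
    (k : ℝ≥0∞) ≤ (hiddenConstant c C : ℝ≥0∞) := by
  refine Nat.cast_le.2 ?_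
  unfold hiddenConstant
  omega

lemma Ample.whp_rounds (h : Ample p C) (hi : p.k i = Real.logb 2 p.n)
    (hi' : i + logStar p.l ≤ logStar p.n + 30)
    (hR : Regime p (i + lastPhases p.c) ((p.n : ℝ) ^ (-(p.c + 4)))) :
    p.WHP (fun ω => p.rounds ρ ω + (logStar p.l : ℕ∞) ≤
      (logStar p.n : ℕ∞) + (hiddenConstant p.c C : ℕ∞)) := by
  refine h.whp_of_placed (ρ := ρ) hi hR fun ω hω => ?_
  refine (add_le_add_left (rounds_le_of_placement hω) _).trans ?_
  have : i + lastPhases p.c + 8 + logStar p.l ≤ logStar p.n + hiddenConstant p.c C := by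
    unfold hiddenConstant
    omega
  exact_mod_cast this

/-- A coordinator handles at most `l ^ 2` bins, which is `O(log n)` by the assumption on `l`. The
requests before the cap sum geometrically to `11 * log n`, and each of the constantly many later
phases adds at most `log n`. -/
lemma Ample.whp_ball (h : Ample p C) (hi : p.k i = Real.logb 2 p.n)
    (hsum : ∑ j ∈ Finset.range i, p.k j ≤ 11 * Real.logb 2 p.n)
    (hR : Regime p (i + lastPhases p.c) ((p.n : ℝ) ^ (-(p.c + 4)))) :
    p.WHP (fun ω => ∀ b,
      p.sentByBall ρ ω b ≤ ENNReal.ofReal (hiddenConstant p.c C * Real.logb 2 p.n) ∧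
      p.receivedByBall ρ ω b ≤ ENNReal.ofReal (hiddenConstant p.c C * Real.logb 2 p.n)) := by
  refine h.whp_of_placed (ρ := ρ) hi hR fun ω hω b => ?_
  have h1 := hR.ball_messages_le hω b
  have h2 : 2 * (p.l : ℝ) + 2 * p.l ^ 2 + 5 + 2 * ∑ j ∈ Finset.range (i + lastPhases p.c), p.k j ≤
      hiddenConstant p.c C * Real.logb 2 p.n := by
    have hL := h.thousand_le
    have hl := h.l_le_mul
    have hl2 := h.l_sq_le
    have hC := h.C_pos
    have hc := h.c_pos
    have hK := hiddenConstant_ge (c := p.c) C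
    have h3 : ∑ j ∈ Finset.range (i + lastPhases p.c), p.k j ≤
        (11 + lastPhases p.c) * Real.logb 2 p.n := by
      rw [Finset.sum_range_add]
      have h4 : ∑ j ∈ Finset.range (lastPhases p.c), p.k (i + j) ≤
          ∑ j ∈ Finset.range (lastPhases p.c), Real.logb 2 p.n :=
        Finset.sum_le_sum fun j _ => k_le_logb _
      rw [Finset.sum_const, Finset.card_range, nsmul_eq_mul] at h4
      linarith
    calc _ ≤ (2 * C + 2 * C ^ 2 + 5 + 2 * (11 + lastPhases p.c)) * Real.logb 2 p.n := by
          linarith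
      _ ≤ _ := by
          refine mul_le_mul_of_nonneg_right ?_ (by linarith)
          linarith
  have h3 := h1.trans (ENNReal.ofReal_le_ofReal h2)
  exact ⟨(sentByBall_le b).trans h3, (receivedByBall_le b).trans h3⟩

/-- The base is about `√(log n) = 2 ^ (log log n / 2)`, so the power is at most `2 ^ (-(c + 5) * log
n) = n ^ (-(c + 5))`. The factor `exp (21 * √(log n))` costs at most one more `n`, since `√(log n) ≥
31`. -/
lemma Ample.rpow_mul_exp_le (h : Ample p C) :
    (1 + √(Real.logb 2 p.n)) ^
      (-(2 * (p.c + 5) * (Real.logb 2 p.n / Real.logb 2 (Real.logb 2 p.n)))) *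
      Real.exp (21 * √(Real.logb 2 p.n)) ≤ (p.n : ℝ) ^ (-(p.c + 4)) := by
  have hL := h.thousand_le
  have hc := h.c_pos
  obtain ⟨hM, -⟩ := h.logb_logb
  have h3 := Real.log_two_gt_d9
  have hn : (p.n : ℝ) = Real.exp (Real.logb 2 p.n * Real.log 2) := by
    rw [Real.logb, div_mul_cancel₀ _ (by linarith), Real.exp_log h.n_pos]
  have hsq : (√(Real.logb 2 p.n)) ^ 2 = Real.logb 2 p.n := Real.sq_sqrt (by linarith)
  have hs0 : 31 ≤ √(Real.logb 2 p.n) := Real.le_sqrt_of_sq_le (by linarith)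
  have e1 : Real.exp (21 * √(Real.logb 2 p.n)) ≤ p.n := by
    rw [hn, Real.exp_le_exp, ← hn]
    nlinarith
  have e2 : (1 + √(Real.logb 2 p.n)) ^
      (-(2 * (p.c + 5) * (Real.logb 2 p.n / Real.logb 2 (Real.logb 2 p.n)))) ≤
      (p.n : ℝ) ^ (-(p.c + 4 + 1)) := by
    calc _ ≤ (√(Real.logb 2 p.n)) ^
          (-(2 * (p.c + 5) * (Real.logb 2 p.n / Real.logb 2 (Real.logb 2 p.n)))) :=
          Real.rpow_le_rpow_of_nonpos (by linarith) (by linarith)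
            (neg_nonpos.2 (by positivity))
      _ = ((2 : ℝ) ^ Real.logb 2 p.n) ^ (-(p.c + 4 + 1)) := by
          rw [Real.sqrt_eq_rpow]
          nth_rewrite 1 [← Real.rpow_logb two_pos (by norm_num) (show 0 < Real.logb 2 p.n by linarith)]
          rw [← Real.rpow_mul two_pos.le, ← Real.rpow_mul two_pos.le, ← Real.rpow_mul two_pos.le]
          congr 1
          field_simp
          ring
      _ = _ := by rw [h.two_rpow_logb]
  calc _ ≤ (p.n : ℝ) ^ (-(p.c + 4 + 1)) * p.n := by gcongr
    _ = _ := h.rpow_succ _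

/-- The exponential moment bound is used with `y = √(log n)`. Queries contribute up to `l ≤ C *
√(log n)`, which is of the right order since `log log n ≤ √(log n)`. -/
lemma Ample.whp_bin (h : Ample p C) (hi : p.k i = Real.logb 2 p.n)
    (hR : Regime p (i + lastPhases p.c) ((p.n : ℝ) ^ (-(p.c + 4)))) :
    p.WHP (fun ω => ∀ v,
      p.sentByBin ρ ω v ≤ ENNReal.ofReal
        (hiddenConstant p.c C * (Real.logb 2 p.n / Real.logb 2 (Real.logb 2 p.n))) ∧
      p.receivedByBin ρ ω v ≤ ENNReal.ofReal
        (hiddenConstant p.c C * (Real.logb 2 p.n / Real.logb 2 (Real.logb 2 p.n)))) := by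
  have hL := h.thousand_le
  have hC := h.C_pos
  have hc := h.c_pos
  obtain ⟨hM, hM'⟩ := h.logb_logb
  set t := 2 * (p.c + 5) * (Real.logb 2 p.n / Real.logb 2 (Real.logb 2 p.n)) with ht
  have h1 := hR.prob_bin_messages_gt_le (ρ := ρ) (t := t) (Real.sqrt_nonneg (Real.logb 2 p.n))
  have h2 := h.rpow_mul_exp_le
  rw [← ht] at h2
  have h3 := h.rpow_neg_add_four_le
  have h4 := h.rpow_succ (p.c + 3)
  rw [show p.c + 3 + 1 = p.c + 4 by ring] at h4
  have h0 : (0 : ℝ) ≤ (p.n : ℝ) ^ (-(p.c + 4)) := (Real.rpow_pos_of_pos h.n_pos _).le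
  refine h.whp_of_prob_le (ρ := ρ) hi hR ?_ ?_ (le_trans (measure_mono fun ω hω => ?_) h1)
  · positivity
  · have h5 := mul_le_mul_of_nonneg_left h2 h.n_pos.le
    linarith
  · intro hb
    refine hω fun v => ?_
    have h5 : √(Real.logb 2 p.n) ≤ Real.logb 2 p.n / Real.logb 2 (Real.logb 2 p.n) := by
      rw [le_div_iff₀ hM]
      calc _ ≤ √(Real.logb 2 p.n) * √(Real.logb 2 p.n) := by gcongr
        _ = _ := Real.mul_self_sqrt (by linarith)
    have h6 : 1 ≤ √(Real.logb 2 p.n) := Real.le_sqrt_of_sq_le (by linarith)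
    have h7 : 5 * t + p.l + 5 ≤
        hiddenConstant p.c C * (Real.logb 2 p.n / Real.logb 2 (Real.logb 2 p.n)) := by
      have hK := hiddenConstant_ge (c := p.c) C
      have h8 : (p.l : ℝ) ≤ C * (Real.logb 2 p.n / Real.logb 2 (Real.logb 2 p.n)) :=
        h.l_le.trans (mul_le_mul_of_nonneg_left h5 hC.le)
      have h9 : (0 : ℝ) ≤ lastPhases p.c := by positivity
      calc _ ≤ (10 * (p.c + 5) + C + 5) *
            (Real.logb 2 p.n / Real.logb 2 (Real.logb 2 p.n)) := by
            rw [ht]; linarith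
        _ ≤ _ := by
            refine mul_le_mul_of_nonneg_right ?_ (by linarith)
            nlinarith
    exact ⟨((hb v).1).trans (ENNReal.ofReal_le_ofReal h7),
      ((hb v).2).trans (ENNReal.ofReal_le_ofReal h7)⟩

lemma Ample.whp_totalMessages (h : Ample p C) (hi : p.k i = Real.logb 2 p.n)
    (hR : Regime p (i + lastPhases p.c) ((p.n : ℝ) ^ (-(p.c + 4)))) :
    p.WHP (fun ω => p.totalMessages ρ ω ≤
      (hiddenConstant p.c C : ℝ≥0∞) * (p.n : ℝ≥0∞)) := by
  have hL := h.thousand_le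
  have hc := h.c_pos
  have h1 := hR.prob_totalMessages_gt_le (ρ := ρ)
  have h3 := h.rpow_neg_add_four_le
  have h0 : (0 : ℝ) ≤ (p.n : ℝ) ^ (-(p.c + 4)) := (Real.rpow_pos_of_pos h.n_pos _).le
  have h2 : Real.exp (-(p.n / p.l)) ≤ (p.n : ℝ) ^ (-(p.c + 4)) := by
    have hl : (0 : ℝ) < p.l := by exact_mod_cast p.one_le_l
    refine h.exp_neg_le (by linarith) ?_
    rw [le_div_iff₀ hl]
    obtain ⟨w, hw, hn4, -, -, hLw⟩ := h.root
    have hw1 : (10 : ℝ) ^ 9 ≤ w := by nlinarith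
    have hwn : w ≤ p.n := by
      rw [hn4]
      nlinarith [pow_le_pow_left₀ (by norm_num) hw1 2, pow_le_pow_left₀ (by norm_num) hw1 3]
    have h5 := h.mul_sq_le h.le_threshold.2.2.2.2.2.2
    rw [hw] at h5
    calc (p.c + 4) * Real.logb 2 p.n * p.l ≤ (p.c + 4) * Real.logb 2 p.n * (C * Real.logb 2 p.n) := by
          gcongr
          exact h.l_le_mul
      _ = C * (p.c + 4) * Real.logb 2 p.n ^ 2 := by ring
      _ ≤ _ := h5.trans hwn
  refine h.whp_of_prob_le (ρ := ρ) hi hR ?_ ?_ (le_trans (measure_mono fun ω hω => ?_) h1)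
  · positivity
  · linarith
  · intro hb
    refine hω (le_trans hb ?_)
    gcongr
    exact natCast_le_hiddenConstant (k := 106) (by norm_num) _ _

end Main

end Params

/-- Part two of the main theorem, for a large number of balls. -/
theorem Params.Ample.main {p : Params} {C : ℝ} (h : Params.Ample p C) (ρ : Rules p.n) :
    p.WHP (fun ω => p.rounds ρ ω + (logStar p.l : ℕ∞) ≤
      (logStar p.n : ℕ∞) + (hiddenConstant p.c C : ℕ∞)) ∧
    (∀ b, ∫⁻ ω, p.sentByBall ρ ω b ∂p.prob ≤ (hiddenConstant p.c C : ENNReal) ∧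
      ∫⁻ ω, p.receivedByBall ρ ω b ∂p.prob ≤ (hiddenConstant p.c C : ENNReal)) ∧
    (∀ v, ∫⁻ ω, p.sentByBin ρ ω v ∂p.prob ≤ (hiddenConstant p.c C : ENNReal) ∧
      ∫⁻ ω, p.receivedByBin ρ ω v ∂p.prob ≤ (hiddenConstant p.c C : ENNReal)) ∧
    p.WHP (fun ω => ∀ b,
      p.sentByBall ρ ω b ≤ ENNReal.ofReal (hiddenConstant p.c C * Real.logb 2 p.n) ∧
      p.receivedByBall ρ ω b ≤ ENNReal.ofReal (hiddenConstant p.c C * Real.logb 2 p.n)) ∧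
    p.WHP (fun ω => ∀ v,
      p.sentByBin ρ ω v ≤ ENNReal.ofReal
        (hiddenConstant p.c C * (Real.logb 2 p.n / Real.logb 2 (Real.logb 2 p.n))) ∧
      p.receivedByBin ρ ω v ≤ ENNReal.ofReal
        (hiddenConstant p.c C * (Real.logb 2 p.n / Real.logb 2 (Real.logb 2 p.n)))) ∧
    p.WHP (fun ω => p.totalMessages ρ ω ≤
      (hiddenConstant p.c C : ENNReal) * (p.n : ENNReal)) := by
  obtain ⟨i, hi, hi', hsum, hT, hR⟩ := h.exists_regime
  have hε := h.mul_rpow_le_one hT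
  have hpl := h.mul_prob_placement_le_one (ρ := ρ) hi hR
  have hK : (130 : ℝ≥0∞) ≤ (hiddenConstant p.c C : ℝ≥0∞) :=
    Params.natCast_le_hiddenConstant (k := 130) (by norm_num) _ _
  refine ⟨h.whp_rounds hi hi' hR, fun b => ⟨?_, ?_⟩, fun v => ⟨?_, ?_⟩, h.whp_ball hi hsum hR,
    h.whp_bin hi hR, h.whp_totalMessages hi hR⟩
  · exact (lintegral_mono fun ω => Params.sentByBall_le b).trans
      ((hR.lintegral_ball_messages_le hε hpl b).trans hK)
  · exact (lintegral_mono fun ω => Params.receivedByBall_le b).trans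
      ((hR.lintegral_ball_messages_le hε hpl b).trans hK)
  · exact (lintegral_mono fun ω => Params.sentByBin_le v).trans
      ((hR.lintegral_bin_messages_le hε hpl v).trans hK)
  · exact (lintegral_mono fun ω => Params.receivedByBin_le v).trans
      ((hR.lintegral_bin_messages_le hε hpl v).trans hK)

/-! ## The choice of the interval length -/

lemma one_le_floor_min {n r : ℕ} (hn : 2 ≤ n) (hr : r < logStar n) :
    1 ≤ ⌊min (iterLog r n) √(Real.logb 2 n)⌋₊ := by
  have hL : 1 ≤ Real.logb 2 n := by
    rw [Real.le_logb_iff_rpow_le one_lt_two (by positivity), Real.rpow_one]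
    exact_mod_cast hn
  rw [Nat.one_le_floor_iff]
  exact le_min (one_lt_iterLog hr).le (Real.le_sqrt_of_sq_le (by linarith))

lemma floor_min_le (n r : ℕ) (h : 1 ≤ ⌊min (iterLog r n) √(Real.logb 2 n)⌋₊) :
    ((⌊min (iterLog r n) √(Real.logb 2 n)⌋₊ : ℕ) : ℝ) ≤ √(Real.logb 2 n) :=
  (Nat.floor_le (zero_le_one.trans (Nat.one_le_floor_iff _ |>.1 h))).trans (min_le_right _ _)

/-- Rounding up, `l + 1` exceeds one of the two terms. If it is the iterated logarithm, rounding
costs one iteration. If it is the square root, then `log n ≤ (l + 1) ^ 2` gives `logStar n ≤ logStar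
l + 3`, and `1 ≤ r` makes up the difference. -/
lemma logStar_le_floor_min {n r : ℕ} (hn : 2 ≤ n) (hr1 : 1 ≤ r) (hr : r < logStar n) :
    logStar n ≤ r + logStar ⌊min (iterLog r n) √(Real.logb 2 n)⌋₊ + 2 := by
  have hl := one_le_floor_min hn hr
  set l := ⌊min (iterLog r n) √(Real.logb 2 n)⌋₊ with hldef
  have hlt := Nat.lt_floor_add_one (min (iterLog r n) √(Real.logb 2 n))
  rw [← hldef] at hlt
  rcases min_lt_iff.1 hlt with h | h
  · have h1 := logStar_eq_add hr.le
    have h2 := logStar_le_of_le_add_one hl h.le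
    omega
  · have hL : Real.logb 2 n ≤ ((l : ℝ) + 1) ^ 2 :=
      (Real.sqrt_le_left (by positivity)).1 h.le
    have h1 : logStar n = logStar (Real.logb 2 n) + 1 :=
      logStar_of_one_lt (by exact_mod_cast hn)
    have h2 := logStar_le_of_le_sq hl hL
    omega

end BallsIntoBins

/-! ### The main theorem -/

theorem mainTheorem8 :
    ∃ α : ℝ, 0 < α ∧
      -- the algorithm terminates almost surely, with every ball in a bin and at most three per bin
      (∀ p : BallsIntoBins.Params, p.α = α → 0 < p.c → ∀ ρ : BallsIntoBins.Rules p.n,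
        (∀ ω t v, p.load (p.position ρ ω t) v ≤ 3) ∧
        (∀ᵐ ω ∂p.prob, ∃ t, p.TerminatedBy ρ ω t)) ∧
      -- running time and messages, for `l ∈ O(√(log n))`
      (∀ c : ℝ, 0 < c → ∀ C : ℝ, 0 < C → ∃ K n₀ : ℕ,
        ∀ p : BallsIntoBins.Params, p.α = α → p.c = c → n₀ ≤ p.n →
        (p.l : ℝ) ≤ C * √(Real.logb 2 p.n) → ∀ ρ : BallsIntoBins.Rules p.n,
        p.WHP (fun ω => p.rounds ρ ω + (BallsIntoBins.logStar p.l : ℕ∞) ≤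
          (BallsIntoBins.logStar p.n : ℕ∞) + (K : ℕ∞)) ∧
        (∀ b, ∫⁻ ω, p.sentByBall ρ ω b ∂p.prob ≤ (K : ENNReal) ∧
          ∫⁻ ω, p.receivedByBall ρ ω b ∂p.prob ≤ (K : ENNReal)) ∧
        (∀ v, ∫⁻ ω, p.sentByBin ρ ω v ∂p.prob ≤ (K : ENNReal) ∧
          ∫⁻ ω, p.receivedByBin ρ ω v ∂p.prob ≤ (K : ENNReal)) ∧
        p.WHP (fun ω => ∀ b,
          p.sentByBall ρ ω b ≤ ENNReal.ofReal (K * Real.logb 2 p.n) ∧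
          p.receivedByBall ρ ω b ≤ ENNReal.ofReal (K * Real.logb 2 p.n)) ∧
        p.WHP (fun ω => ∀ v,
          p.sentByBin ρ ω v ≤
            ENNReal.ofReal (K * (Real.logb 2 p.n / Real.logb 2 (Real.logb 2 p.n))) ∧
          p.receivedByBin ρ ω v ≤
            ENNReal.ofReal (K * (Real.logb 2 p.n / Real.logb 2 (Real.logb 2 p.n)))) ∧
        p.WHP (fun ω => p.totalMessages ρ ω ≤ (K : ENNReal) * (p.n : ENNReal))) ∧
      -- the choice `l = log^(r) n`
      (∀ c : ℝ, 0 < c → ∃ K n₀ : ℕ, ∀ n r : ℕ, n₀ ≤ n → 1 ≤ r → r < BallsIntoBins.logStar n →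
        ∃ p : BallsIntoBins.Params, p.n = n ∧ p.α = α ∧ p.c = c ∧
          p.l = ⌊min (BallsIntoBins.iterLog r n) √(Real.logb 2 n)⌋₊ ∧
          ∀ ρ : BallsIntoBins.Rules p.n,
            p.WHP (fun ω => p.rounds ρ ω ≤ ((r + K : ℕ) : ℕ∞))) := by
  -- The bound `n₀` comes from `threshold c C` and is therefore uniform in `l`.
  have key : ∀ c : ℝ, 0 < c → ∀ C : ℝ, 0 < C → ∃ n₀ : ℕ, ∀ p : BallsIntoBins.Params,
      p.α = 1 / 10 → p.c = c → n₀ ≤ p.n → (p.l : ℝ) ≤ C * √(Real.logb 2 p.n) →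
      BallsIntoBins.Params.Ample p C := by
    intro c hc C hC
    obtain ⟨n₀, hn₀⟩ := Filter.eventually_atTop.1
      (BallsIntoBins.eventually_threshold (BallsIntoBins.threshold c C))
    refine ⟨n₀, fun p hα hpc hn hl => ?_⟩
    subst hpc
    exact ⟨hα, hc, hC, hl, (hn₀ _ hn).1, (hn₀ _ hn).2⟩
  refine ⟨1 / 10, by norm_num, fun p hα _ ρ => ⟨fun ω t v =>
    BallsIntoBins.Params.load_position_le t v,
    BallsIntoBins.Params.ae_exists_terminatedBy (by rw [hα]; norm_num)⟩, ?_, ?_⟩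
  · intro c hc C hC
    obtain ⟨n₀, hn₀⟩ := key c hc C hC
    refine ⟨BallsIntoBins.hiddenConstant c C, n₀, fun p hα hpc hn hl ρ => ?_⟩
    have h := (hn₀ p hα hpc hn hl).main ρ
    subst hpc
    exact h
  · intro c hc
    obtain ⟨n₀, hn₀⟩ := key c hc 1 one_pos
    refine ⟨BallsIntoBins.hiddenConstant c 1 + 2, max n₀ 2, fun n r hn hr1 hr => ?_⟩
    have hn2 : 2 ≤ n := (le_max_right _ _).trans hn
    have hl := BallsIntoBins.one_le_floor_min hn2 hr
    have hl2 := BallsIntoBins.floor_min_le n r hl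
    have hlog := BallsIntoBins.logStar_le_floor_min hn2 hr1 hr
    have hL : 1 ≤ Real.logb 2 n := by
      rw [Real.le_logb_iff_rpow_le one_lt_two (by positivity), Real.rpow_one]
      exact_mod_cast hn2
    refine ⟨⟨n, ⌊min (BallsIntoBins.iterLog r n) √(Real.logb 2 n)⌋₊, c, 1 / 10, hl, ?_⟩, rfl, rfl,
      rfl, rfl, fun ρ => ?_⟩
    · have h1 := pow_le_pow_left₀ (Nat.cast_nonneg _) hl2 2
      rw [Real.sq_sqrt (by linarith)] at h1
      exact_mod_cast h1.trans (BallsIntoBins.Params.logb_two_le_self n)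
    · refine BallsIntoBins.Params.WHP.mono (hn₀ _ rfl rfl ((le_max_left _ _).trans hn)
        (by rw [one_mul]; exact hl2) |>.main ρ).1 fun ω hb => ?_
      -- The bound has the form `R + logStar l ≤ logStar n + K`. To cancel `logStar l`, the number
      -- of rounds must first be seen to be finite.
      generalize BallsIntoBins.Params.rounds _ ρ ω = R at hb ⊢
      have hb' : R + (BallsIntoBins.logStar ⌊min (BallsIntoBins.iterLog r n)
          √(Real.logb 2 n)⌋₊ : ℕ∞) ≤
          (BallsIntoBins.logStar n : ℕ∞) + (BallsIntoBins.hiddenConstant c 1 : ℕ∞) := hb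
      have hR : R ≠ ⊤ := by
        rintro rfl
        rw [top_add, top_le_iff] at hb'
        exact ENat.natCast_ne_top (BallsIntoBins.logStar n + BallsIntoBins.hiddenConstant c 1)
          (by exact_mod_cast hb')
      lift R to ℕ using hR
      norm_cast at hb' ⊢
      omega
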